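/- **Setting.** Let $q_1,q_2,q_3\in\mathbb C$ with $q_1q_2q_3=1$ and $g(z,w)=(z-q_1w)(z-q_2w)(z-q_3w)$. Let $\mathcal E$ (quantum continuous $\mathfrak{gl}_\infty$) be the associative $\mathbb C$-algebra with generators $e_i,f_i$ $(i\in\mathbb Z)$, $\psi^+_i,\psi^-_{-i}$ $(i\ge0)$, $(\psi^\pm_0)^{-1}$ and relations, for $e(z)=\sum e_iz^{-i}$, $f(z)=\sum f_iz^{-i}$, $\psi^\pm(z)=\sum_{\pm i\ge0}\psi^\pm_iz^{-i}$, $\delta(z)=\sum_{m\in\mathbb Z}z^m$: $$g(z,w)e(z)e(w)=-g(w,z)e(w)e(z),\qquad g(w,z)f(z)f(w)=-g(z,w)f(w)f(z),$$ $$g(z,w)\psi^\pm(z)e(w)=-g(w,z)e(w)\psi^\pm(z),\qquad g(w,z)\psi^\pm(z)f(w)=-g(z,w)f(w)\psi^\pm(z),$$ $$[e(z),f(w)]=\tfrac{\delta(z/w)}{g(1,1)}\big(\psi^+(z)-\psi^-(z)\big),\qquad \text{all }\psi^\pm_i\text{ commute},\qquad \psi_0^\pm(\psi_0^\pm)^{-1}=(\psi_0^\pm)^{-1}\psi_0^\pm=1,$$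 $$[e_0,[e_1,e_{-1}]]=0,\qquad [f_0,[f_1,f_{-1}]]=0.$$ **Fock modules.** A finite partition is a sequence $\lambda_1\ge\lambda_2\ge\cdots$ of non-negative integers, finitely many of them non-zero; $\mathbf 1_s$ is the sequence with $1$ in place $s$ and $0$ elsewhere. Put $\psi_{\lambda,j}(x)=\frac{(1-q_1^{\lambda_j}q_3^{j}x)(1-q_1^{\lambda_j-1}q_3^{j-2}x)}{(1-q_1^{\lambda_j}q_3^{j-1}x)(1-q_1^{\lambda_j-1}q_3^{j-1}x)}$, $\psi_\emptyset(x)=\frac{1-q_2x}{1-x}$ and $\psi_\lambda(x)=\psi_\emptyset(x)\prod_{j\ge1}\psi_{\lambda,j}(x)/\psi_{\emptyset,j}(x)$ (a finite product). The Fock module $\mathcal F(u)$ has basis $|\lambda\rangle$, indexed by the finite partitions. On it $\psi^{\pm}(z)|\lambda\rangle=\psi_\lambda(u/z)|\lambda\rangle$, expanded in powers of $z^{\mp1}$. With $v=q_1^{\lambda_s}q_3^{s-1}u$, the only non-zero matrix coefficients of $e(z)$ and $f(z)$ are $$\langle\lambda+\mathbf 1_s|e(z)|\lambda\rangle=\frac{\delta(v/z)}{1-q_1}\prod_{j<s}\psi_{\lambda,j}(u/v),\qquad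 \langle\lambda|f(z)|\lambda+\mathbf 1_s\rangle=\frac{q_1\delta(v/z)}{1-q_1}\,\psi_\emptyset(q_3^su/v)\prod_{j>s}\frac{\psi_{\lambda,j}(u/v)}{\psi_{\emptyset,j}(u/v)}.$$ For generic parameters $q_1,q_3,u_1,\dots,u_n$ (with $q_2=(q_1q_3)^{-1}$), $\mathcal F(u_1)\otimes\cdots\otimes\mathcal F(u_n)$ carries operators given by the rule $e(z)\mapsto e(z)\otimes1+\psi^-(z)\otimes e(z)$, $f(z)\mapsto f(z)\otimes\psi^+(z)+1\otimes f(z)$, $\psi^\pm(z)\mapsto\psi^\pm(z)\otimes\psi^\pm(z)$, where a rational function multiplying $\delta(v/z)$ is evaluated at $z=v$. The matrix coefficients of all modes are then rational functions of the generic parameters. **The modules $\mathcal M^{p',p}_{\mathbf a,\mathbf b}$.** Let $n\ge2$, let $a_1,\dots,a_n,b_1,\dots,b_n$ be non-negative integers, $p'=\sum_{i=1}^n(a_i+1)$, $p=\sum_{i=1}^n(b_i+1)$, $p\ne p'$; thus $a_n,b_n$ are determined by $p',p$ and $\mathbf a=(a_1,\dots,a_{n-1})$, $\mathbf b=(b_1,\dots,b_{n-1})$.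 Let $u_1,\dots,u_n\in\mathbb C^\times$, and assume the resonance conditions: $$u_i=u_{i+1}q_1^{a_i+1}q_3^{b_i+1}\ (1\le i\le n-1),\qquad\text{and for }x,y\in\mathbb Z:\ q_1^xq_3^y=1\iff(x,y)=\kappa(p',p)\text{ for some }\kappa\in\mathbb Z.$$ Let $P^{p',p}_{\mathbf a,\mathbf b}$ be the set of $n$-tuples $\boldsymbol\lambda=(\lambda^{(1)},\dots,\lambda^{(n)})$ of finite partitions with $\lambda^{(i)}_s\ge\lambda^{(i+1)}_{s+b_i}-a_i$ for all $s\ge1$ and $1\le i\le n$, where $\lambda^{(n+1)}=\lambda^{(1)}$. Let $\mathcal M^{p',p}_{\mathbf a,\mathbf b}$ be the complex vector space with basis $|\boldsymbol\lambda\rangle=|\lambda^{(1)}\rangle\otimes\cdots\otimes|\lambda^{(n)}\rangle$, $\boldsymbol\lambda\in P^{p',p}_{\mathbf a,\mathbf b}$. Its operators $e_i,f_i,\psi^\pm_{\pm i}$ are those whose matrix coefficients between these basis vectors are the generic matrix coefficients above, after cancelling common factors, evaluated at the given $q_1,q_3,u_1,\dots,u_n$. **Theorem ($\mathbb Z_n$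 symmetry).** All these values are defined, and the operators give an $\mathcal E$-module structure on $\mathcal M^{p',p}_{(a_1,\dots,a_{n-1}),(b_1,\dots,b_{n-1})}$ (Fock parameters $u_1,\dots,u_n$) and likewise on $\mathcal M^{p',p}_{(a_2,\dots,a_n),(b_2,\dots,b_n)}$ (Fock parameters $u_2,\dots,u_n,u_1$). Moreover there exist non-zero constants $c_{\boldsymbol\lambda}$, $\boldsymbol\lambda\in P^{p',p}_{\mathbf a,\mathbf b}$, such that the linear map $$\iota:\ \mathcal M^{p',p}_{(a_1,\dots,a_{n-1}),(b_1,\dots,b_{n-1})}\to\mathcal M^{p',p}_{(a_2,\dots,a_n),(b_2,\dots,b_n)},\qquad |\lambda^{(1)}\rangle\otimes\cdots\otimes|\lambda^{(n)}\rangle\mapsto c_{\boldsymbol\lambda}\,|\lambda^{(2)}\rangle\otimes\cdots\otimes|\lambda^{(n)}\rangle\otimes|\lambda^{(1)}\rangle$$ is an isomorphism of $\mathcal E$-modules. -/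

import Mathlib

noncomputable section

namespace QuantumCgl

/-! ### The algebra -/

/-- Generators: `e i`, `f i` for `i ∈ ℤ`; `psiPlus i` is `ψ⁺_i` and `psiMinus i` is `ψ⁻_{-i}` for
`i ≥ 0`; `psiPlusInv` and `psiMinusInv` are `(ψ⁺_0)⁻¹` and `(ψ⁻_0)⁻¹`. -/
inductive Gen : Type
  | e (i : ℤ)
  | f (i : ℤ)
  | psiPlus (i : ℕ)
  | psiMinus (i : ℕ)
  | psiPlusInv
  | psiMinusInv

/-- The free associative algebra on the generators. -/
abbrev FreeGen : Type := FreeAlgebra ℂ Gen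

/-- `e_i` in the free algebra. -/
def freeE (i : ℤ) : FreeGen := FreeAlgebra.ι ℂ (Gen.e i)

/-- `f_i` in the free algebra. -/
def freeF (i : ℤ) : FreeGen := FreeAlgebra.ι ℂ (Gen.f i)

/-- The coefficient of `z^{-i}` in `ψ⁺(z) = ∑_{i ≥ 0} ψ⁺_i z^{-i}`. -/
def freePsiPlus (i : ℤ) : FreeGen :=
  if 0 ≤ i then FreeAlgebra.ι ℂ (Gen.psiPlus i.toNat) else 0

/-- The coefficient of `z^{-i}` in `ψ⁻(z) = ∑_{i ≤ 0} ψ⁻_i z^{-i}`. -/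
def freePsiMinus (i : ℤ) : FreeGen :=
  if i ≤ 0 then FreeAlgebra.ι ℂ (Gen.psiMinus (-i).toNat) else 0

/-- The coefficient of `z^{3-k} w^k` in `g(z,w) = (z - q₁ w)(z - q₂ w)(z - q₃ w)`. -/
def gCoeff (q₁ q₂ q₃ : ℂ) : Fin 4 → ℂ :=
  ![1, -(q₁ + q₂ + q₃), q₁ * q₂ + q₁ * q₃ + q₂ * q₃, -(q₁ * q₂ * q₃)]

/-- For `x(z) = ∑ x_i z^{-i}`, `y(w) = ∑ y_i w^{-i}`: the coefficient of `z^{-i} w^{-j}` in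
`g(z,w) x(z) y(w)`. -/
def gzw (q₁ q₂ q₃ : ℂ) (x y : ℤ → FreeGen) (i j : ℤ) : FreeGen :=
  ∑ k : Fin 4, gCoeff q₁ q₂ q₃ k • (x (i + 3 - (k : ℕ)) * y (j + (k : ℕ)))

/-- The coefficient of `z^{-i} w^{-j}` in `g(z,w) y(w) x(z)`. -/
def gzwOp (q₁ q₂ q₃ : ℂ) (x y : ℤ → FreeGen) (i j : ℤ) : FreeGen :=
  ∑ k : Fin 4, gCoeff q₁ q₂ q₃ k • (y (j + (k : ℕ)) * x (i + 3 - (k : ℕ)))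

/-- The coefficient of `z^{-i} w^{-j}` in `g(w,z) x(z) y(w)`. -/
def gwz (q₁ q₂ q₃ : ℂ) (x y : ℤ → FreeGen) (i j : ℤ) : FreeGen :=
  ∑ k : Fin 4, gCoeff q₁ q₂ q₃ k • (x (i + (k : ℕ)) * y (j + 3 - (k : ℕ)))

/-- The coefficient of `z^{-i} w^{-j}` in `g(w,z) y(w) x(z)`. -/
def gwzOp (q₁ q₂ q₃ : ℂ) (x y : ℤ → FreeGen) (i j : ℤ) : FreeGen :=
  ∑ k : Fin 4, gCoeff q₁ q₂ q₃ k • (y (j + 3 - (k : ℕ)) * x (i + (k : ℕ)))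

/-- The defining relations, each one written for every coefficient of the generating series. -/
inductive Rel (q₁ q₂ q₃ : ℂ) : FreeGen → FreeGen → Prop
  | ee (i j : ℤ) : Rel q₁ q₂ q₃ (gzw q₁ q₂ q₃ freeE freeE i j) (-gwzOp q₁ q₂ q₃ freeE freeE i j)
  | ff (i j : ℤ) : Rel q₁ q₂ q₃ (gwz q₁ q₂ q₃ freeF freeF i j) (-gzwOp q₁ q₂ q₃ freeF freeF i j)
  | psiPlus_e (i j : ℤ) :
      Rel q₁ q₂ q₃ (gzw q₁ q₂ q₃ freePsiPlus freeE i j) (-gwzOp q₁ q₂ q₃ freePsiPlus freeE i j)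
  | psiMinus_e (i j : ℤ) :
      Rel q₁ q₂ q₃ (gzw q₁ q₂ q₃ freePsiMinus freeE i j) (-gwzOp q₁ q₂ q₃ freePsiMinus freeE i j)
  | psiPlus_f (i j : ℤ) :
      Rel q₁ q₂ q₃ (gwz q₁ q₂ q₃ freePsiPlus freeF i j) (-gzwOp q₁ q₂ q₃ freePsiPlus freeF i j)
  | psiMinus_f (i j : ℤ) :
      Rel q₁ q₂ q₃ (gwz q₁ q₂ q₃ freePsiMinus freeF i j) (-gzwOp q₁ q₂ q₃ freePsiMinus freeF i j)
  | ef (i j : ℤ) :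
      Rel q₁ q₂ q₃ (freeE i * freeF j - freeF j * freeE i)
        (((1 - q₁) * (1 - q₂) * (1 - q₃))⁻¹ • (freePsiPlus (i + j) - freePsiMinus (i + j)))
  | psiPlus_psiPlus (i j : ℤ) :
      Rel q₁ q₂ q₃ (freePsiPlus i * freePsiPlus j) (freePsiPlus j * freePsiPlus i)
  | psiMinus_psiMinus (i j : ℤ) :
      Rel q₁ q₂ q₃ (freePsiMinus i * freePsiMinus j) (freePsiMinus j * freePsiMinus i)
  | psiPlus_psiMinus (i j : ℤ) :
      Rel q₁ q₂ q₃ (freePsiPlus i * freePsiMinus j) (freePsiMinus j * freePsiPlus i)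
  | psiPlus_inv : Rel q₁ q₂ q₃ (freePsiPlus 0 * FreeAlgebra.ι ℂ Gen.psiPlusInv) 1
  | psiPlus_inv_left : Rel q₁ q₂ q₃ (FreeAlgebra.ι ℂ Gen.psiPlusInv * freePsiPlus 0) 1
  | psiMinus_inv : Rel q₁ q₂ q₃ (freePsiMinus 0 * FreeAlgebra.ι ℂ Gen.psiMinusInv) 1
  | psiMinus_inv_left : Rel q₁ q₂ q₃ (FreeAlgebra.ι ℂ Gen.psiMinusInv * freePsiMinus 0) 1
  | serre_e : Rel q₁ q₂ q₃ ⁅freeE 0, ⁅freeE 1, freeE (-1)⁆⁆ 0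
  | serre_f : Rel q₁ q₂ q₃ ⁅freeF 0, ⁅freeF 1, freeF (-1)⁆⁆ 0

/-- The algebra `𝓔`: quantum continuous `𝔤𝔩_∞`. -/
abbrev Alg (q₁ q₂ q₃ : ℂ) : Type := RingQuot (Rel q₁ q₂ q₃)

/-- The image of a generator in `𝓔`. -/
def gen (q₁ q₂ q₃ : ℂ) (x : Gen) : Alg q₁ q₂ q₃ :=
  RingQuot.mkAlgHom ℂ (Rel q₁ q₂ q₃) (FreeAlgebra.ι ℂ x)

/-! ### Matrix coefficients in a tensor product of Fock modules

A finite partition `p₁ ≥ p₂ ≥ …` is an antitone `p : ℕ →₀ ℕ`; rows are numbered from `0`, so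
`p s` is the `(s+1)`-st part.  The formulas make sense over any field `K`. -/

section Coefficients

variable {K : Type} [Field K]

/-- The eigenvalue of `ψ^±(z)` on the vector `|i⟩_u` of the vector representation, `x = u / z`. -/
def vecPsi (q₁ q₂ q₃ : K) (i : ℤ) (x : K) : K :=
  ((1 - q₁ ^ i * q₃ * x) * (1 - q₁ ^ i * q₂ * x)) /
    ((1 - q₁ ^ i * x) * (1 - q₁ ^ (i - 1) * x))

/-- `⟨p| ψ(z)_{j+1} |p⟩`: the eigenvalue on `|p_{j+1} - j⟩` in the vector representation with
parameter `u q₂^{-j}`, `x = u / z`. -/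
def rowPsi (q₁ q₂ q₃ : K) (p : ℕ →₀ ℕ) (j : ℕ) (x : K) : K :=
  vecPsi q₁ q₂ q₃ ((p j : ℤ) - (j : ℤ)) (q₂ ^ (-(j : ℤ)) * x)

/-- `ψ_∅(x) = (1 - q₂ x) / (1 - x)`. -/
def vacPsi (q₂ : K) (x : K) : K := (1 - q₂ * x) / (1 - x)

/-- The eigenvalue of `ψ^±(z)` on `|p⟩` in the Fock module `F(u)`, `x = u / z`.  (All but finitely
many factors are `1`.) -/
def fockPsi (q₁ q₂ q₃ : K) (p : ℕ →₀ ℕ) (x : K) : K :=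
  vacPsi q₂ x * ∏ᶠ j : ℕ, rowPsi q₁ q₂ q₃ p j x / rowPsi q₁ q₂ q₃ 0 j x

/-- The point `q₁^{p_{s+1}} q₃^s u` that supports the delta function in the matrix coefficients
between `|p⟩` and `|p + 1_{s+1}⟩`. -/
def support (q₁ q₃ : K) (u : K) (p : ℕ →₀ ℕ) (s : ℕ) : K := q₁ ^ (p s) * q₃ ^ s * u

/-- For `⟨p + 1_{s+1}| e(z) |p⟩ = C δ(v/z)` in the Fock module: the constant `C`. -/
def fockE (q₁ q₂ q₃ : K) (u : K) (p : ℕ →₀ ℕ) (s : ℕ) : K :=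
  (1 - q₁)⁻¹ * ∏ j ∈ Finset.range s, rowPsi q₁ q₂ q₃ p j (u / support q₁ q₃ u p s)

/-- For `⟨p| f(z) |p + 1_{s+1}⟩ = C δ(v/z)` in the Fock module: the constant `C`. -/
def fockF (q₁ q₂ q₃ : K) (u : K) (p : ℕ →₀ ℕ) (s : ℕ) : K :=
  q₁ / (1 - q₁) * vacPsi q₂ (q₃ ^ (s + 1) * (u / support q₁ q₃ u p s)) *
    ∏ᶠ j : ℕ, (if s < j then
      rowPsi q₁ q₂ q₃ p j (u / support q₁ q₃ u p s) /
        rowPsi q₁ q₂ q₃ 0 j (u / support q₁ q₃ u p s) else 1)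

variable {n : ℕ}

/-- In `F(u_1) ⊗ ⋯ ⊗ F(u_n)`: the matrix coefficient of `e_m` (the coefficient of `z^{-m}` in
`e(z)`) from `|P⟩` to `|P + 1_{s+1}⟩`, the box being added to the `k`-th partition, by the
comultiplication `e(z) ↦ e(z) ⊗ 1 + ψ⁻(z) ⊗ e(z)`. -/
def tensorE (q₁ q₂ q₃ : K) (u : Fin n → K) (P : Fin n → ℕ →₀ ℕ) (k : Fin n) (s : ℕ) (m : ℤ) : K :=
  (∏ l ∈ Finset.univ.filter (fun l => l < k),
      fockPsi q₁ q₂ q₃ (P l) (u l / support q₁ q₃ (u k) (P k) s)) *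
    fockE q₁ q₂ q₃ (u k) (P k) s * support q₁ q₃ (u k) (P k) s ^ m

/-- In `F(u_1) ⊗ ⋯ ⊗ F(u_n)`: the matrix coefficient of `f_m` from `|P + 1_{s+1}⟩` to `|P⟩`, the
box being removed from the `k`-th partition, by the comultiplication
`f(z) ↦ f(z) ⊗ ψ⁺(z) + 1 ⊗ f(z)`. -/
def tensorF (q₁ q₂ q₃ : K) (u : Fin n → K) (P : Fin n → ℕ →₀ ℕ) (k : Fin n) (s : ℕ) (m : ℤ) : K :=
  fockF q₁ q₂ q₃ (u k) (P k) s *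
    (∏ l ∈ Finset.univ.filter (fun l => k < l),
      fockPsi q₁ q₂ q₃ (P l) (u l / support q₁ q₃ (u k) (P k) s)) *
    support q₁ q₃ (u k) (P k) s ^ m

end Coefficients

/-- The eigenvalue of `ψ⁺_m` on `|P⟩` in `F(u_1) ⊗ ⋯ ⊗ F(u_n)`: expand `∏ ψ_{P_k}(u_k / z)` in
powers of `z⁻¹`, which is the variable of the Laurent series here. -/
def psiPlusEig {n : ℕ} (q₁ q₂ q₃ : ℂ) (u : Fin n → ℂ) (P : Fin n → ℕ →₀ ℕ) (m : ℕ) : ℂ :=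
  HahnSeries.coeff (∏ k : Fin n,
    fockPsi (K := LaurentSeries ℂ) (HahnSeries.C q₁) (HahnSeries.C q₂) (HahnSeries.C q₃) (P k)
      (HahnSeries.single (1 : ℤ) (u k))) (m : ℤ)

/-- The eigenvalue of `ψ⁻_{-m}` on `|P⟩` in `F(u_1) ⊗ ⋯ ⊗ F(u_n)`: expand the same rational function
`∏ ψ_{P_k}(u_k / z)` in powers of `z`, which is the variable of the Laurent series here. -/
def psiMinusEig {n : ℕ} (q₁ q₂ q₃ : ℂ) (u : Fin n → ℂ) (P : Fin n → ℕ →₀ ℕ) (m : ℕ) : ℂ :=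
  HahnSeries.coeff (∏ k : Fin n,
    fockPsi (K := LaurentSeries ℂ) (HahnSeries.C q₁) (HahnSeries.C q₂) (HahnSeries.C q₃) (P k)
      (HahnSeries.single (-1 : ℤ) (u k))) (m : ℤ)

/-! ### Special values of the parameters -/

/-- Polynomials in the generic parameters `q₁, q₃, u_1, …, u_n`. -/
abbrev ParamPoly (n : ℕ) : Type := MvPolynomial (Fin 2 ⊕ Fin n) ℂ

/-- Rational functions in the generic parameters `q₁, q₃, u_1, …, u_n` (`q₂ = (q₁ q₃)⁻¹`). -/
abbrev GenericField (n : ℕ) : Type := FractionRing (ParamPoly n)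

/-- The generic `q₁`. -/
def genQ1 (n : ℕ) : GenericField n := algebraMap (ParamPoly n) _ (MvPolynomial.X (Sum.inl 0))

/-- The generic `q₃`. -/
def genQ3 (n : ℕ) : GenericField n := algebraMap (ParamPoly n) _ (MvPolynomial.X (Sum.inl 1))

/-- The generic `q₂`. -/
def genQ2 (n : ℕ) : GenericField n := (genQ1 n * genQ3 n)⁻¹

/-- The generic `u_1, …, u_n`. -/
def genU (n : ℕ) (i : Fin n) : GenericField n :=
  algebraMap (ParamPoly n) _ (MvPolynomial.X (Sum.inr i))

/-- The rational function `r` is defined at the given values of `q₁, q₃, u_1, …, u_n` (its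
denominator, after cancellation, does not vanish there), and has the value `c`. -/
def HasValueAt {n : ℕ} (q₁ q₃ : ℂ) (u : Fin n → ℂ) (r : GenericField n) (c : ℂ) : Prop :=
  ∃ N D : ParamPoly n,
    r * algebraMap _ (GenericField n) D = algebraMap _ (GenericField n) N ∧
    MvPolynomial.eval (Sum.elim ![q₁, q₃] u) D ≠ 0 ∧
    c = MvPolynomial.eval (Sum.elim ![q₁, q₃] u) N / MvPolynomial.eval (Sum.elim ![q₁, q₃] u) D

/-! ### The modules `M^{p',p}_{a,b}` -/

/-- The index set of the basis: `n`-tuples of finite partitions with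
`P^{(i)}_s ≥ P^{(i+1)}_{s + b_i} - a_i` for all `s` and all `i` modulo `n`. -/
def Tuples {n : ℕ} [NeZero n] (a b : Fin n → ℕ) : Type :=
  {P : Fin n → ℕ →₀ ℕ //
    (∀ i, Antitone (P i)) ∧ ∀ (i : Fin n) (s : ℕ), P (i + 1) (s + b i) ≤ P i s + a i}

/-- The vector space `M^{p',p}_{a,b}` with basis `|P⟩`, `P ∈ Tuples a b`. -/
abbrev Space {n : ℕ} [NeZero n] (a b : Fin n → ℕ) : Type := Tuples a b →₀ ℂ

/-- The basis vector `|P⟩`. -/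
def ket {n : ℕ} [NeZero n] {a b : Fin n → ℕ} (P : Tuples a b) : Space a b := Finsupp.single P 1

/-- The `n`-tuple `1_{s+1}^{(k)}`. -/
def box {n : ℕ} (k : Fin n) (s : ℕ) : Fin n → ℕ →₀ ℕ := Pi.single k (Finsupp.single s 1)

/-- `ρ` is the `𝓔`-module structure on `M^{p',p}_{a,b}` with Fock parameters `u_1, …, u_n`: the
matrix coefficients of `e_m`, `f_m` are the values, at the given parameters, of the matrix
coefficients in the tensor product of Fock modules with generic parameters, and `ψ^±_{±m}` act by
the same formula as in the tensor product. -/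
structure IsModuleStructure {n : ℕ} [NeZero n] (q₁ q₂ q₃ : ℂ) (u : Fin n → ℂ) (a b : Fin n → ℕ)
    (ρ : Alg q₁ q₂ q₃ →ₐ[ℂ] Module.End ℂ (Space a b)) : Prop where
  e_box : ∀ (m : ℤ) (P Q : Tuples a b) (k : Fin n) (s : ℕ), Q.1 = P.1 + box k s →
    HasValueAt q₁ q₃ u (tensorE (genQ1 n) (genQ2 n) (genQ3 n) (genU n) P.1 k s m)
      (ρ (gen q₁ q₂ q₃ (Gen.e m)) (ket P) Q)
  e_zero : ∀ (m : ℤ) (P Q : Tuples a b), (∀ k s, Q.1 ≠ P.1 + box k s) →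
    ρ (gen q₁ q₂ q₃ (Gen.e m)) (ket P) Q = 0
  f_box : ∀ (m : ℤ) (P Q : Tuples a b) (k : Fin n) (s : ℕ), Q.1 = P.1 + box k s →
    HasValueAt q₁ q₃ u (tensorF (genQ1 n) (genQ2 n) (genQ3 n) (genU n) P.1 k s m)
      (ρ (gen q₁ q₂ q₃ (Gen.f m)) (ket Q) P)
  f_zero : ∀ (m : ℤ) (P Q : Tuples a b), (∀ k s, Q.1 ≠ P.1 + box k s) →
    ρ (gen q₁ q₂ q₃ (Gen.f m)) (ket Q) P = 0
  psiPlus_eig : ∀ (m : ℕ) (P : Tuples a b),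
    ρ (gen q₁ q₂ q₃ (Gen.psiPlus m)) (ket P) = psiPlusEig q₁ q₂ q₃ u P.1 m • ket P
  psiMinus_eig : ∀ (m : ℕ) (P : Tuples a b),
    ρ (gen q₁ q₂ q₃ (Gen.psiMinus m)) (ket P) = psiMinusEig q₁ q₂ q₃ u P.1 m • ket P

/-- The cyclic shift `(x_1, …, x_n) ↦ (x_2, …, x_n, x_1)`. -/
def cyc {n : ℕ} [NeZero n] {α : Type} (x : Fin n → α) : Fin n → α := fun i => x (i + 1)

/-- The cyclic shift of `n`-tuples of partitions. -/
def Tuples.shift {n : ℕ} [NeZero n] {a b : Fin n → ℕ} (P : Tuples a b) :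
    Tuples (cyc a) (cyc b) :=
  ⟨cyc P.1, fun i => P.2.1 (i + 1), fun i s => P.2.2 (i + 1) s⟩

end QuantumCgl

end

noncomputable section

namespace QuantumCgl

/-! ### Combinatorics of the index set at resonance -/

/-! Each row of a tuple has a colour, the point `col` at its end, and contributes one explicit
rational factor in that colour (`headFactor` times `tailFactor`) to the eigenvalue of ψ(z). The
coefficient of e(z) for adding a box to a row is a constant times the product, at the colour of that
row, of the factors of the rows which precede it in the lexicographic order imposed by the
comultiplication; f(z) uses the rows which follow. A cyclic permutation of the tensor factors
changes nothing but this order, so the quadratic, cubic and commutation properties of the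
coefficients are proved for an arbitrary linear order of the rows (`RowOrder`, `coefBy`).

Resonance makes colours of different partitions comparable. By `lift`, two colours with ratio q₁^x
q₃^y belong to rows linked by a chain of neighbouring partitions, and each step of a chain leaves
one unit of slack in the inequalities (`IsT.chain`). Hence colours are distinct, and a row to which
a box can be added meets no zero and no pole of the other factors: the coefficients are finite and
non-zero on every move inside the index set. A move leaving the index set is obstructed by a row of
colour q₂⁻¹ or q₃⁻¹ times its own (`blocked`), which makes g vanish where the relations need it; a
coincidence of ratio q₁ comes with two obstructions (`double_block`).

Adding a box multiplies the factor of its row by -g(t,z)/g(z,t) (`selProd_add_bx`). This gives the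
quadratic relations; with the polynomial identity `cubic_identity` it gives the cubic one. The
relations for f follow by transposing matrices. For [e,f] the eigenvalue of ψ is decomposed into
partial fractions: by `card_poles_le` and `poleAt_unique` its poles are simple and lie at the boxes
that can be added or removed, and the residues are the products of the coefficients of e and f.

Such a product runs over all rows but one and does not see the order, so it is invariant under the
cyclic shift. The coefficients of e before and after the shift obey the same quadratic relations
with non-vanishing g, so their ratio is consistent around every square of moves and integrates to
the constants c (`exists_potential`). Compatibility with f is then automatic. -/

/-- The resonance conditions, with the relations between the Fock parameters written cyclically. -/
structure Resonant {n : ℕ} [NeZero n] (q₁ q₂ q₃ : ℂ) (u : Fin n → ℂ) (a b : Fin n → ℕ) : Prop where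
  two_le : 2 ≤ n
  hq : q₁ * q₂ * q₃ = 1
  u_ne : ∀ i, u i ≠ 0
  shift : ∀ i, u i = u (i + 1) * q₁ ^ (a i + 1) * q₃ ^ (b i + 1)
  res : ∀ x y : ℤ, q₁ ^ x * q₃ ^ y = 1 →
    ∃ κ : ℤ, x = κ * (∑ i, (a i + 1) : ℕ) ∧ y = κ * (∑ i, (b i + 1) : ℕ)

/-- `P` satisfies the conditions defining `Tuples a b`. -/
def IsT {n : ℕ} [NeZero n] (a b : Fin n → ℕ) (P : Fin n → ℕ →₀ ℕ) : Prop :=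
  (∀ i, Antitone (P i)) ∧ ∀ (i : Fin n) (s : ℕ), P (i + 1) (s + b i) ≤ P i s + a i

/-- The tuple with one box, in row `α.2` of the partition number `α.1`. -/
def bx {n : ℕ} (α : Fin n × ℕ) : Fin n → ℕ →₀ ℕ := box α.1 α.2

/-- The colour of the position at the end of the row `α`. -/
def col {n : ℕ} {K : Type} [Field K] (q₁ q₃ : K) (u : Fin n → K) (P : Fin n → ℕ →₀ ℕ)
    (α : Fin n × ℕ) : K := support q₁ q₃ (u α.1) (P α.1) α.2

/-! ### Single boxes and their effect on colours. -/

section Basic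

variable {n : ℕ}

lemma bx_apply (α : Fin n × ℕ) (l : Fin n) (r : ℕ) :
    bx α l r = if α = (l, r) then 1 else 0 := by
  obtain ⟨k, s⟩ := α
  unfold bx box
  by_cases h : l = k
  · subst h
    simp [Finsupp.single_apply]
  · have h' : k ≠ l := Ne.symm h
    simp [h']

lemma add_bx_apply (P : Fin n → ℕ →₀ ℕ) (α : Fin n × ℕ) (l : Fin n) (r : ℕ) :
    (P + bx α) l r = P l r + if α = (l, r) then 1 else 0 := by
  rw [← bx_apply]; rfl

lemma add_bx_self (P : Fin n → ℕ →₀ ℕ) (α : Fin n × ℕ) :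
    (P + bx α) α.1 α.2 = P α.1 α.2 + 1 := by
  rw [add_bx_apply, if_pos rfl]

lemma add_bx_of_ne (P : Fin n → ℕ →₀ ℕ) {α β : Fin n × ℕ} (h : α ≠ β) :
    (P + bx α) β.1 β.2 = P β.1 β.2 := by
  rw [add_bx_apply, if_neg h, add_zero]

lemma bx_injective : Function.Injective (bx (n := n)) := by
  intro α β h
  have := congrFun h β.1
  have h2 := DFunLike.congr_fun this β.2
  simp only [bx_apply] at h2
  by_contra hne
  simp [hne] at h2

variable {K : Type} [Field K] (q₁ q₃ : K) (u : Fin n → K)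

lemma col_def (P : Fin n → ℕ →₀ ℕ) (α : Fin n × ℕ) :
    col q₁ q₃ u P α = q₁ ^ (P α.1 α.2) * q₃ ^ α.2 * u α.1 := rfl

lemma col_congr {P Q : Fin n → ℕ →₀ ℕ} {α : Fin n × ℕ} (h : P α.1 α.2 = Q α.1 α.2) :
    col q₁ q₃ u P α = col q₁ q₃ u Q α := by
  rw [col_def, col_def, h]

lemma col_add_self (P : Fin n → ℕ →₀ ℕ) (α : Fin n × ℕ) :
    col q₁ q₃ u (P + bx α) α = q₁ * col q₁ q₃ u P α := by
  rw [col_def, col_def, add_bx_self, pow_succ]; ring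

lemma col_add_of_ne (P : Fin n → ℕ →₀ ℕ) {α β : Fin n × ℕ} (h : α ≠ β) :
    col q₁ q₃ u (P + bx α) β = col q₁ q₃ u P β :=
  col_congr _ _ _ (add_bx_of_ne P h)

end Basic

/-! ### The index set as a system of inequalities, and chains of neighbouring partitions. -/

section Lattice

variable {n : ℕ} [NeZero n] {a b : Fin n → ℕ}

lemma isT_iff (P : Fin n → ℕ →₀ ℕ) : IsT a b P ↔
    (∀ i s, P i (s + 1) ≤ P i s) ∧ ∀ (i : Fin n) (s : ℕ), P (i + 1) (s + b i) ≤ P i s + a i :=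
  and_congr_left' ⟨fun h i s => h i (Nat.le_succ s), fun h i => antitone_nat_of_succ_le (h i)⟩

/-- An inequality between two entries can only be broken by raising its smaller side, and at most
one of the two distinct boxes does this; the hypothesis for that box covers the inequality. -/
lemma isT_join {P : Fin n → ℕ →₀ ℕ} {α β : Fin n × ℕ} (hne : α ≠ β)
    (hα : IsT a b (P + bx α)) (hβ : IsT a b (P + bx β)) : IsT a b (P + bx α + bx β) := by
  rw [isT_iff] at hα hβ ⊢
  have key : ∀ (y x : Fin n × ℕ) (c : ℕ), (P + bx α) y.1 y.2 ≤ (P + bx α) x.1 x.2 + c →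
      (P + bx β) y.1 y.2 ≤ (P + bx β) x.1 x.2 + c →
      (P + bx α + bx β) y.1 y.2 ≤ (P + bx α + bx β) x.1 x.2 + c := by
    intro y x c h1 h2
    simp only [add_bx_apply, Prod.mk.eta] at *
    by_cases e1 : α = y
    · have e2 : β ≠ y := fun h => hne (e1.trans h.symm)
      simp only [e1, e2, if_true, if_false] at *
      split_ifs at * <;> omega
    · simp only [e1, if_false] at *
      split_ifs at * <;> omega
  exact ⟨fun i s => key (i, s + 1) (i, s) 0 (hα.1 i s) (hβ.1 i s),
    fun i s => key (i + 1, s + b i) (i, s) (a i) (hα.2 i s) (hβ.2 i s)⟩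

/-- Dual to `isT_join`: the larger side of an inequality is raised by at most one of the two boxes,
and the tuple with the other box gives the inequality without it. -/
lemma isT_meet {P : Fin n → ℕ →₀ ℕ} {α β : Fin n × ℕ} (hne : α ≠ β)
    (hα : IsT a b (P + bx α)) (hβ : IsT a b (P + bx β)) : IsT a b P := by
  rw [isT_iff] at hα hβ ⊢
  have key : ∀ (y x : Fin n × ℕ) (c : ℕ), (P + bx α) y.1 y.2 ≤ (P + bx α) x.1 x.2 + c →
      (P + bx β) y.1 y.2 ≤ (P + bx β) x.1 x.2 + c → P y.1 y.2 ≤ P x.1 x.2 + c := by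
    intro y x c h1 h2
    simp only [add_bx_apply, Prod.mk.eta] at *
    by_cases e1 : α = x
    · have e2 : β ≠ x := fun h => hne (e1.trans h.symm)
      simp only [e1, e2, if_true, if_false] at *
      split_ifs at * <;> omega
    · simp only [e1, if_false] at *
      split_ifs at * <;> omega
  exact ⟨fun i s => key (i, s + 1) (i, s) 0 (hα.1 i s) (hβ.1 i s),
    fun i s => key (i + 1, s + b i) (i, s) (a i) (hα.2 i s) (hβ.2 i s)⟩

/-- The `i`-th partition after the partition number `k`, cyclically. -/
def itr (k : Fin n) (i : ℕ) : Fin n := k + Fin.ofNat n i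

/-- The sum of `c_j + 1` over `i` consecutive indices, the first one being `k`. -/
def stepSum (c : Fin n → ℕ) (k : Fin n) (i : ℕ) : ℕ := ∑ r ∈ Finset.range i, (c (itr k r) + 1)

lemma itr_zero (k : Fin n) : itr k 0 = k := by simp [itr]

lemma itr_add (k : Fin n) (i j : ℕ) : itr k (i + j) = itr (itr k i) j := by
  unfold itr
  rw [add_assoc]
  congr 1
  ext
  simp [Fin.val_add]

lemma itr_one (k : Fin n) : itr k 1 = k + 1 := rfl

lemma itr_succ (k : Fin n) (i : ℕ) : itr k (i + 1) = itr k i + 1 := by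
  rw [itr_add, itr_one]

lemma itr_mul (k : Fin n) (m : ℕ) : itr k (m * n) = k := by
  unfold itr
  have : Fin.ofNat n (m * n) = 0 := by ext; simp
  rw [this, add_zero]

lemma stepSum_zero (c : Fin n → ℕ) (k : Fin n) : stepSum c k 0 = 0 := rfl

lemma stepSum_succ (c : Fin n → ℕ) (k : Fin n) (i : ℕ) :
    stepSum c k (i + 1) = stepSum c k i + (c (itr k i) + 1) := Finset.sum_range_succ _ _

lemma stepSum_one (c : Fin n → ℕ) (k : Fin n) : stepSum c k 1 = c k + 1 := by
  rw [stepSum_succ, stepSum_zero, itr_zero, zero_add]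

lemma stepSum_add (c : Fin n → ℕ) (k : Fin n) (i j : ℕ) :
    stepSum c k (i + j) = stepSum c k i + stepSum c (itr k i) j := by
  unfold stepSum
  rw [Finset.sum_range_add]
  simp_rw [itr_add]

lemma le_stepSum (c : Fin n → ℕ) (k : Fin n) (i : ℕ) : i ≤ stepSum c k i := by
  induction i with
  | zero => simp
  | succ i ih => rw [stepSum_succ]; omega

lemma stepSum_period (c : Fin n → ℕ) (k : Fin n) : stepSum c k n = ∑ i, (c i + 1) := by
  unfold stepSum
  rw [Finset.sum_range fun r => c (itr k r) + 1,
    ← Equiv.sum_comp (Equiv.addLeft k) (fun i => c i + 1)]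
  exact Finset.sum_congr rfl fun i _ => by simp [itr]

lemma stepSum_mul (c : Fin n → ℕ) (k : Fin n) (m : ℕ) :
    stepSum c k (m * n) = m * ∑ i, (c i + 1) := by
  induction m with
  | zero => simp [stepSum_zero]
  | succ m ih =>
    rw [Nat.succ_mul, stepSum_add, ih, itr_mul, stepSum_period, Nat.succ_mul]

/-- The condition on neighbouring partitions, iterated. -/
lemma IsT.chain {P : Fin n → ℕ →₀ ℕ} (hP : IsT a b P) (k : Fin n) (s i r : ℕ)
    (h : s + stepSum b k i ≤ r + i) : P (itr k i) r + i ≤ P k s + stepSum a k i := by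
  induction i generalizing r with
  | zero =>
    rw [itr_zero, stepSum_zero] at *
    simpa using hP.1 k (by omega)
  | succ i ih =>
    rw [stepSum_succ] at h ⊢
    -- This bound forces `b (itr k i) ≤ r`, so the truncated subtraction below is a true one.
    have h0 := le_stepSum b k i
    have h1 := ih (r - b (itr k i)) (by omega)
    have h2 := hP.2 (itr k i) (r - b (itr k i))
    rw [itr_succ, show r = r - b (itr k i) + b (itr k i) by omega]
    omega

lemma IsT.lt_of_add_left {P : Fin n → ℕ →₀ ℕ} {k : Fin n} {s : ℕ}
    (h : IsT a b (P + bx (k, s + 1))) : P k (s + 1) < P k s := by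
  have := ((isT_iff _).1 h).1 k s
  rw [add_bx_apply, add_bx_apply, if_pos rfl, if_neg (by simp)] at this
  exact this

lemma IsT.lt_of_add_nbr (hn : 2 ≤ n) {P : Fin n → ℕ →₀ ℕ} {i : Fin n} {s : ℕ}
    (h : IsT a b (P + bx (i + 1, s + b i))) : P (i + 1) (s + b i) < P i s + a i := by
  have := h.2 i s
  -- Two partitions at least: otherwise the neighbour of a partition is itself and the box may raise
  -- both sides.
  have hne : i + 1 ≠ i := by
    intro h
    have h1 : (1 : Fin n) = 0 := by simpa using h
    have h2 := congrArg Fin.val h1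
    rw [Fin.val_one', Nat.mod_eq_of_lt (by omega)] at h2
    simp at h2
  simp only [add_bx_apply, Prod.mk.injEq, hne, false_and, if_true, if_false] at this
  omega

end Lattice

/-! ### Coincidences of colours at resonance. -/

namespace Resonant

variable {n : ℕ} [NeZero n] {q₁ q₂ q₃ : ℂ} {u : Fin n → ℂ} {a b : Fin n → ℕ}

lemma q₁_ne (h : Resonant q₁ q₂ q₃ u a b) : q₁ ≠ 0 := by
  rintro rfl; simpa using h.hq

lemma q₂_ne (h : Resonant q₁ q₂ q₃ u a b) : q₂ ≠ 0 := by
  rintro rfl; simpa using h.hq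

lemma q₃_ne (h : Resonant q₁ q₂ q₃ u a b) : q₃ ≠ 0 := by
  rintro rfl; simpa using h.hq

lemma q₂_eq (h : Resonant q₁ q₂ q₃ u a b) : q₂ = (q₁ * q₃)⁻¹ := by
  have := h.hq
  have h1 := h.q₁_ne
  have h3 := h.q₃_ne
  field_simp
  linear_combination this

lemma period_ge (h : Resonant q₁ q₂ q₃ u a b) (c : Fin n → ℕ) : 2 ≤ ∑ i, (c i + 1) := by
  have : ∑ i : Fin n, 1 ≤ ∑ i, (c i + 1) := Finset.sum_le_sum fun i _ => by omega
  simp only [Finset.sum_const, Finset.card_univ, Fintype.card_fin, smul_eq_mul, mul_one] at this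
  exact h.two_le.trans this

/-- Both periods are at least n ≥ 2, so a non-trivial relation between q₁ and q₃ has two exponents
of the same sign and of size at least 2. This excludes all the short relations met later. -/
lemma exponents (h : Resonant q₁ q₂ q₃ u a b) {x y : ℤ} (hxy : q₁ ^ x * q₃ ^ y = 1) :
    (x = 0 ∧ y = 0) ∨ (2 ≤ x ∧ 2 ≤ y) ∨ (x ≤ -2 ∧ y ≤ -2) := by
  obtain ⟨κ, h1, h2⟩ := h.res x y hxy
  have ha : (2 : ℤ) ≤ (∑ i, (a i + 1) : ℕ) := by exact_mod_cast h.period_ge a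
  have hb : (2 : ℤ) ≤ (∑ i, (b i + 1) : ℕ) := by exact_mod_cast h.period_ge b
  generalize ((∑ i, (a i + 1) : ℕ) : ℤ) = A at *
  generalize ((∑ i, (b i + 1) : ℕ) : ℤ) = B at *
  rcases lt_trichotomy κ 0 with hk | hk | hk
  · right; right; constructor <;> nlinarith
  · left; simp [h1, h2, hk]
  · right; left; constructor <;> nlinarith

lemma col_ne (h : Resonant q₁ q₂ q₃ u a b) (P : Fin n → ℕ →₀ ℕ) (α : Fin n × ℕ) :
    col q₁ q₃ u P α ≠ 0 :=
  mul_ne_zero (mul_ne_zero (pow_ne_zero _ h.q₁_ne) (pow_ne_zero _ h.q₃_ne)) (h.u_ne _)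

lemma u_itr (h : Resonant q₁ q₂ q₃ u a b) (k : Fin n) (i : ℕ) :
    u k = u (itr k i) * q₁ ^ stepSum a k i * q₃ ^ stepSum b k i := by
  induction i with
  | zero => simp [itr_zero, stepSum_zero]
  | succ i ih =>
    rw [ih, h.shift (itr k i), stepSum_succ, stepSum_succ, itr_succ, pow_add, pow_add]
    ring

/-- Positions of proportional colours are related by a chain of neighbouring partitions. -/
lemma lift (h : Resonant q₁ q₂ q₃ u a b) {P : Fin n → ℕ →₀ ℕ} {α β : Fin n × ℕ} (x y : ℤ)
    (hc : col q₁ q₃ u P β = q₁ ^ x * q₃ ^ y * col q₁ q₃ u P α) :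
    (∃ i : ℕ, β.1 = itr α.1 i ∧ (P β.1 β.2 : ℤ) = P α.1 α.2 + stepSum a α.1 i + x ∧
      (β.2 : ℤ) = α.2 + stepSum b α.1 i + y) ∨
    (∃ i : ℕ, 1 ≤ i ∧ α.1 = itr β.1 i ∧ (P α.1 α.2 : ℤ) = P β.1 β.2 + stepSum a β.1 i - x ∧
      (α.2 : ℤ) = β.2 + stepSum b β.1 i - y) := by
  have q1 := h.q₁_ne
  have q3 := h.q₃_ne
  -- The shortest way forward from the partition of α to that of β; the true chain differs from it
  -- by full turns.
  obtain ⟨i, hin, hi⟩ : ∃ i < n, itr α.1 i = β.1 :=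
    ⟨(β.1 - α.1).val, (β.1 - α.1).isLt, by simp [itr]⟩
  have hu := h.u_itr α.1 i
  rw [hi] at hu
  rw [col_def, col_def, hu] at hc
  have hub := h.u_ne β.1
  have key : q₁ ^ ((P β.1 β.2 : ℤ) - P α.1 α.2 - stepSum a α.1 i - x) *
      q₃ ^ ((β.2 : ℤ) - α.2 - stepSum b α.1 i - y) = 1 := by
    rw [zpow_sub₀ q1, zpow_sub₀ q1, zpow_sub₀ q1, zpow_sub₀ q3, zpow_sub₀ q3, zpow_sub₀ q3]
    simp only [zpow_natCast]
    have hx := zpow_ne_zero x q1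
    have hy := zpow_ne_zero y q3
    field_simp
    apply mul_right_cancel₀ hub
    linear_combination hc
  -- For κ ≥ 0 the chain from α makes κ further turns. For κ < 0 it is read backwards from β: it has
  -- n - i steps and -κ - 1 full turns.
  obtain ⟨κ, h1, h2⟩ := h.res _ _ key
  rcases le_or_gt 0 κ with hk | hk
  · left
    lift κ to ℕ using hk
    refine ⟨κ * n + i, by rw [itr_add, itr_mul, hi], ?_, ?_⟩ <;>
    · rw [stepSum_add, stepSum_mul, itr_mul, Nat.cast_add, Nat.cast_mul]
      linarith
  · right
    obtain ⟨m, hm⟩ : ∃ m : ℕ, κ = -(m : ℤ) - 1 := ⟨(-κ - 1).toNat, by omega⟩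
    have hback : ∀ c : Fin n → ℕ, (stepSum c β.1 (n - i) : ℤ) + stepSum c α.1 i =
        (∑ i, (c i + 1) : ℕ) := by
      intro c
      have := stepSum_add c α.1 i (n - i)
      rw [show i + (n - i) = n by omega, stepSum_period, hi] at this
      rw [this]; push_cast; ring
    refine ⟨m * n + (n - i), by omega, ?_, ?_, ?_⟩
    · rw [itr_add, itr_mul, ← hi, ← itr_add, show i + (n - i) = 1 * n by omega, itr_mul]
    · have := hback a
      rw [stepSum_add, stepSum_mul, itr_mul, Nat.cast_add, Nat.cast_mul]
      rw [hm] at h1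
      linarith
    · have := hback b
      rw [stepSum_add, stepSum_mul, itr_mul, Nat.cast_add, Nat.cast_mul]
      rw [hm] at h2
      linarith

/-- Equal colours leave no slack in the chain between the two rows, while a chain of i steps has
slack i; so i = 0. -/
lemma col_injective (h : Resonant q₁ q₂ q₃ u a b) {P : Fin n → ℕ →₀ ℕ} (hP : IsT a b P) :
    Function.Injective (col q₁ q₃ u P) := by
  intro β α hc
  rcases h.lift (P := P) (α := α) (β := β) 0 0 (by simp [hc]) with ⟨i, h1, h2, h3⟩ | ⟨i, hi, h1, h2, h3⟩
  · have := hP.chain α.1 α.2 i β.2 (by omega)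
    rw [← h1] at this
    obtain rfl : i = 0 := by omega
    rw [itr_zero] at h1
    rw [stepSum_zero] at h3
    exact Prod.ext h1 (by omega)
  · have := hP.chain β.1 β.2 i α.2 (by omega)
    rw [← h1] at this
    omega

/-- A row whose end lies directly to the left of the end of another row is blocked twice. -/
lemma double_block (h : Resonant q₁ q₂ q₃ u a b) {P : Fin n → ℕ →₀ ℕ} (hP : IsT a b P)
    {α γ : Fin n × ℕ} (hc : col q₁ q₃ u P α = q₁ * col q₁ q₃ u P γ) :
    ∃ δ ε : Fin n × ℕ, δ ≠ ε ∧ δ ≠ α ∧ ε ≠ α ∧ δ ≠ γ ∧ ε ≠ γ ∧ δ.2 + 1 = γ.2 ∧ ε.2 = α.2 + 1 ∧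
      q₃ * col q₁ q₃ u P δ = col q₁ q₃ u P γ ∧ q₂ * col q₁ q₃ u P ε = col q₁ q₃ u P γ := by
  have q1 := h.q₁_ne
  have q3 := h.q₃_ne
  have hne : ∀ k : Fin n, k + 1 ≠ k := by
    intro k hk
    have h1 : (1 : Fin n) = 0 := by simpa using hk
    have h2 := congrArg Fin.val h1
    have := h.two_le
    rw [Fin.val_one', Nat.mod_eq_of_lt (by omega)] at h2
    simp at h2
  -- The ratio q₁ leaves room for one unit of slack, hence for at most one step; no step at all
  -- would give the same row two lengths.
  obtain ⟨h1, h2, h3⟩ : γ.1 = α.1 + 1 ∧ P γ.1 γ.2 = P α.1 α.2 + a α.1 ∧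
      γ.2 = α.2 + b α.1 + 1 := by
    rcases h.lift (α := α) (β := γ) (-1) 0 (by rw [hc]; simp; field_simp) with
      ⟨i, h1, h2, h3⟩ | ⟨i, hi, h1, h2, h3⟩
    · have := hP.chain α.1 α.2 i γ.2 (by omega)
      rw [← h1] at this
      obtain h0 | rfl : i = 0 ∨ i = 1 := by omega
      · subst h0
        rw [itr_zero] at h1
        rw [stepSum_zero] at h2 h3
        obtain rfl : γ = α := Prod.ext h1 (by omega)
        omega
      · rw [stepSum_one] at h2 h3
        rw [itr_one] at h1
        exact ⟨h1, by omega, by omega⟩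
    · have := hP.chain γ.1 γ.2 i α.2 (by omega)
      rw [← h1] at this
      omega
  obtain ⟨k, s⟩ := α
  obtain ⟨l, r⟩ := γ
  dsimp only at h1 h2 h3
  subst h1 h3
  -- Both equalities are squeezes: the length of γ already attains the bound imposed by α, and
  -- monotonicity leaves no freedom for the rows adjacent to γ and α.
  have e1 : P (k + 1) (s + b k) = P k s + a k :=
    le_antisymm (hP.2 k s) (h2 ▸ hP.1 (k + 1) (Nat.le_succ _))
  have e2 : P k (s + 1) = P k s := by
    refine le_antisymm (hP.1 k (Nat.le_succ _)) ?_
    have := hP.2 k (s + 1)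
    rw [show s + 1 + b k = s + b k + 1 by ring, h2] at this
    omega
  -- The two obstructions to γ are the row before it in its own partition and the row after α.
  refine ⟨(k + 1, s + b k), (k, s + 1), ?_, ?_, ?_, ?_, ?_, rfl, rfl, ?_, ?_⟩
  · simp [hne k]
  · simp [hne k]
  · simp
  · simp
  · simp [(hne k).symm]
  · simp only [col_def, e1, h2, pow_succ]; ring
  · have : q₂ * (q₁ * q₃) = 1 := by linear_combination h.hq
    have h5 : col q₁ q₃ u P (k, s + 1) = q₃ * col q₁ q₃ u P (k, s) := by
      simp only [col_def, e2, pow_succ]; ring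
    rw [h5, hc]
    linear_combination col q₁ q₃ u P (k + 1, s + b k + 1) * this

/-- Such a β could only be the preceding row of the same partition, with the same length as α, and
would prevent the new box; longer chains have too much slack. -/
lemma q₃_col_ne (h : Resonant q₁ q₂ q₃ u a b) {P : Fin n → ℕ →₀ ℕ} (hP : IsT a b P)
    {α β : Fin n × ℕ} (hα : IsT a b (P + bx α)) :
    q₃ * col q₁ q₃ u P β ≠ col q₁ q₃ u P α := by
  intro hc
  have q3 := h.q₃_ne
  rcases h.lift (α := α) (β := β) 0 (-1) (by rw [← hc]; simp; field_simp) with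
    ⟨i, h1, h2, h3⟩ | ⟨i, hi, h1, h2, h3⟩
  · rcases Nat.eq_zero_or_pos i with rfl | hi
    · rw [itr_zero] at h1
      rw [stepSum_zero] at h2 h3
      obtain ⟨k, s⟩ := α
      obtain ⟨l, r⟩ := β
      dsimp only at *
      subst h1
      obtain rfl : s = r + 1 := by omega
      have := hα.lt_of_add_left
      omega
    · have := hP.chain α.1 α.2 i β.2 (by omega)
      rw [← h1] at this
      omega
  · have := hP.chain β.1 β.2 i α.2 (by omega)
    rw [← h1] at this
    omega

/-- The only chain with small enough slack is one step from β to α, where the inequality between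
neighbouring partitions is an equality; the new box in α would violate it. -/
lemma q₂_col_ne (h : Resonant q₁ q₂ q₃ u a b) {P : Fin n → ℕ →₀ ℕ} (hP : IsT a b P)
    {α β : Fin n × ℕ} (hα : IsT a b (P + bx α)) :
    q₂ * col q₁ q₃ u P β ≠ col q₁ q₃ u P α := by
  intro hc
  have q3 := h.q₃_ne
  have hq := h.hq
  rcases h.lift (α := α) (β := β) 1 1 (by
      rw [← hc]; simp only [zpow_one]; linear_combination -col q₁ q₃ u P β * hq) with
    ⟨i, h1, h2, h3⟩ | ⟨i, hi, h1, h2, h3⟩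
  · rcases Nat.eq_zero_or_pos i with rfl | hi
    · rw [itr_zero] at h1
      rw [stepSum_zero] at h2 h3
      have := hP.1 β.1 (show α.2 ≤ β.2 by omega)
      rw [h1] at this h2
      omega
    · have := hP.chain α.1 α.2 i β.2 (by omega)
      rw [← h1] at this
      omega
  · have := hP.chain β.1 β.2 i α.2 (by omega)
    rw [← h1] at this
    obtain rfl : i = 1 := by omega
    rw [stepSum_one] at *
    rw [itr_one] at h1
    obtain ⟨k, s⟩ := α
    obtain ⟨l, r⟩ := β
    dsimp only at *
    subst h1
    obtain rfl : s = r + b l := by omega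
    have := hα.lt_of_add_nbr h.two_le
    omega

/-- By `double_block` the row α would be blocked. -/
lemma q₁_col_ne (h : Resonant q₁ q₂ q₃ u a b) {P : Fin n → ℕ →₀ ℕ} (hP : IsT a b P)
    {α β : Fin n × ℕ} (hα : IsT a b (P + bx α)) :
    col q₁ q₃ u P β ≠ q₁ * col q₁ q₃ u P α := by
  intro hc
  obtain ⟨δ, ε, -, -, -, -, -, -, -, h1, -⟩ := h.double_block hP hc
  exact h.q₃_col_ne hP hα h1

/-- A row to which no box can be added is blocked by another one. -/
lemma blocked (h : Resonant q₁ q₂ q₃ u a b) {P : Fin n → ℕ →₀ ℕ} (hP : IsT a b P)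
    {α : Fin n × ℕ} (hα : ¬ IsT a b (P + bx α)) :
    ∃ β : Fin n × ℕ, (q₃ * col q₁ q₃ u P β = col q₁ q₃ u P α ∧ β.2 + 1 = α.2) ∨
      (q₂ * col q₁ q₃ u P β = col q₁ q₃ u P α ∧ β.2 ≤ α.2) := by
  by_contra! hcon
  apply hα
  rw [isT_iff]
  constructor
  · intro i s
    have h0 := hP.1 i (Nat.le_succ s)
    rw [add_bx_apply, add_bx_apply]
    by_cases e : α = (i, s + 1)
    · subst e
      rw [if_pos rfl, if_neg (by simp)]
      by_contra hlt
      have e : P i (s + 1) = P i s := by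
        change P i (s + 1) ≤ P i s at h0; omega
      refine (hcon (i, s)).1 ?_ rfl
      simp only [col_def, e, pow_succ]; ring
    · rw [if_neg e]
      change P i (s + 1) ≤ P i s at h0; omega
  · intro i s
    have h0 := hP.2 i s
    rw [add_bx_apply, add_bx_apply]
    by_cases e : α = (i + 1, s + b i)
    · subst e
      rw [if_pos rfl]
      by_contra hlt
      have e : P (i + 1) (s + b i) = P i s + a i := by omega
      refine absurd ((hcon (i, s)).2 ?_) (by simp)
      simp only [col_def, e, h.shift i, pow_succ, pow_add]
      linear_combination (u (i + 1) * q₁ ^ P i s * q₁ ^ a i * q₃ ^ s * q₃ ^ b i) * h.hq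
    · rw [if_neg e]
      omega

/-- A row from which no box can be removed is blocked by another one. -/
lemma blocked_removal (h : Resonant q₁ q₂ q₃ u a b) {P : Fin n → ℕ →₀ ℕ} (hP : IsT a b P)
    {γ : Fin n × ℕ} (hγ : ¬ ∃ R, IsT a b R ∧ P = R + bx γ) :
    ∃ β : Fin n × ℕ, (q₂ * col q₁ q₃ u P β = q₁⁻¹ * col q₁ q₃ u P γ ∧ β.2 = γ.2 + 1) ∨
      (q₃ * col q₁ q₃ u P β = q₁⁻¹ * col q₁ q₃ u P γ ∧ P β.1 β.2 ≠ 0) := by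
  by_contra! hcon
  have q1 := h.q₁_ne
  have hlt : P γ.1 (γ.2 + 1) < P γ.1 γ.2 := by
    refine lt_of_le_of_ne (hP.1 _ (Nat.le_succ _)) fun e => (hcon (γ.1, γ.2 + 1)).1 ?_ rfl
    simp only [col_def, e, pow_succ]
    field_simp
    linear_combination q₃ ^ γ.2 * u γ.1 * h.hq
  have hR : P = (P - bx γ) + bx γ := by
    ext l r
    rw [add_bx_apply]
    change _ = P l r - bx γ l r + _
    rw [bx_apply]
    split_ifs with e
    · subst e; dsimp at hlt; omega
    · simp
  refine hγ ⟨P - bx γ, ?_, hR⟩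
  have hv : ∀ l r, (P - bx γ) l r = P l r - if γ = (l, r) then 1 else 0 := by
    intro l r; rw [← bx_apply]; rfl
  rw [isT_iff]
  constructor
  · intro i s
    have h0 : P i (s + 1) ≤ P i s := hP.1 i (Nat.le_succ s)
    rw [hv, hv]
    by_cases e : γ = (i, s)
    · subst e; dsimp at hlt; rw [if_pos rfl, if_neg (by simp)]; omega
    · rw [if_neg e]; omega
  · intro i s
    have h0 := hP.2 i s
    rw [hv, hv]
    by_cases e : γ = (i, s)
    · subst e
      dsimp at hlt hcon
      rw [if_pos rfl]
      have : P (i + 1) (s + b i) ≠ P i s + a i := by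
        intro e
        -- The side condition `P β.1 β.2 ≠ 0` of the second alternative is harmless here: the
        -- blocking entry is at least as long as the non-empty row γ.
        have : P (i + 1) (s + b i) = 0 := (hcon (i + 1, s + b i)).2 (by
          simp only [col_def, e, h.shift i, pow_succ, pow_add]
          field_simp)
        omega
      omega
    · rw [if_neg e]; omega

/-- Colours of two boxes added one after the other. -/
lemma path_two (h : Resonant q₁ q₂ q₃ u a b) {P : Fin n → ℕ →₀ ℕ} {α β : Fin n × ℕ}
    (hP : IsT a b P) (hα : IsT a b (P + bx α)) (hβ : IsT a b (P + bx α + bx β)) (i : Fin 4) :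
    col q₁ q₃ u P α ≠ ![1, q₁, q₂, q₃] i * col q₁ q₃ u (P + bx α) β := by
  have q1 := h.q₁_ne
  have q3 := h.q₃_ne
  have hx := h.col_ne P α
  have hexp : ∀ x y : ℤ, q₁ ^ x * q₃ ^ y = 1 →
    (x = 0 ∧ y = 0) ∨ (2 ≤ x ∧ 2 ≤ y) ∨ (x ≤ -2 ∧ y ≤ -2) := fun x y => h.exponents
  -- Twice the same row: the colours have ratio q₁, and each coincidence would be a short relation
  -- between q₁ and q₃.
  by_cases e : α = β
  · subst e
    rw [col_add_self]
    intro hc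
    have hc : ![1, q₁, q₂, q₃] i * q₁ = 1 := by
      apply mul_right_cancel₀ hx
      rw [mul_assoc, ← hc, one_mul]
    fin_cases i <;> simp [h.q₂_eq] at hc
    · have := hexp 1 0 (by simpa using hc); omega
    · have := hexp 2 0 (by rw [← hc]; simp [zpow_ofNat, pow_two]); omega
    · have := hexp 0 (-1) (by rw [← hc]; field_simp); omega
    · have := hexp 1 1 (by rw [← hc]; simp [mul_comm]); omega
  · rw [col_add_of_ne _ _ _ _ e]
    fin_cases i <;> intro hc <;> simp at hc
    · exact e (h.col_injective hP hc)
    -- The obstruction δ to β is not the row α, so it survives the first box.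
    · obtain ⟨δ, ε, -, h1, -, h2, -, -, -, h3, -⟩ := h.double_block hP hc
      apply h.q₃_col_ne hα hβ (β := δ)
      rw [col_add_of_ne _ _ _ _ h1.symm, col_add_of_ne _ _ _ _ e, h3]
    · exact h.q₂_col_ne hP hα hc.symm
    · exact h.q₃_col_ne hP hα hc.symm

/-- Colours of the first and the third of three boxes added one after the other. -/
lemma path_three (h : Resonant q₁ q₂ q₃ u a b) {P : Fin n → ℕ →₀ ℕ} {α β γ : Fin n × ℕ}
    (hP : IsT a b P) (hα : IsT a b (P + bx α)) (hβ : IsT a b (P + bx α + bx β))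
    (hγ : IsT a b (P + bx α + bx β + bx γ)) (i : Fin 4) :
    col q₁ q₃ u P α ≠ ![1, q₁, q₂, q₃] i * col q₁ q₃ u (P + bx α + bx β) γ := by
  have q1 := h.q₁_ne
  have q3 := h.q₃_ne
  have hx := h.col_ne P α
  have hexp : ∀ x y : ℤ, q₁ ^ x * q₃ ^ y = 1 →
    (x = 0 ∧ y = 0) ∨ (2 ≤ x ∧ 2 ≤ y) ∨ (x ≤ -2 ∧ y ≤ -2) := fun x y => h.exponents
  by_cases e1 : α = γ
  · subst e1
    by_cases e2 : β = α
    · subst e2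
      rw [col_add_self, col_add_self]
      intro hc
      have hc : ![1, q₁, q₂, q₃] i * (q₁ * q₁) = 1 := by
        apply mul_right_cancel₀ hx
        rw [mul_assoc, mul_assoc, ← hc, one_mul]
      fin_cases i <;> simp [h.q₂_eq] at hc
      · have := hexp 2 0 (by rw [← hc]; simp [zpow_ofNat, pow_two]); omega
      · have := hexp 3 0 (by rw [← hc]; simp [zpow_ofNat]; ring); omega
      · have := hexp 1 (-1) (by rw [← hc]; field_simp); omega
      · have := hexp 2 1 (by rw [← hc]; simp [zpow_ofNat]; ring); omega
    · rw [col_add_of_ne _ _ _ _ e2, col_add_self]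
      intro hc
      have hc : ![1, q₁, q₂, q₃] i * q₁ = 1 := by
        apply mul_right_cancel₀ hx
        rw [mul_assoc, ← hc, one_mul]
      fin_cases i <;> simp [h.q₂_eq] at hc
      · have := hexp 1 0 (by simpa using hc); omega
      · have := hexp 2 0 (by rw [← hc]; simp [zpow_ofNat, pow_two]); omega
      · have := hexp 0 (-1) (by rw [← hc]; field_simp); omega
      · have := hexp 1 1 (by rw [← hc]; simp [mul_comm]); omega
  · by_cases e2 : β = γ
    · subst e2
      have hxQ : col q₁ q₃ u (P + bx α + bx β) α = q₁ * col q₁ q₃ u P α := by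
        rw [col_add_of_ne _ _ _ _ (Ne.symm e1), col_add_self]
      fin_cases i <;> intro hc <;> simp at hc
      · exact h.q₁_col_ne hβ hγ (β := α) (by rw [hxQ, hc])
      -- The delicate case: β receives two boxes and the colour of α is q₁² times the original
      -- colour of β. Either β could have taken a box before α did, and `double_block` applies with
      -- that box in place, or β was blocked at the start.
      · have hz : col q₁ q₃ u (P + bx α + bx β) β = q₁ * col q₁ q₃ u P β := by
          rw [col_add_self, col_add_of_ne _ _ _ _ e1]
        by_cases hPβ : IsT a b (P + bx β)
        · have hx' : col q₁ q₃ u (P + bx β) α = q₁ * col q₁ q₃ u (P + bx β) β := by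
            rw [col_add_of_ne _ _ _ _ (Ne.symm e1), col_add_self, hc, hz]
          obtain ⟨δ, ε, -, h1, -, h2, -, -, -, h3, -⟩ := h.double_block hPβ hx'
          apply h.q₃_col_ne hβ hγ (β := δ)
          rw [hz, col_add_of_ne _ _ _ _ h2.symm, col_add_of_ne _ _ _ _ h1.symm,
            ← col_add_of_ne _ _ _ P h2.symm, h3, col_add_self]
        · obtain ⟨δ, hδ⟩ := h.blocked hP hPβ
          have hy := h.col_ne P β
          have hyα : col q₁ q₃ u (P + bx α) β = col q₁ q₃ u P β := col_add_of_ne _ _ _ _ e1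
          rw [hz] at hc
          -- If α itself was the obstruction, the two ratios combine to a short relation between q₁
          -- and q₃; any other obstruction remains after the box in α.
          by_cases e : α = δ
          · subst e
            rcases hδ with ⟨h1, -⟩ | ⟨h1, -⟩
            · have := hexp 2 1 (by
                rw [zpow_ofNat, zpow_one]
                apply mul_right_cancel₀ hx
                linear_combination q₁ * q₁ * h1 - hc)
              omega
            · have := hexp 1 (-1) (by
                rw [h.q₂_eq] at h1
                apply mul_right_cancel₀ hx
                rw [← h1] at hc
                rw [one_mul, zpow_one]
                conv_rhs => rw [hc]
                field_simp)
              omega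
          · rcases hδ with ⟨h1, -⟩ | ⟨h1, -⟩
            · exact h.q₃_col_ne hα hβ (β := δ) (by rw [col_add_of_ne _ _ _ _ e, h1, hyα])
            · exact h.q₂_col_ne hα hβ (β := δ) (by rw [col_add_of_ne _ _ _ _ e, h1, hyα])
      · apply h.q₃_col_ne hβ hγ (β := α)
        rw [hxQ, hc]
        linear_combination col q₁ q₃ u (P + bx α + bx β) β * h.hq
      · apply h.q₂_col_ne hβ hγ (β := α)
        rw [hxQ, hc]
        linear_combination col q₁ q₃ u (P + bx α + bx β) β * h.hq
    · have hz : col q₁ q₃ u (P + bx α + bx β) γ = col q₁ q₃ u P γ := by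
        rw [col_add_of_ne _ _ _ _ e2, col_add_of_ne _ _ _ _ e1]
      rw [hz]
      fin_cases i <;> intro hc <;> simp at hc
      · exact e1 (h.col_injective hP hc)
      -- Here two obstructions matter: the middle box can release only one of δ and ε, and the other
      -- still blocks γ.
      · obtain ⟨δ, ε, h0, h1, h2, -, -, -, -, h3, h4⟩ := h.double_block hP hc
        by_cases e : β = δ
        · apply h.q₂_col_ne hβ hγ (β := ε)
          rw [hz, col_add_of_ne _ _ _ _ (e ▸ h0), col_add_of_ne _ _ _ _ h2.symm, h4]
        · apply h.q₃_col_ne hβ hγ (β := δ)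
          rw [hz, col_add_of_ne _ _ _ _ e, col_add_of_ne _ _ _ _ h1.symm, h3]
      · exact h.q₂_col_ne hP hα hc.symm
      · exact h.q₃_col_ne hP hα hc.symm

end Resonant

/-! ### Truncated products over rows -/

section Size

variable {n : ℕ}

/-- The number of boxes. -/
def size (P : Fin n → ℕ →₀ ℕ) : ℕ := ∑ i, (P i).degree

lemma size_add (P Q : Fin n → ℕ →₀ ℕ) : size (P + Q) = size P + size Q := by
  simp [size, Finset.sum_add_distrib]

lemma size_bx (α : Fin n × ℕ) : size (bx α) = 1 := by
  unfold size bx box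
  rw [Finset.sum_eq_single α.1]
  · simp
  · intro i _ hi
    simp [hi]
  · simp

lemma size_add_bx (P : Fin n → ℕ →₀ ℕ) (α : Fin n × ℕ) : size (P + bx α) = size P + 1 := by
  rw [size_add, size_bx]

/-- All the rows up to a non-empty one are non-empty. -/
lemma lt_degree_of_antitone {f : ℕ →₀ ℕ} (hf : Antitone f) {j : ℕ} (hj : f j ≠ 0) :
    j < f.degree := by
  have hsub : Finset.range (j + 1) ⊆ f.support := by
    intro i hi
    have := hf (show i ≤ j by simp at hi; omega)
    rw [Finsupp.mem_support_iff]
    omega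
  have h1 : ∑ i ∈ Finset.range (j + 1), 1 ≤ ∑ i ∈ Finset.range (j + 1), f i := by
    refine Finset.sum_le_sum fun i hi => ?_
    have := Finsupp.mem_support_iff.1 (hsub hi)
    omega
  have h2 : ∑ i ∈ Finset.range (j + 1), f i ≤ f.degree :=
    Finset.sum_le_sum_of_subset hsub
  simp at h1
  omega

lemma degree_le_size (P : Fin n → ℕ →₀ ℕ) (i : Fin n) : (P i).degree ≤ size P :=
  Finset.single_le_sum (f := fun i => (P i).degree) (fun _ _ => Nat.zero_le _) (Finset.mem_univ i)

variable [NeZero n] {a b : Fin n → ℕ}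

lemma IsT.eq_zero {P : Fin n → ℕ →₀ ℕ} (hP : IsT a b P) (l : Fin n) {j : ℕ} (hj : size P ≤ j) :
    P l j = 0 := by
  by_contra h0
  have := lt_degree_of_antitone (hP.1 l) h0
  have := degree_le_size P l
  omega

/-- Bounds the rows that can receive a box, which makes the sums over moves finite and fixes the
truncation level of the products. -/
lemma IsT.row_le {P : Fin n → ℕ →₀ ℕ} {α : Fin n × ℕ} (hP : IsT a b (P + bx α)) :
    α.2 ≤ size P := by
  by_contra hlt
  have := hP.eq_zero α.1 (j := α.2) (by rw [size_add_bx]; omega)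
  rw [add_bx_self] at this
  omega

end Size

/-! ### Row factors and their change under a new box. -/

section Products

variable {n : ℕ} {K : Type} [Field K]

/-- `g(z, w)`. -/
def gpol (q₁ q₂ q₃ z w : K) : K := (z - q₁ * w) * (z - q₂ * w) * (z - q₃ * w)

/-- The first half of the contribution of a row, whose end has colour `t`, to the eigenvalue of
`ψ(z)`. -/
def headFactor (q₂ t z : K) : K := (z - q₂ * t) / (z - t)

/-- The second half of the contribution of a row to the eigenvalue of `ψ(z)`. -/
def tailFactor (q₁ q₃ t z : K) : K := (z - q₃ * t) / (z - q₁⁻¹ * t)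

/-- The first `L` rows of every partition. -/
def rows (n L : ℕ) : Finset (Fin n × ℕ) := Finset.univ ×ˢ Finset.range L

lemma mem_rows {L : ℕ} {β : Fin n × ℕ} : β ∈ rows n L ↔ β.2 < L := by
  simp [rows]

/-- The product of the contributions of the rows selected by `S`, where the empty rows from number
`L` on are replaced by the value of their (telescoping) product. -/
def selProd (q₁ q₂ q₃ : K) (u : Fin n → K) (P : Fin n → ℕ →₀ ℕ) (S : Fin n × ℕ → Prop)
    [DecidablePred S] (L : ℕ) (z : K) : K :=
  (∏ β ∈ rows n (L + 1), if S β then headFactor q₂ (col q₁ q₃ u P β) z else 1) *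
    ∏ β ∈ rows n L, if S β then tailFactor q₁ q₃ (col q₁ q₃ u P β) z else 1

variable {q₁ q₂ q₃ : K} {u : Fin n → K} {P : Fin n → ℕ →₀ ℕ}

lemma selProd_congr {S S' : Fin n × ℕ → Prop} [DecidablePred S] [DecidablePred S']
    {P' : Fin n → ℕ →₀ ℕ} {L : ℕ} {z : K} (hS : ∀ β, S β ↔ S' β)
    (h : ∀ β, S β → P β.1 β.2 = P' β.1 β.2) :
    selProd q₁ q₂ q₃ u P S L z = selProd q₁ q₂ q₃ u P' S' L z := by
  unfold selProd
  congr 1 <;>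
  · refine Finset.prod_congr rfl fun β _ => ?_
    by_cases hβ : S β
    · rw [if_pos hβ, if_pos ((hS β).1 hβ), col_congr _ _ _ (h β hβ)]
    · rw [if_neg hβ, if_neg (fun h => hβ ((hS β).2 h))]

/-- Telescoping: the colours of successive empty rows have ratio q₃, so the tail factor of one
cancels the head factor of the next. This is why a truncated product has one more head than tail. -/
lemma selProd_succ (hq : q₁ * q₂ * q₃ = 1) {S : Fin n × ℕ → Prop} [DecidablePred S] {L : ℕ} {z : K}
    (hP : ∀ l j, L ≤ j → P l j = 0) (hS : ∀ l, S (l, L + 1) ↔ S (l, L))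
    (h3 : ∀ l, S (l, L) → z ≠ q₃ * col q₁ q₃ u P (l, L))
    (h1 : ∀ l, S (l, L) → z ≠ q₁⁻¹ * col q₁ q₃ u P (l, L)) :
    selProd q₁ q₂ q₃ u P S (L + 1) z = selProd q₁ q₂ q₃ u P S L z := by
  have hq1 : q₁ ≠ 0 := by rintro rfl; simp at hq
  unfold selProd rows
  simp only [Finset.prod_product]
  rw [← Finset.prod_mul_distrib, ← Finset.prod_mul_distrib]
  refine Finset.prod_congr rfl fun l _ => ?_
  rw [Finset.prod_range_succ _ (L + 1), Finset.prod_range_succ (fun j =>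
    if S (l, j) then tailFactor q₁ q₃ (col q₁ q₃ u P (l, j)) z else 1) L, mul_assoc]
  congr 1
  rw [mul_comm _ (if S (l, L) then _ else _), ← mul_assoc]
  convert one_mul _
  by_cases hl : S (l, L)
  · rw [if_pos hl, if_pos ((hS l).2 hl)]
    have ht : col q₁ q₃ u P (l, L + 1) = q₃ * col q₁ q₃ u P (l, L) := by
      simp only [col_def, hP l L le_rfl, hP l (L + 1) (Nat.le_succ L), pow_succ]; ring
    have h3 := sub_ne_zero.2 (h3 l hl)
    have h1 := sub_ne_zero.2 (h1 l hl)
    have e : q₂ * (q₃ * col q₁ q₃ u P (l, L)) = q₁⁻¹ * col q₁ q₃ u P (l, L) := by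
      field_simp
      linear_combination col q₁ q₃ u P (l, L) * hq
    rw [headFactor, tailFactor, ht, e, div_mul_div_comm, mul_comm (z - q₁⁻¹ * _),
      div_self (mul_ne_zero h3 h1)]
  · rw [if_neg hl, if_neg (fun h => hl ((hS l).1 h)), one_mul]

lemma selProd_le (hq : q₁ * q₂ * q₃ = 1) {S : Fin n × ℕ → Prop} [DecidablePred S] {L L' : ℕ} {z : K}
    (hL : L ≤ L')
    (hP : ∀ l j, L ≤ j → P l j = 0) (hS : ∀ l j, L ≤ j → (S (l, j + 1) ↔ S (l, j)))
    (h3 : ∀ β, S β → z ≠ q₃ * col q₁ q₃ u P β)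
    (h1 : ∀ β, S β → z ≠ q₁⁻¹ * col q₁ q₃ u P β) :
    selProd q₁ q₂ q₃ u P S L' z = selProd q₁ q₂ q₃ u P S L z := by
  induction L', hL using Nat.le_induction with
  | base => rfl
  | succ L' hL ih =>
    rw [← ih, selProd_succ hq (fun l j hj => hP l j (hL.trans hj)) (fun l => hS l L' hL)
      (fun l hl => h3 _ hl) (fun l hl => h1 _ hl)]

lemma selProd_mul {S S₁ S₂ : Fin n × ℕ → Prop} [DecidablePred S] [DecidablePred S₁]
    [DecidablePred S₂] {L : ℕ} {z : K} (hS : ∀ β, S β ↔ S₁ β ∨ S₂ β)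
    (hd : ∀ β, ¬ (S₁ β ∧ S₂ β)) :
    selProd q₁ q₂ q₃ u P S₁ L z * selProd q₁ q₂ q₃ u P S₂ L z = selProd q₁ q₂ q₃ u P S L z := by
  unfold selProd
  rw [mul_mul_mul_comm, ← Finset.prod_mul_distrib, ← Finset.prod_mul_distrib]
  congr 1 <;>
  · refine Finset.prod_congr rfl fun β _ => ?_
    have h1 := hS β
    have h2 := hd β
    by_cases c1 : S₁ β <;> by_cases c2 : S₂ β <;> simp_all

lemma selProd_ne_zero {S : Fin n × ℕ → Prop} [DecidablePred S] {L : ℕ} {z : K}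
    (h0 : ∀ β, S β → z ≠ col q₁ q₃ u P β) (h1 : ∀ β, S β → z ≠ q₁⁻¹ * col q₁ q₃ u P β)
    (h2 : ∀ β, S β → z ≠ q₂ * col q₁ q₃ u P β) (h3 : ∀ β, S β → z ≠ q₃ * col q₁ q₃ u P β) :
    selProd q₁ q₂ q₃ u P S L z ≠ 0 := by
  refine mul_ne_zero (Finset.prod_ne_zero_iff.2 fun β _ => ?_)
    (Finset.prod_ne_zero_iff.2 fun β _ => ?_)
  · split_ifs with h
    · exact div_ne_zero (sub_ne_zero.2 (h2 β h)) (sub_ne_zero.2 (h0 β h))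
    · exact one_ne_zero
  · split_ifs with h
    · exact div_ne_zero (sub_ne_zero.2 (h3 β h)) (sub_ne_zero.2 (h1 β h))
    · exact one_ne_zero

/-- Only the factor of row α changes, its colour t becoming q₁t; with q₁q₂q₃ = 1 the ratio of new to
old is -g(t,z)/g(z,t). -/
lemma selProd_add_bx (hq : q₁ * q₂ * q₃ = 1) {S : Fin n × ℕ → Prop} [DecidablePred S] {L : ℕ}
    {z : K} {α : Fin n × ℕ} (hL : α.2 < L) (hα : S α) (h1 : q₁ * z ≠ col q₁ q₃ u P α)
    (h2 : z ≠ q₂ * col q₁ q₃ u P α) (h3 : z ≠ q₃ * col q₁ q₃ u P α)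
    (h4 : z ≠ q₁ * col q₁ q₃ u P α) :
    selProd q₁ q₂ q₃ u (P + bx α) S L z * gpol q₁ q₂ q₃ z (col q₁ q₃ u P α) =
      -(gpol q₁ q₂ q₃ (col q₁ q₃ u P α) z * selProd q₁ q₂ q₃ u P S L z) := by
  have hq1 : q₁ ≠ 0 := by rintro rfl; simp at hq
  unfold selProd
  have m1 : α ∈ rows n (L + 1) := mem_rows.2 (by omega)
  have m2 : α ∈ rows n L := mem_rows.2 hL
  rw [← Finset.mul_prod_erase _ _ m1, ← Finset.mul_prod_erase _ _ m2,
    ← Finset.mul_prod_erase (rows n (L + 1)) _ m1, ← Finset.mul_prod_erase (rows n L) _ m2]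
  have e : ∀ (M : ℕ) (F : K → K → K),
      (∏ β ∈ (rows n M).erase α, if S β then F (col q₁ q₃ u (P + bx α) β) z else 1) =
      ∏ β ∈ (rows n M).erase α, if S β then F (col q₁ q₃ u P β) z else 1 := by
    intro M F
    refine Finset.prod_congr rfl fun β hβ => ?_
    rw [col_add_of_ne _ _ _ _ (Finset.ne_of_mem_erase hβ).symm]
  rw [e _ (headFactor q₂), e _ (tailFactor q₁ q₃), if_pos hα, if_pos hα, if_pos hα, if_pos hα,
    col_add_self]
  generalize (∏ β ∈ (rows n (L + 1)).erase α,
    if S β then headFactor q₂ (col q₁ q₃ u P β) z else 1) = A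
  generalize (∏ β ∈ (rows n L).erase α,
    if S β then tailFactor q₁ q₃ (col q₁ q₃ u P β) z else 1) = B
  generalize col q₁ q₃ u P α = t at *
  have h1' : z - q₁⁻¹ * t ≠ 0 := by
    rw [sub_ne_zero]
    contrapose! h1
    rw [h1]; field_simp
  have h2 := sub_ne_zero.2 h2
  have h3 := sub_ne_zero.2 h3
  have h4 := sub_ne_zero.2 h4
  have key : headFactor q₂ (q₁ * t) z * tailFactor q₁ q₃ (q₁ * t) z * gpol q₁ q₂ q₃ z t =
      -(gpol q₁ q₂ q₃ t z * (headFactor q₂ t z * tailFactor q₁ q₃ t z)) := by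
    unfold headFactor tailFactor gpol
    rw [inv_mul_cancel_left₀ hq1]
    rw [div_mul_div_comm, div_mul_div_comm, div_mul_eq_mul_div, mul_div_assoc', ← neg_div]
    -- At z = t both quotients have a zero denominator, hence the value 0, and the identity holds by
    -- this convention.
    by_cases h0 : z - t = 0
    · simp [h0]
    · rw [div_eq_div_iff (mul_ne_zero h4 h0) (mul_ne_zero h0 h1')]
      have e1 : t - q₁ * z = -q₁ * (z - q₁⁻¹ * t) := by field_simp; ring
      have e2 : t - q₂ * z = -q₂ * (z - q₁ * q₃ * t) := by linear_combination -t * hq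
      have e3 : t - q₃ * z = -q₃ * (z - q₁ * q₂ * t) := by linear_combination -t * hq
      rw [e1, e2, e3]
      linear_combination (-(z - q₂ * t) * (z - q₃ * t) * (z - q₁ * t) * (z - t) *
        (z - q₁⁻¹ * t) * (z - q₁ * q₃ * t) * (z - q₁ * q₂ * t)) * hq
  linear_combination A * B * key

end Products

/-! ### Coefficients attached to a linear order of the rows. -/

section Coefficients

variable {n : ℕ} [NeZero n] {q₁ q₂ q₃ : ℂ} {u : Fin n → ℂ} {a b : Fin n → ℕ}

/-- A linear order on the rows that compares rows far down by their partitions only. -/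
structure RowOrder (R : Fin n × ℕ → Fin n × ℕ → Prop) : Prop where
  irrefl : ∀ α, ¬ R α α
  asymm : ∀ α β, R α β → ¬ R β α
  total : ∀ α β, α ≠ β → R α β ∨ R β α
  tail : ∀ α l j, α.2 < j → (R (l, j + 1) α ↔ R (l, j) α)

/-- The coefficient for adding a box to the row `α`: `c` times the product over the rows which
precede `α` in the order `R`, and zero when one of the tuples is not in the index set. -/
def coefBy (q₁ q₂ q₃ : ℂ) (u : Fin n → ℂ) (a b : Fin n → ℕ) (c : ℂ)
    (R : Fin n × ℕ → Fin n × ℕ → Prop) (P : Fin n → ℕ →₀ ℕ) (α : Fin n × ℕ) : ℂ :=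
  open Classical in
  if IsT a b P ∧ IsT a b (P + bx α) then
    c * selProd q₁ q₂ q₃ u P (fun β => R β α) (size P + 1) (col q₁ q₃ u P α) else 0

lemma coefBy_of_not {c : ℂ} {R : Fin n × ℕ → Fin n × ℕ → Prop} {P : Fin n → ℕ →₀ ℕ}
    {α : Fin n × ℕ} (h : ¬ (IsT a b P ∧ IsT a b (P + bx α))) :
    coefBy q₁ q₂ q₃ u a b c R P α = 0 := if_neg h

lemma isT_of_coefBy {c : ℂ} {R : Fin n × ℕ → Fin n × ℕ → Prop} {P : Fin n → ℕ →₀ ℕ}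
    {α : Fin n × ℕ} (h : coefBy q₁ q₂ q₃ u a b c R P α ≠ 0) :
    IsT a b P ∧ IsT a b (P + bx α) := by
  by_contra hn
  exact h (coefBy_of_not hn)

namespace Resonant

lemma col_ne_inv (h : Resonant q₁ q₂ q₃ u a b) {P : Fin n → ℕ →₀ ℕ} (hP : IsT a b P)
    {α β : Fin n × ℕ} (hα : IsT a b (P + bx α)) :
    col q₁ q₃ u P α ≠ q₁⁻¹ * col q₁ q₃ u P β := by
  intro hc
  refine h.q₁_col_ne hP hα (β := β) ?_
  rw [hc, mul_inv_cancel_left₀ h.q₁_ne]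

open Classical in
-- The truncation level is immaterial, because far rows of one partition all stand on the same side
-- of α (`RowOrder.tail`). This allows coefficients of different tuples to be compared at a common
-- level.
lemma coefBy_eq (h : Resonant q₁ q₂ q₃ u a b) {c : ℂ} {R : Fin n × ℕ → Fin n × ℕ → Prop}
    (hR : RowOrder R) {P : Fin n → ℕ →₀ ℕ} {α : Fin n × ℕ} (hP : IsT a b P)
    (hα : IsT a b (P + bx α)) {L : ℕ} (hL : size P + 1 ≤ L) :
    coefBy q₁ q₂ q₃ u a b c R P α =
      c * selProd q₁ q₂ q₃ u P (fun β => R β α) L (col q₁ q₃ u P α) := by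
  rw [coefBy, if_pos ⟨hP, hα⟩]
  congr 1
  symm
  refine selProd_le h.hq hL (fun l j hj => hP.eq_zero l (by omega)) (fun l j hj => ?_)
    (fun β _ => (h.q₃_col_ne hP hα).symm) (fun β _ => h.col_ne_inv hP hα)
  exact hR.tail α l j (by have := hα.row_le; omega)

/-- Zeros and poles of the other row factors are exactly the coincidences excluded for a row that
can receive a box. -/
lemma coefBy_ne_zero (h : Resonant q₁ q₂ q₃ u a b) {c : ℂ} (hc : c ≠ 0)
    {R : Fin n × ℕ → Fin n × ℕ → Prop} (hR : RowOrder R) {P : Fin n → ℕ →₀ ℕ} {α : Fin n × ℕ}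
    (hP : IsT a b P) (hα : IsT a b (P + bx α)) : coefBy q₁ q₂ q₃ u a b c R P α ≠ 0 := by
  classical
  rw [coefBy, if_pos ⟨hP, hα⟩]
  refine mul_ne_zero hc (selProd_ne_zero (fun β hβ he => ?_) (fun β _ => h.col_ne_inv hP hα)
    (fun β _ => (h.q₂_col_ne hP hα).symm) (fun β _ => (h.q₃_col_ne hP hα).symm))
  obtain rfl := h.col_injective hP he
  exact hR.irrefl _ hβ

lemma gpol_ne_zero (h : Resonant q₁ q₂ q₃ u a b) {P : Fin n → ℕ →₀ ℕ} {α β : Fin n × ℕ}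
    (hP : IsT a b P) (hα : IsT a b (P + bx α)) (hβ : IsT a b (P + bx β)) :
    gpol q₁ q₂ q₃ (col q₁ q₃ u P α) (col q₁ q₃ u P β) ≠ 0 :=
  mul_ne_zero (mul_ne_zero (sub_ne_zero.2 (h.q₁_col_ne hP hβ))
    (sub_ne_zero.2 (h.q₂_col_ne hP hα).symm)) (sub_ne_zero.2 (h.q₃_col_ne hP hα).symm)

/-- The new box sits in one of the rows of the product for β, so `selProd_add_bx` applies at z equal
to the unchanged colour of β. -/
lemma coefBy_add_of_rel (h : Resonant q₁ q₂ q₃ u a b) {c : ℂ}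
    {R : Fin n × ℕ → Fin n × ℕ → Prop} (hR : RowOrder R) {P : Fin n → ℕ →₀ ℕ} {α β : Fin n × ℕ}
    (hP : IsT a b P) (hα : IsT a b (P + bx α)) (hβ : IsT a b (P + bx β)) (hαβ : R α β) :
    coefBy q₁ q₂ q₃ u a b c R (P + bx α) β *
        gpol q₁ q₂ q₃ (col q₁ q₃ u P β) (col q₁ q₃ u P α) =
      -(gpol q₁ q₂ q₃ (col q₁ q₃ u P α) (col q₁ q₃ u P β) *
        coefBy q₁ q₂ q₃ u a b c R P β) := by
  classical
  have hne : α ≠ β := by rintro rfl; exact hR.irrefl _ hαβ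
  rw [h.coefBy_eq hR hα (isT_join hne hα hβ) (L := size P + 2) (by rw [size_add_bx]),
    h.coefBy_eq hR hP hβ (L := size P + 2) (by omega), col_add_of_ne _ _ _ _ hne, mul_assoc,
    selProd_add_bx (S := fun γ => R γ β) (α := α) h.hq (by have := hα.row_le; omega) hαβ (h.q₁_col_ne hP hβ).symm
      (h.q₂_col_ne hP hβ).symm (h.q₃_col_ne hP hβ).symm (h.q₁_col_ne hP hα)]
  ring

lemma coefBy_add_of_not_rel (h : Resonant q₁ q₂ q₃ u a b) {c : ℂ}
    {R : Fin n × ℕ → Fin n × ℕ → Prop} (hR : RowOrder R) {P : Fin n → ℕ →₀ ℕ} {α β : Fin n × ℕ}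
    (hne : α ≠ β) (hP : IsT a b P) (hα : IsT a b (P + bx α)) (hβ : IsT a b (P + bx β))
    (hαβ : ¬ R α β) :
    coefBy q₁ q₂ q₃ u a b c R (P + bx α) β = coefBy q₁ q₂ q₃ u a b c R P β := by
  classical
  rw [h.coefBy_eq hR hα (isT_join hne hα hβ) (L := size P + 2) (by rw [size_add_bx]),
    h.coefBy_eq hR hP hβ (L := size P + 2) (by omega), col_add_of_ne _ _ _ _ hne]
  congr 1
  refine selProd_congr (fun _ => Iff.rfl) fun γ hγ => ?_
  have : α ≠ γ := by rintro rfl; exact hαβ hγ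
  exact add_bx_of_ne P this

/-- If adding a box to `α` makes it possible to add a box to `β`, then `g` vanishes. -/
lemma gpol_eq_zero_of_blocked (h : Resonant q₁ q₂ q₃ u a b) {P : Fin n → ℕ →₀ ℕ}
    {α β : Fin n × ℕ} (hne : α ≠ β) (hP : IsT a b P) (hα : IsT a b (P + bx α))
    (hβ : ¬ IsT a b (P + bx β)) (hαβ : IsT a b (P + bx α + bx β)) :
    gpol q₁ q₂ q₃ (col q₁ q₃ u P β) (col q₁ q₃ u P α) = 0 := by
  obtain ⟨δ, hδ⟩ := h.blocked hP hβ
  have hy : col q₁ q₃ u (P + bx α) β = col q₁ q₃ u P β := col_add_of_ne _ _ _ _ hne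
  by_cases e : α = δ
  · subst e
    rcases hδ with ⟨h1, -⟩ | ⟨h1, -⟩ <;> simp [gpol, ← h1]
  · exfalso
    rcases hδ with ⟨h1, -⟩ | ⟨h1, -⟩
    · exact h.q₃_col_ne hα hαβ (β := δ) (by rw [col_add_of_ne _ _ _ _ e, h1, hy])
    · exact h.q₂_col_ne hα hαβ (β := δ) (by rw [col_add_of_ne _ _ _ _ e, h1, hy])

/-- The quadratic relation between the coefficients. -/
lemma coefBy_quadratic (h : Resonant q₁ q₂ q₃ u a b) {c : ℂ}
    {R : Fin n × ℕ → Fin n × ℕ → Prop} (hR : RowOrder R) (P : Fin n → ℕ →₀ ℕ) {α β : Fin n × ℕ}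
    (hne : α ≠ β) :
    coefBy q₁ q₂ q₃ u a b c R P α * coefBy q₁ q₂ q₃ u a b c R (P + bx α) β *
        gpol q₁ q₂ q₃ (col q₁ q₃ u P β) (col q₁ q₃ u P α) =
      -(gpol q₁ q₂ q₃ (col q₁ q₃ u P α) (col q₁ q₃ u P β) *
        (coefBy q₁ q₂ q₃ u a b c R P β * coefBy q₁ q₂ q₃ u a b c R (P + bx β) α)) := by
  by_cases hP : IsT a b P
  swap
  · rw [coefBy_of_not (fun h => hP h.1), coefBy_of_not (fun h => hP h.1)]; simp
  by_cases hPαβ : IsT a b (P + bx α + bx β)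
  swap
  · rw [coefBy_of_not (P := P + bx α) (fun h => hPαβ h.2),
      coefBy_of_not (P := P + bx β) (fun h => hPαβ (add_right_comm P _ _ ▸ h.2))]
    simp
  -- If both boxes can be added first, one of the two coefficients is unchanged and the other
  -- acquires the ratio of g's. If only one can, one path has coefficient zero and g vanishes on the
  -- other. If neither can, both paths are zero.
  by_cases hα : IsT a b (P + bx α) <;> by_cases hβ : IsT a b (P + bx β)
  · rcases hR.total α β hne with hr | hr
    · rw [h.coefBy_add_of_not_rel hR hne.symm hP hβ hα (hR.asymm _ _ hr), mul_assoc,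
        h.coefBy_add_of_rel hR hP hα hβ hr]
      ring
    · rw [h.coefBy_add_of_not_rel hR hne hP hα hβ (hR.asymm _ _ hr)]
      linear_combination coefBy q₁ q₂ q₃ u a b c R P β * h.coefBy_add_of_rel hR hP hβ hα hr
  · rw [h.gpol_eq_zero_of_blocked hne hP hα hβ hPαβ,
      coefBy_of_not (P := P) (α := β) (fun h => hβ h.2)]
    simp
  · rw [h.gpol_eq_zero_of_blocked hne.symm hP hβ hα (add_right_comm P _ _ ▸ hPαβ),
      coefBy_of_not (P := P) (α := α) (fun h => hα h.2)]
    simp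
  · rw [coefBy_of_not (P := P) (α := α) (fun h => hα h.2),
      coefBy_of_not (P := P) (α := β) (fun h => hβ h.2)]
    simp

/-- The coefficients for an order and for the opposite one commute. -/
lemma coefBy_commute (h : Resonant q₁ q₂ q₃ u a b) {c d : ℂ}
    {R : Fin n × ℕ → Fin n × ℕ → Prop} (hR : RowOrder R) (hR' : RowOrder fun α β => R β α)
    (P : Fin n → ℕ →₀ ℕ) {α β : Fin n × ℕ} (hne : α ≠ β) :
    coefBy q₁ q₂ q₃ u a b d (fun α β => R β α) P α * coefBy q₁ q₂ q₃ u a b c R P β =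
      coefBy q₁ q₂ q₃ u a b c R (P + bx α) β *
        coefBy q₁ q₂ q₃ u a b d (fun α β => R β α) (P + bx β) α := by
  by_cases hα : IsT a b (P + bx α)
  swap
  · rw [coefBy_of_not (fun h => hα h.2), coefBy_of_not (P := P + bx α) (fun h => hα h.1)]; simp
  by_cases hβ : IsT a b (P + bx β)
  swap
  · rw [coefBy_of_not (P := P) (α := β) (fun h => hβ h.2),
      coefBy_of_not (P := P + bx β) (fun h => hβ h.1)]; simp
  have hP := isT_meet hne hα hβ
  rcases hR.total α β hne with hr | hr
  · have h1 := h.coefBy_add_of_rel hR (c := c) hP hα hβ hr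
    have h2 := h.coefBy_add_of_rel hR' (c := d) hP hβ hα hr
    have g1 := h.gpol_ne_zero hP hα hβ
    have g2 := h.gpol_ne_zero hP hβ hα
    -- The coefficient for `R` and the one for the opposite order acquire inverse ratios of g's,
    -- which cancel in the product.
    apply mul_right_cancel₀ (mul_ne_zero g1 g2)
    linear_combination (-coefBy q₁ q₂ q₃ u a b d (fun α β => R β α) (P + bx β) α *
      gpol q₁ q₂ q₃ (col q₁ q₃ u P α) (col q₁ q₃ u P β)) * h1 +
      (gpol q₁ q₂ q₃ (col q₁ q₃ u P α) (col q₁ q₃ u P β) *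
        coefBy q₁ q₂ q₃ u a b c R P β) * h2
  · rw [h.coefBy_add_of_not_rel hR hne hP hα hβ (hR.asymm _ _ hr),
      h.coefBy_add_of_not_rel hR' hne.symm hP hβ hα (hR.asymm _ _ hr), mul_comm]

open Classical in
/-- The product of the two coefficients for an order and for the opposite one. -/
lemma coefBy_mul_coefBy (h : Resonant q₁ q₂ q₃ u a b) {c d : ℂ}
    {R : Fin n × ℕ → Fin n × ℕ → Prop} (hR : RowOrder R) (hR' : RowOrder fun α β => R β α)
    {P : Fin n → ℕ →₀ ℕ} {α : Fin n × ℕ} (hP : IsT a b P) (hα : IsT a b (P + bx α)) {L : ℕ}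
    (hL : size P + 1 ≤ L) :
    coefBy q₁ q₂ q₃ u a b c R P α * coefBy q₁ q₂ q₃ u a b d (fun α β => R β α) P α =
      c * d * selProd q₁ q₂ q₃ u P (fun β => β ≠ α) L (col q₁ q₃ u P α) := by
  rw [h.coefBy_eq hR hP hα hL, h.coefBy_eq hR' hP hα hL, mul_mul_mul_comm]
  congr 1
  refine selProd_mul (fun β => ⟨hR.total β α, ?_⟩) fun β hβ => hR.asymm _ _ hβ.1 hβ.2
  rintro (hr | hr) rfl
  · exact hR.irrefl _ hr
  · exact hR.irrefl _ hr

end Resonant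

end Coefficients

/-! ### Partial fractions and expansions -/

section PartialFractions

open Polynomial

variable {ι κ : Type}

lemma map_prod_X_sub_C {F K : Type} [Field F] [Field K] (φ : F →+* K) (ζ : K) (S : Finset ι)
    (x : ι → F) : eval₂ φ ζ (∏ i ∈ S, (X - C (x i))) = ∏ i ∈ S, (ζ - φ (x i)) := by
  rw [eval₂_finsetProd]
  simp

/-- Partial fractions: the poles `y i` of the quotient, after cancellation with the zeros `x i`,
are simple and located at the points `c k`; the pole at `c k` is the one with index `j k`. -/
lemma partial_fractions [DecidableEq ι] [DecidableEq κ] {F K : Type} [Field F] [DecidableEq F] [Field K] (φ : F →+* K) (ζ : K)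
    (hζ : ∀ t, ζ ≠ φ t) (S : Finset ι) (x y : ι → F) (A : Finset κ) (c : κ → F)
    (hc : Set.InjOn c A)
    (hcount : ∀ w, (S.filter fun i => y i = w).card ≤
      (S.filter fun i => x i = w).card + (A.filter fun k => c k = w).card)
    (j : κ → ι) (hj : ∀ k ∈ A, j k ∈ S) (hyj : ∀ k ∈ A, ∀ i ∈ S, y i = c k ↔ i = j k) :
    ∏ i ∈ S, ((ζ - φ (x i)) / (ζ - φ (y i))) =
      1 + ∑ k ∈ A, φ ((c k - x (j k)) * ∏ i ∈ S.erase (j k), ((c k - x i) / (c k - y i))) /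
        (ζ - φ (c k)) := by
  have hne : ∀ t, ζ - φ t ≠ 0 := fun t => sub_ne_zero.2 (hζ t)
  set N : F[X] := ∏ i ∈ S, (X - C (x i)) with hN
  set D : F[X] := ∏ i ∈ S, (X - C (y i)) with hD
  set E : F[X] := ∏ k ∈ A, (X - C (c k)) with hE
  have hNm : N.Monic := monic_prod_of_monic _ _ fun i _ => monic_X_sub_C _
  have hDm : D.Monic := monic_prod_of_monic _ _ fun i _ => monic_X_sub_C _
  have hEm : E.Monic := monic_prod_of_monic _ _ fun i _ => monic_X_sub_C _
  -- The counting hypothesis is the inclusion of multisets of roots; the quotient M then satisfies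
  -- N/D = M/E with E squarefree.
  have hdvd : D ∣ N * E := by
    have e : D = (Multiset.map (fun a => X - C a) (S.val.map y)).prod := by
      rw [Multiset.map_map]; rfl
    have e1 : N = (Multiset.map (fun a => X - C a) (S.val.map x)).prod := by
      rw [Multiset.map_map]; rfl
    have e2 : E = (Multiset.map (fun a => X - C a) (A.val.map c)).prod := by
      rw [Multiset.map_map]; rfl
    rw [e, Multiset.prod_X_sub_C_dvd_iff_le_roots (hNm.mul hEm).ne_zero,
      roots_mul (hNm.mul hEm).ne_zero, e1, e2, roots_multiset_prod_X_sub_C,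
      roots_multiset_prod_X_sub_C, Multiset.le_iff_count]
    intro w
    rw [Multiset.count_add, Multiset.count_map, Multiset.count_map, Multiset.count_map]
    have := hcount w
    simp only [eq_comm (b := w)] at this
    exact this
  obtain ⟨M, hM⟩ := hdvd
  have hMm : M.Monic := hDm.of_mul_monic_left (hM ▸ hNm.mul hEm)
  have hdeg : M.natDegree = A.card := by
    have h1 := congrArg natDegree hM
    rw [hNm.natDegree_mul hEm, hDm.natDegree_mul hMm, hN, hD, hE, natDegree_finsetProd_X_sub_C_eq_card,
      natDegree_finsetProd_X_sub_C_eq_card, natDegree_finsetProd_X_sub_C_eq_card] at h1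
    omega
  have hEdeg : E.natDegree = A.card := natDegree_finsetProd_X_sub_C_eq_card _ _
  -- M and E are monic of equal degree, so M - E is determined by its values at the points c k
  -- through Lagrange interpolation, and these values are those of M.
  have hlt : (M - E).degree < A.card := by
    have hd : M.degree = E.degree := by
      rw [degree_eq_natDegree hMm.ne_zero, degree_eq_natDegree hEm.ne_zero, hdeg, hEdeg]
    refine (degree_sub_lt_left hd hMm.ne_zero ?_).trans_le ?_
    · rw [hMm.leadingCoeff, hEm.leadingCoeff]
    · rw [degree_eq_natDegree hMm.ne_zero, hdeg]
  have hinterp := Lagrange.eq_interpolate hc hlt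
  rw [Lagrange.interpolate_apply] at hinterp
  have hDζ : eval₂ φ ζ D ≠ 0 := by
    rw [map_prod_X_sub_C]; exact Finset.prod_ne_zero_iff.2 fun i _ => hne _
  have hEζ : eval₂ φ ζ E ≠ 0 := by
    rw [map_prod_X_sub_C]; exact Finset.prod_ne_zero_iff.2 fun i _ => hne _
  have h1 : ∏ i ∈ S, ((ζ - φ (x i)) / (ζ - φ (y i))) = eval₂ φ ζ M / eval₂ φ ζ E := by
    rw [Finset.prod_div_distrib, ← map_prod_X_sub_C, ← map_prod_X_sub_C, ← hN, ← hD,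
      div_eq_div_iff hDζ hEζ]
    have := congrArg (eval₂ φ ζ) hM
    rw [eval₂_mul, eval₂_mul] at this
    rw [this, mul_comm]
  rw [h1]
  have h2 : eval₂ φ ζ M = eval₂ φ ζ E + eval₂ φ ζ (M - E) := by rw [eval₂_sub]; ring
  rw [h2, add_div, div_self hEζ]
  congr 1
  rw [hinterp, eval₂_finsetSum, Finset.sum_div]
  refine Finset.sum_congr rfl fun k hk => ?_
  have hck : ∀ i ∈ A.erase k, c k - c i ≠ 0 := fun i hi => sub_ne_zero.2 fun e =>
    Finset.ne_of_mem_erase hi (hc (Finset.mem_of_mem_erase hi) hk e.symm)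
  have hyk : ∀ i ∈ S.erase (j k), c k - y i ≠ 0 := fun i hi => sub_ne_zero.2 fun e =>
    Finset.ne_of_mem_erase hi ((hyj k hk i (Finset.mem_of_mem_erase hi)).1 e.symm)
  have hEk : eval (c k) E = 0 := by
    rw [hE, eval_prod]
    exact Finset.prod_eq_zero hk (by simp)
  -- The value of M at c k follows from N·E = D·M after one factor X - c k is cancelled from both
  -- sides.
  have hres : eval (c k) M * ∏ i ∈ S.erase (j k), (c k - y i) =
      ((c k - x (j k)) * ∏ i ∈ S.erase (j k), (c k - x i)) * ∏ i ∈ A.erase k, (c k - c i) := by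
    have hM' : (X - C (c k)) * (N * ∏ i ∈ A.erase k, (X - C (c i))) =
        (X - C (c k)) * ((∏ i ∈ S.erase (j k), (X - C (y i))) * M) := by
      rw [← mul_assoc, ← mul_assoc, mul_comm (X - C (c k)) N, mul_assoc N,
        Finset.mul_prod_erase A (fun i => X - C (c i)) hk, ← hE, hM, hD,
        ← Finset.mul_prod_erase S (fun i => X - C (y i)) (hj k hk),
        (hyj k hk _ (hj k hk)).2 rfl]
    have := congrArg (eval (c k)) (mul_left_cancel₀ (X_sub_C_ne_zero _) hM')
    rw [eval_mul, eval_mul, hN, eval_prod, eval_prod, eval_prod] at this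
    simp only [eval_sub, eval_X, eval_C] at this
    rw [mul_comm, ← this, Finset.mul_prod_erase S (fun i => c k - x i) (hj k hk)]
  have hP1 : ∏ i ∈ A.erase k, (c k - c i) ≠ 0 := Finset.prod_ne_zero_iff.2 hck
  have hP2 : ∏ i ∈ S.erase (j k), (c k - y i) ≠ 0 := Finset.prod_ne_zero_iff.2 hyk
  have hb : eval₂ φ ζ (Lagrange.basis A c k) =
      (φ (∏ i ∈ A.erase k, (c k - c i)))⁻¹ * ∏ i ∈ A.erase k, (ζ - φ (c i)) := by
    rw [Lagrange.basis, eval₂_finsetProd, map_prod, ← Finset.prod_inv_distrib,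
      ← Finset.prod_mul_distrib]
    refine Finset.prod_congr rfl fun i _ => ?_
    simp [Lagrange.basisDivisor]
  have hM2 : eval (c k) M = ((c k - x (j k)) * ∏ i ∈ S.erase (j k), ((c k - x i) / (c k - y i))) *
      ∏ i ∈ A.erase k, (c k - c i) := by
    rw [Finset.prod_div_distrib]
    field_simp
    linear_combination hres
  rw [eval₂_mul, eval₂_C, hb, eval_sub, hEk, sub_zero, hM2, hE, map_prod_X_sub_C,
    ← Finset.mul_prod_erase A (fun i => ζ - φ (c i)) hk, map_mul φ _ (∏ i ∈ A.erase k, _)]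
  have hP3 : φ (∏ i ∈ A.erase k, (c k - c i)) ≠ 0 := (map_ne_zero φ).2 hP1
  have hP4 : ∏ i ∈ A.erase k, (ζ - φ (c i)) ≠ 0 := Finset.prod_ne_zero_iff.2 fun i _ => hne _
  have hP5 := hne (c k)
  field_simp

end PartialFractions

/-! ### Expansions at infinity and at zero. -/

section Expansions

/-- `z` as an element of the Laurent series in `z⁻¹`. -/
abbrev zInf : LaurentSeries ℂ := HahnSeries.single (-1 : ℤ) 1

/-- `z` as an element of the Laurent series in `z`. -/
abbrev zZero : LaurentSeries ℂ := HahnSeries.single (1 : ℤ) 1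

lemma zInf_mul_zZero : zInf * zZero = 1 := by simp

lemma zInf_ne (t : ℂ) : zInf ≠ HahnSeries.C t := by
  intro h
  have := congrArg (fun f => HahnSeries.coeff f (-1 : ℤ)) h
  simp [HahnSeries.C_apply] at this

lemma zZero_ne (t : ℂ) : zZero ≠ HahnSeries.C t := by
  intro h
  have := congrArg (fun f => HahnSeries.coeff f (1 : ℤ)) h
  simp [HahnSeries.C_apply] at this

lemma geom_mul (c : ℂ) :
    (PowerSeries.mk fun m => c ^ m) * (1 - PowerSeries.C c * PowerSeries.X) = 1 := by
  ext m
  rw [mul_sub, mul_one, ← mul_assoc, mul_comm _ (PowerSeries.C c), mul_assoc, map_sub,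
    PowerSeries.coeff_C_mul]
  cases m with
  | zero => simp
  | succ m => simp [PowerSeries.coeff_one, pow_succ, mul_comm]

lemma constantCoeff_geom (c : ℂ) :
    PowerSeries.constantCoeff (PowerSeries.mk fun m => c ^ m) = 1 := by
  rw [← PowerSeries.coeff_zero_eq_constantCoeff_apply, PowerSeries.coeff_mk, pow_zero]

lemma inv_zInf_sub (c : ℂ) : (zInf - HahnSeries.C c)⁻¹ =
    HahnSeries.ofPowerSeries ℤ ℂ (PowerSeries.X * PowerSeries.mk fun m => c ^ m) := by
  symm
  apply eq_inv_of_mul_eq_one_left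
  have h := congrArg (HahnSeries.ofPowerSeries ℤ ℂ) (geom_mul c)
  rw [map_mul, map_sub, map_one, map_mul, HahnSeries.ofPowerSeries_X, HahnSeries.ofPowerSeries_C]
    at h
  rw [map_mul, HahnSeries.ofPowerSeries_X]
  linear_combination h + (HahnSeries.ofPowerSeries ℤ ℂ (PowerSeries.mk fun m => c ^ m)) *
    zInf_mul_zZero

lemma inv_zZero_sub {c : ℂ} (hc : c ≠ 0) : (zZero - HahnSeries.C c)⁻¹ =
    HahnSeries.ofPowerSeries ℤ ℂ
      (PowerSeries.C (-c⁻¹) * PowerSeries.mk fun m => c⁻¹ ^ m) := by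
  symm
  apply eq_inv_of_mul_eq_one_left
  have h := congrArg (HahnSeries.ofPowerSeries ℤ ℂ) (geom_mul c⁻¹)
  rw [map_mul, map_sub, map_one, map_mul, HahnSeries.ofPowerSeries_X, HahnSeries.ofPowerSeries_C]
    at h
  rw [map_mul, HahnSeries.ofPowerSeries_C, map_neg]
  have hcc : (HahnSeries.C c⁻¹ : LaurentSeries ℂ) * HahnSeries.C c = 1 := by
    rw [← map_mul, inv_mul_cancel₀ hc, map_one]
  linear_combination h + (HahnSeries.ofPowerSeries ℤ ℂ (PowerSeries.mk fun m => c⁻¹ ^ m)) * hcc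

/-- The expansions of `1 / (z - c)` at infinity and at zero differ by a delta function. -/
lemma coeff_inv_sub {c : ℂ} (hc : c ≠ 0) (m : ℤ) :
    (zInf - HahnSeries.C c)⁻¹.coeff m - (zZero - HahnSeries.C c)⁻¹.coeff (-m) = c ^ (m - 1) := by
  rw [inv_zInf_sub, inv_zZero_sub hc, PowerSeries.coeff_coe, PowerSeries.coeff_coe]
  -- For m ≤ 0 only the expansion at zero contributes, for m > 0 only the one at infinity.
  rcases lt_trichotomy m 0 with hm | rfl | hm
  · obtain ⟨k, rfl⟩ : ∃ k : ℕ, m = -(k : ℤ) := ⟨m.natAbs, by omega⟩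
    rw [if_pos hm, if_neg (by omega), PowerSeries.coeff_C_mul, PowerSeries.coeff_mk]
    have : (-(-(k : ℤ))).natAbs = k := by omega
    rw [this, show (-(k : ℤ) - 1) = -((k + 1 : ℕ) : ℤ) by push_cast; ring, zpow_neg,
      zpow_natCast, pow_succ, mul_inv, inv_pow]
    ring
  · simp [zpow_neg]
  · obtain ⟨k, rfl⟩ : ∃ k : ℕ, m = (k : ℤ) + 1 := ⟨(m - 1).natAbs, by omega⟩
    rw [if_neg (by omega), if_pos (by omega)]
    have : ((k : ℤ) + 1).natAbs = k + 1 := by omega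
    rw [this, PowerSeries.coeff_succ_X_mul, PowerSeries.coeff_mk]
    simp

variable {ι : Type}

lemma exists_powerSeries_zInf (S : Finset ι) (x y : ι → ℂ) : ∃ F : PowerSeries ℂ,
    ∏ i ∈ S, ((zInf - HahnSeries.C (x i)) / (zInf - HahnSeries.C (y i))) =
      HahnSeries.ofPowerSeries ℤ ℂ F ∧ PowerSeries.constantCoeff F = 1 := by
  refine ⟨∏ i ∈ S, (1 - PowerSeries.C (x i) * PowerSeries.X) * PowerSeries.mk fun m => y i ^ m,
    ?_, ?_⟩
  · rw [map_prod]
    refine Finset.prod_congr rfl fun i _ => ?_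
    rw [div_eq_mul_inv, inv_zInf_sub]
    simp only [map_mul, map_sub, map_one, HahnSeries.ofPowerSeries_X, HahnSeries.ofPowerSeries_C]
    linear_combination (HahnSeries.ofPowerSeries ℤ ℂ (PowerSeries.mk fun m => y i ^ m)) *
      zInf_mul_zZero
  · rw [map_prod]
    refine Finset.prod_eq_one fun i _ => ?_
    rw [map_mul, constantCoeff_geom]
    simp

/-- The constant term is the product of the quotients x i / y i; its non-vanishing makes ψ⁻_0
invertible. -/
lemma exists_powerSeries_zZero (S : Finset ι) (x y : ι → ℂ) (hx : ∀ i ∈ S, x i ≠ 0)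
    (hy : ∀ i ∈ S, y i ≠ 0) : ∃ F : PowerSeries ℂ,
    ∏ i ∈ S, ((zZero - HahnSeries.C (x i)) / (zZero - HahnSeries.C (y i))) =
      HahnSeries.ofPowerSeries ℤ ℂ F ∧ PowerSeries.constantCoeff F ≠ 0 := by
  refine ⟨∏ i ∈ S, (PowerSeries.X - PowerSeries.C (x i)) *
    (PowerSeries.C (-(y i)⁻¹) * PowerSeries.mk fun m => (y i)⁻¹ ^ m), ?_, ?_⟩
  · rw [map_prod]
    refine Finset.prod_congr rfl fun i hi => ?_
    rw [div_eq_mul_inv, inv_zZero_sub (hy i hi)]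
    simp only [map_mul, map_sub, HahnSeries.ofPowerSeries_X, HahnSeries.ofPowerSeries_C]
  · rw [map_prod]
    refine Finset.prod_ne_zero_iff.2 fun i hi => ?_
    rw [map_mul, map_mul, map_sub, constantCoeff_geom]
    simp [hx i hi, hy i hi]

end Expansions

/-! ### The coefficients in the tensor product of Fock modules as truncated products -/

section Fock

variable {K : Type} [Field K] {q₁ q₂ q₃ : K}

/-- The parameters q₁^(p_j - j) q₂^(-j) of the vector representation collapse to q₁^(p_j) q₃^j,
since q₁q₂q₃ = 1. -/
lemma rowPsi_eq (hq : q₁ * q₂ * q₃ = 1) {u z : K} (hz : z ≠ 0) (p : ℕ →₀ ℕ) (j : ℕ) :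
    rowPsi q₁ q₂ q₃ p j (u / z) =
      headFactor q₂ (support q₁ q₃ u p j) z * tailFactor q₁ q₃ (support q₁ q₃ u p j) z := by
  have h1 : q₁ ≠ 0 := by rintro rfl; simp at hq
  have h2 : q₂ ≠ 0 := by rintro rfl; simp at hq
  have h3 : q₃ ≠ 0 := by rintro rfl; simp at hq
  have hx : q₁ ^ ((p j : ℤ) - j) * (q₂ ^ (-(j : ℤ)) * (u / z)) = support q₁ q₃ u p j / z := by
    have e : q₁ ^ (-(j : ℤ)) * q₂ ^ (-(j : ℤ)) = q₃ ^ j := by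
      rw [← mul_zpow, eq_inv_of_mul_eq_one_left hq]
      simp
    rw [sub_eq_add_neg, zpow_add₀ h1, support, ← e, zpow_natCast]
    ring
  have hx' : q₁ ^ ((p j : ℤ) - j - 1) * (q₂ ^ (-(j : ℤ)) * (u / z)) =
      q₁⁻¹ * (support q₁ q₃ u p j / z) := by
    rw [← hx, zpow_sub_one₀ h1]; ring
  have hd : ∀ t : K, 1 - t / z = (z - t) / z := fun t => by rw [sub_div, div_self hz]
  rw [rowPsi, vecPsi, hx', mul_right_comm, hx, mul_right_comm _ q₂, hx, headFactor, tailFactor,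
    div_mul_eq_mul_div, div_mul_eq_mul_div, mul_div_assoc', hd, hd, hd, hd, div_mul_div_comm,
    div_mul_div_comm, div_div_div_cancel_right₀ (mul_ne_zero hz hz), div_mul_div_comm,
    mul_comm (support q₁ q₃ u p j) q₃, mul_comm (support q₁ q₃ u p j) q₂,
    mul_comm (z - q₃ * _)]

lemma vacPsi_eq {t z : K} (hz : z ≠ 0) : vacPsi q₂ (t / z) = headFactor q₂ t z := by
  have hd : ∀ t : K, 1 - t / z = (z - t) / z := fun t => by rw [sub_div, div_self hz]
  rw [vacPsi, headFactor, mul_div_assoc', hd, hd, div_div_div_cancel_right₀ hz]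

lemma support_of_eq_zero {u : K} {p : ℕ →₀ ℕ} {j : ℕ} (h : p j = 0) :
    support q₁ q₃ u p j = support q₁ q₃ u 0 j := by
  simp [support, h]

/-- The value of a product over the rows of a partition, from a given one on. -/
lemma vacPsi_mul_prod (hq : q₁ * q₂ * q₃ = 1) {u z : K} (hz : z ≠ 0) (p : ℕ →₀ ℕ) (s L : ℕ)
    (hs : s ≤ L) (hp : p L = 0) (h0 : ∀ j, s ≤ j → z ≠ support q₁ q₃ u 0 j)
    (h1 : ∀ j, s ≤ j → z ≠ q₁⁻¹ * support q₁ q₃ u 0 j)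
    (h2 : ∀ j, s ≤ j → z ≠ q₂ * support q₁ q₃ u 0 j) :
    vacPsi q₂ (q₃ ^ s * (u / z)) *
        ∏ j ∈ Finset.Ico s L, rowPsi q₁ q₂ q₃ p j (u / z) / rowPsi q₁ q₂ q₃ 0 j (u / z) =
      (∏ j ∈ Finset.Ico s (L + 1), headFactor q₂ (support q₁ q₃ u p j) z) *
        ∏ j ∈ Finset.Ico s L, tailFactor q₁ q₃ (support q₁ q₃ u p j) z := by
  have q1 : q₁ ≠ 0 := by rintro rfl; simp at hq
  -- The vacuum factor is the head factor of an empty row s. Dividing by the contributions of the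
  -- empty rows from s to M - 1 moves it to the empty row M.
  have key : ∀ M, s ≤ M → vacPsi q₂ (q₃ ^ s * (u / z)) *
        ∏ j ∈ Finset.Ico s M, rowPsi q₁ q₂ q₃ p j (u / z) / rowPsi q₁ q₂ q₃ 0 j (u / z) =
      headFactor q₂ (support q₁ q₃ u 0 M) z * ∏ j ∈ Finset.Ico s M,
        (headFactor q₂ (support q₁ q₃ u p j) z * tailFactor q₁ q₃ (support q₁ q₃ u p j) z) := by
    intro M hM
    induction M, hM using Nat.le_induction with
    | base =>
      have : q₃ ^ s * u = support q₁ q₃ u 0 s := by simp [support]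
      rw [mul_div_assoc', vacPsi_eq hz, this]
      simp
    | succ M hM ih =>
      rw [Finset.prod_Ico_succ_top hM, ← mul_assoc, ih, Finset.prod_Ico_succ_top hM,
        rowPsi_eq hq hz, rowPsi_eq hq hz]
      have a0 := sub_ne_zero.2 (h0 M hM)
      have a1 := sub_ne_zero.2 (h1 M hM)
      have a2 := sub_ne_zero.2 (h2 M hM)
      have a3 := sub_ne_zero.2 (h0 (M + 1) (hM.trans (Nat.le_succ M)))
      have e : support q₁ q₃ u 0 (M + 1) = q₃ * support q₁ q₃ u 0 M := by
        simp [support, pow_succ]; ring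
      have e2 : q₂ * (q₃ * support q₁ q₃ u 0 M) = q₁⁻¹ * support q₁ q₃ u 0 M := by
        field_simp
        linear_combination support q₁ q₃ u 0 M * hq
      have hh : headFactor q₂ (support q₁ q₃ u 0 M) z ≠ 0 := div_ne_zero a2 a0
      have e3 : tailFactor q₁ q₃ (support q₁ q₃ u 0 M) z *
          headFactor q₂ (support q₁ q₃ u 0 (M + 1)) z = 1 := by
        rw [e] at a3 ⊢
        rw [tailFactor, headFactor, e2, div_mul_div_comm, mul_comm (z - q₃ * _),
          div_self (mul_ne_zero a1 a3)]
      have ht := left_ne_zero_of_mul_eq_one e3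
      rw [eq_inv_of_mul_eq_one_right e3]
      field_simp
  rw [key L hs, Finset.prod_Ico_succ_top hs, Finset.prod_mul_distrib, support_of_eq_zero hp]
  ring

lemma rowPsi_zero_ne_zero (hq : q₁ * q₂ * q₃ = 1) {u z : K} (hz : z ≠ 0) {j : ℕ}
    (h0 : z ≠ support q₁ q₃ u 0 j) (h1 : z ≠ q₁⁻¹ * support q₁ q₃ u 0 j)
    (h2 : z ≠ q₂ * support q₁ q₃ u 0 j) (h3 : z ≠ q₃ * support q₁ q₃ u 0 j) :
    rowPsi q₁ q₂ q₃ 0 j (u / z) ≠ 0 := by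
  rw [rowPsi_eq hq hz]
  exact mul_ne_zero (div_ne_zero (sub_ne_zero.2 h2) (sub_ne_zero.2 h0))
    (div_ne_zero (sub_ne_zero.2 h3) (sub_ne_zero.2 h1))

lemma rowPsi_congr {p p' : ℕ →₀ ℕ} {j : ℕ} (h : p j = p' j) (x : K) :
    rowPsi q₁ q₂ q₃ p j x = rowPsi q₁ q₂ q₃ p' j x := by
  rw [rowPsi, rowPsi, h]

/-- The condition on z keeps it off every zero and pole of the empty rows, so the quotients that
should be 1 are 1 and the product is finite. -/
lemma fockPsi_eq (hq : q₁ * q₂ * q₃ = 1) {u z : K} (hz : z ≠ 0) (p : ℕ →₀ ℕ) (L : ℕ)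
    (hp : ∀ j, L ≤ j → p j = 0) (hu : ∀ i j : ℤ, q₁ ^ i * q₃ ^ j * u ≠ z) :
    fockPsi q₁ q₂ q₃ p (u / z) =
      (∏ j ∈ Finset.range (L + 1), headFactor q₂ (support q₁ q₃ u p j) z) *
        ∏ j ∈ Finset.range L, tailFactor q₁ q₃ (support q₁ q₃ u p j) z := by
  have q1 : q₁ ≠ 0 := by rintro rfl; simp at hq
  have q3 : q₃ ≠ 0 := by rintro rfl; simp at hq
  have h0 : ∀ j, z ≠ support q₁ q₃ u 0 j := fun j e =>
    hu 0 j (by rw [e]; simp [support])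
  have h1 : ∀ j, z ≠ q₁⁻¹ * support q₁ q₃ u 0 j := fun j e =>
    hu (-1) j (by rw [e]; simp [support]; ring)
  have h2 : ∀ j, z ≠ q₂ * support q₁ q₃ u 0 j := fun j e =>
    hu (-1) (j - 1) (by
      rw [e, zpow_sub₀ q3, zpow_natCast]
      simp only [support, Finsupp.coe_zero, Pi.zero_apply, pow_zero, one_mul, zpow_neg_one, zpow_one]
      field_simp
      linear_combination -u * hq)
  have h3 : ∀ j, z ≠ q₃ * support q₁ q₃ u 0 j := fun j e =>
    hu 0 (j + 1) (by rw [e, zpow_add₀ q3]; simp [support]; ring)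
  rw [fockPsi, finprod_eq_prod_of_mulSupport_subset (s := Finset.Ico 0 L)]
  · have := vacPsi_mul_prod hq hz p 0 L (Nat.zero_le _) (hp L le_rfl) (fun j _ => h0 j)
      (fun j _ => h1 j) (fun j _ => h2 j)
    rw [pow_zero, one_mul] at this
    rw [this, Nat.Ico_zero_eq_range, Nat.Ico_zero_eq_range]
  · intro j hj
    by_contra hn
    refine hj ?_
    simp only [Finset.coe_Ico, Set.mem_Ico, not_and, not_lt] at hn
    dsimp only
    rw [rowPsi_congr (hp j (hn (Nat.zero_le j))) (p' := 0),
      div_self (rowPsi_zero_ne_zero hq hz (h0 j) (h1 j) (h2 j) (h3 j))]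

/-- The order in which the comultiplication arranges the rows. -/
def Prec {n : ℕ} (β α : Fin n × ℕ) : Prop := β.1 < α.1 ∨ β.1 = α.1 ∧ β.2 < α.2

instance {n : ℕ} (β α : Fin n × ℕ) : Decidable (Prec β α) := by unfold Prec; infer_instance

lemma prec_rowOrder {n : ℕ} : RowOrder (Prec (n := n)) where
  irrefl α := by simp [Prec]
  asymm α β h := by unfold Prec at *; omega
  total α β h := by
    unfold Prec
    by_contra hn
    exact h (Prod.ext (by omega) (by omega))
  tail α l j h := by
    constructor <;> intro h' <;> simp only [Prec] at h' ⊢ <;> omega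

lemma prec_rowOrder_flip {n : ℕ} : RowOrder fun α β : Fin n × ℕ => Prec β α where
  irrefl α := prec_rowOrder.irrefl α
  asymm α β h := prec_rowOrder.asymm _ _ h
  total α β h := prec_rowOrder.total _ _ h.symm
  tail α l j h := by
    constructor <;> intro h' <;> simp only [Prec] at h' ⊢ <;> omega

variable {n : ℕ} {u : Fin n → K} {P : Fin n → ℕ →₀ ℕ}

lemma selProd_eq_prod (S : Fin n × ℕ → Prop) [DecidablePred S] (L : ℕ) (z : K) :
    selProd q₁ q₂ q₃ u P S L z = ∏ l, (
      (∏ j ∈ (Finset.range (L + 1)).filter fun j => S (l, j),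
        headFactor q₂ (support q₁ q₃ (u l) (P l) j) z) *
      ∏ j ∈ (Finset.range L).filter fun j => S (l, j),
        tailFactor q₁ q₃ (support q₁ q₃ (u l) (P l) j) z) := by
  unfold selProd rows
  rw [Finset.prod_product, Finset.prod_product, ← Finset.prod_mul_distrib]
  simp only [Finset.prod_filter]
  rfl

lemma prod_split (k : Fin n) (f : Fin n → K) :
    ∏ l, f l = (∏ l ∈ Finset.univ.filter (fun l => l < k), f l) * f k *
      ∏ l ∈ Finset.univ.filter (fun l => k < l), f l := by
  have e : f k = ∏ l, if l = k then f l else 1 := by simp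
  rw [Finset.prod_filter, Finset.prod_filter, e, ← Finset.prod_mul_distrib,
    ← Finset.prod_mul_distrib]
  refine Finset.prod_congr rfl fun l _ => ?_
  rcases lt_trichotomy l k with h | rfl | h
  · simp [h, h.ne, h.not_gt]
  · simp
  · simp [h, h.ne', h.not_gt]

/-- The factors ψ⁻ of the comultiplication supply all rows of the earlier partitions, and the Fock
formula the earlier rows of partition k: together the rows before (k, s) in `Prec`. -/
lemma tensorE_eq (hq : q₁ * q₂ * q₃ = 1) (k : Fin n) (s L : ℕ) (m : ℤ) (hs : s < L)
    (hP : ∀ l j, L ≤ j → P l j = 0) (hz : col q₁ q₃ u P (k, s) ≠ 0)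
    (hu : ∀ l, l ≠ k → ∀ i j : ℤ, q₁ ^ i * q₃ ^ j * u l ≠ col q₁ q₃ u P (k, s)) :
    tensorE q₁ q₂ q₃ u P k s m = (1 - q₁)⁻¹ *
      selProd q₁ q₂ q₃ u P (fun β => Prec β (k, s)) L (col q₁ q₃ u P (k, s)) *
        col q₁ q₃ u P (k, s) ^ m := by
  have hz' : support q₁ q₃ (u k) (P k) s = col q₁ q₃ u P (k, s) := rfl
  rw [tensorE, fockE, hz', selProd_eq_prod, prod_split k]
  generalize col q₁ q₃ u P (k, s) = z at *
  have e1 : ∏ l ∈ Finset.univ.filter (fun l => l < k), fockPsi q₁ q₂ q₃ (P l) (u l / z) =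
      ∏ l ∈ Finset.univ.filter (fun l => l < k), (
      (∏ j ∈ (Finset.range (L + 1)).filter fun j => Prec (l, j) (k, s),
        headFactor q₂ (support q₁ q₃ (u l) (P l) j) z) *
      ∏ j ∈ (Finset.range L).filter fun j => Prec (l, j) (k, s),
        tailFactor q₁ q₃ (support q₁ q₃ (u l) (P l) j) z) := by
    refine Finset.prod_congr rfl fun l hl => ?_
    have hl : l < k := (Finset.mem_filter.1 hl).2
    rw [fockPsi_eq hq hz (P l) L (hP l) (hu l hl.ne), Finset.filter_true_of_mem,
      Finset.filter_true_of_mem]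
    · exact fun j _ => Or.inl hl
    · exact fun j _ => Or.inl hl
  have e2 : ∏ l ∈ Finset.univ.filter (fun l => k < l), (
      (∏ j ∈ (Finset.range (L + 1)).filter fun j => Prec (l, j) (k, s),
        headFactor q₂ (support q₁ q₃ (u l) (P l) j) z) *
      ∏ j ∈ (Finset.range L).filter fun j => Prec (l, j) (k, s),
        tailFactor q₁ q₃ (support q₁ q₃ (u l) (P l) j) z) = 1 := by
    refine Finset.prod_eq_one fun l hl => ?_
    have hl : k < l := (Finset.mem_filter.1 hl).2
    rw [Finset.filter_false_of_mem, Finset.filter_false_of_mem]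
    · simp
    · intro j _; simp only [Prec]; omega
    · intro j _; simp only [Prec]; omega
  have e3 : ∀ M, s ≤ M → (Finset.range M).filter (fun j => Prec (k, j) (k, s)) =
      Finset.range s := by
    intro M hM; ext j
    simp only [Finset.mem_filter, Finset.mem_range, Prec, lt_irrefl, true_and, false_or]; omega
  rw [e1, e2, e3 _ (by omega), e3 _ (by omega), ← Finset.prod_mul_distrib]
  simp only [rowPsi_eq hq hz]
  ring

/-- Mirror image of `tensorE_eq`. The Fock formula now divides by empty rows of partition k itself,
so q₁ and q₃ must be multiplicatively independent for these divisions to be legitimate. -/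
lemma tensorF_eq (hq : q₁ * q₂ * q₃ = 1) (k : Fin n) (s L : ℕ) (m : ℤ) (hs : s < L)
    (hP : ∀ l j, L ≤ j → P l j = 0) (hz : col q₁ q₃ u P (k, s) ≠ 0)
    (hgen : ∀ i j : ℤ, q₁ ^ i * q₃ ^ j = 1 → i = 0 ∧ j = 0)
    (hu : ∀ l, l ≠ k → ∀ i j : ℤ, q₁ ^ i * q₃ ^ j * u l ≠ col q₁ q₃ u P (k, s)) :
    tensorF q₁ q₂ q₃ u P k s m = q₁ / (1 - q₁) *
      selProd q₁ q₂ q₃ u P (fun β => Prec (k, s) β) L (col q₁ q₃ u P (k, s)) *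
        col q₁ q₃ u P (k, s) ^ m := by
  have q1 : q₁ ≠ 0 := by rintro rfl; simp at hq
  have q3 : q₃ ≠ 0 := by rintro rfl; simp at hq
  have hz' : support q₁ q₃ (u k) (P k) s = col q₁ q₃ u P (k, s) := rfl
  have hsup : ∀ i j : ℤ, q₁ ^ i * q₃ ^ j * u k = col q₁ q₃ u P (k, s) → i = P k s ∧ j = s := by
    intro i j h
    have huk : u k ≠ 0 := by
      intro h0; rw [col_def] at hz; simp [h0] at hz
    rw [col_def] at h
    have h := mul_right_cancel₀ huk h
    have := hgen (i - P k s) (j - s) (by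
      rw [zpow_sub₀ q1, zpow_sub₀ q3, zpow_natCast, zpow_natCast]
      rw [div_mul_div_comm, h, div_self (by positivity)])
    omega
  rw [tensorF, fockF, hz', selProd_eq_prod, prod_split k]
  generalize col q₁ q₃ u P (k, s) = z at *
  have h0 : ∀ j, s + 1 ≤ j → z ≠ support q₁ q₃ (u k) 0 j := fun j hj e => by
    have := hsup 0 j (by rw [e]; simp [support]); omega
  have h1 : ∀ j, s + 1 ≤ j → z ≠ q₁⁻¹ * support q₁ q₃ (u k) 0 j := fun j hj e => by
    have := hsup (-1) j (by rw [e]; simp [support]; ring); omega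
  have h2 : ∀ j, s + 1 ≤ j → z ≠ q₂ * support q₁ q₃ (u k) 0 j := fun j hj e => by
    have := hsup (-1) (j - 1) (by
      rw [e, zpow_sub₀ q3, zpow_natCast]
      simp only [support, Finsupp.coe_zero, Pi.zero_apply, pow_zero, one_mul, zpow_neg_one, zpow_one]
      field_simp
      linear_combination -u k * hq)
    omega
  have h3 : ∀ j, s + 1 ≤ j → z ≠ q₃ * support q₁ q₃ (u k) 0 j := fun j hj e => by
    have := hsup 0 (j + 1) (by rw [e, zpow_add₀ q3]; simp [support]; ring); omega
  have e1 : ∏ l ∈ Finset.univ.filter (fun l => k < l), fockPsi q₁ q₂ q₃ (P l) (u l / z) =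
      ∏ l ∈ Finset.univ.filter (fun l => k < l), (
      (∏ j ∈ (Finset.range (L + 1)).filter fun j => Prec (k, s) (l, j),
        headFactor q₂ (support q₁ q₃ (u l) (P l) j) z) *
      ∏ j ∈ (Finset.range L).filter fun j => Prec (k, s) (l, j),
        tailFactor q₁ q₃ (support q₁ q₃ (u l) (P l) j) z) := by
    refine Finset.prod_congr rfl fun l hl => ?_
    have hl : k < l := (Finset.mem_filter.1 hl).2
    rw [fockPsi_eq hq hz (P l) L (hP l) (hu l hl.ne'), Finset.filter_true_of_mem,
      Finset.filter_true_of_mem]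
    · exact fun j _ => Or.inl hl
    · exact fun j _ => Or.inl hl
  have e2 : ∏ l ∈ Finset.univ.filter (fun l => l < k), (
      (∏ j ∈ (Finset.range (L + 1)).filter fun j => Prec (k, s) (l, j),
        headFactor q₂ (support q₁ q₃ (u l) (P l) j) z) *
      ∏ j ∈ (Finset.range L).filter fun j => Prec (k, s) (l, j),
        tailFactor q₁ q₃ (support q₁ q₃ (u l) (P l) j) z) = 1 := by
    refine Finset.prod_eq_one fun l hl => ?_
    have hl : l < k := (Finset.mem_filter.1 hl).2
    rw [Finset.filter_false_of_mem, Finset.filter_false_of_mem]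
    · simp
    · intro j _; simp only [Prec]; omega
    · intro j _; simp only [Prec]; omega
  have e3 : ∀ M, (Finset.range M).filter (fun j => Prec (k, s) (k, j)) =
      Finset.Ico (s + 1) M := by
    intro M; ext j
    simp only [Finset.mem_filter, Finset.mem_range, Finset.mem_Ico, Prec, lt_irrefl, true_and,
      false_or]
    omega
  have e4 : ∏ᶠ j : ℕ, (if s < j then
      rowPsi q₁ q₂ q₃ (P k) j (u k / z) / rowPsi q₁ q₂ q₃ 0 j (u k / z) else 1) =
      ∏ j ∈ Finset.Ico (s + 1) L,
        rowPsi q₁ q₂ q₃ (P k) j (u k / z) / rowPsi q₁ q₂ q₃ 0 j (u k / z) := by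
    rw [finprod_eq_prod_of_mulSupport_subset (s := Finset.Ico (s + 1) L)]
    · refine Finset.prod_congr rfl fun j hj => if_pos ?_
      have := Finset.mem_Ico.1 hj; omega
    · intro j hj
      by_contra hn
      refine hj ?_
      simp only [Finset.coe_Ico, Set.mem_Ico, not_and, not_lt] at hn
      dsimp only
      split_ifs with hsj
      · rw [rowPsi_congr (hP k j (hn hsj)) (p' := 0),
          div_self (rowPsi_zero_ne_zero hq hz (h0 j hsj) (h1 j hsj) (h2 j hsj) (h3 j hsj))]
      · rfl
  have e5 := vacPsi_mul_prod hq hz (P k) (s + 1) L hs (hP k L le_rfl) h0 h1 h2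
  rw [e1, e2, e3, e3, ← e5, e4]
  ring

lemma prod_fockPsi_eq (hq : q₁ * q₂ * q₃ = 1) {z : K} (hz : z ≠ 0) (L : ℕ)
    (hP : ∀ l j, L ≤ j → P l j = 0) (hu : ∀ l, ∀ i j : ℤ, q₁ ^ i * q₃ ^ j * u l ≠ z) :
    ∏ l, fockPsi q₁ q₂ q₃ (P l) (u l / z) = selProd q₁ q₂ q₃ u P (fun _ => True) L z := by
  rw [selProd_eq_prod]
  refine Finset.prod_congr rfl fun l _ => ?_
  rw [fockPsi_eq hq hz (P l) L (hP l) (hu l), Finset.filter_true_of_mem (by simp),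
    Finset.filter_true_of_mem (by simp)]

end Fock

/-! ### Values at special parameters -/

section Values

variable {n : ℕ} {q₁ q₃ : ℂ} {u : Fin n → ℂ}

namespace HasValueAt

lemma of_poly (N : ParamPoly n) : HasValueAt q₁ q₃ u (algebraMap _ (GenericField n) N)
    (MvPolynomial.eval (Sum.elim ![q₁, q₃] u) N) :=
  ⟨N, 1, by simp, by simp, by simp⟩

lemma one : HasValueAt q₁ q₃ u (1 : GenericField n) 1 := ⟨1, 1, by simp, by simp, by simp⟩

lemma mul {r r' : GenericField n} {c c' : ℂ} (h : HasValueAt q₁ q₃ u r c)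
    (h' : HasValueAt q₁ q₃ u r' c') : HasValueAt q₁ q₃ u (r * r') (c * c') := by
  obtain ⟨N, D, h1, h2, rfl⟩ := h
  obtain ⟨N', D', h1', h2', rfl⟩ := h'
  refine ⟨N * N', D * D', ?_, ?_, ?_⟩
  · rw [map_mul, map_mul, ← h1, ← h1']; ring
  · rw [map_mul]; exact mul_ne_zero h2 h2'
  · rw [map_mul, map_mul, div_mul_div_comm]

lemma sub {r r' : GenericField n} {c c' : ℂ} (h : HasValueAt q₁ q₃ u r c)
    (h' : HasValueAt q₁ q₃ u r' c') : HasValueAt q₁ q₃ u (r - r') (c - c') := by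
  obtain ⟨N, D, h1, h2, rfl⟩ := h
  obtain ⟨N', D', h1', h2', rfl⟩ := h'
  refine ⟨N * D' - D * N', D * D', ?_, ?_, ?_⟩
  · rw [map_mul, map_sub, map_mul, map_mul, ← h1, ← h1']; ring
  · rw [map_mul]; exact mul_ne_zero h2 h2'
  · rw [map_mul, map_sub, map_mul, map_mul, div_sub_div _ _ h2 h2']

lemma inv {r : GenericField n} {c : ℂ} (h : HasValueAt q₁ q₃ u r c) (hc : c ≠ 0) :
    HasValueAt q₁ q₃ u r⁻¹ c⁻¹ := by
  obtain ⟨N, D, h1, h2, rfl⟩ := h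
  have hN : MvPolynomial.eval (Sum.elim ![q₁, q₃] u) N ≠ 0 := (div_ne_zero_iff.1 hc).1
  refine ⟨D, N, ?_, hN, by rw [inv_div]⟩
  have hr : r ≠ 0 := by
    rintro rfl
    rw [zero_mul, eq_comm, IsFractionRing.to_map_eq_zero_iff] at h1
    simp [h1] at hN
  rw [← h1, inv_mul_cancel_left₀ hr]

lemma div {r r' : GenericField n} {c c' : ℂ} (h : HasValueAt q₁ q₃ u r c)
    (h' : HasValueAt q₁ q₃ u r' c') (hc : c' ≠ 0) : HasValueAt q₁ q₃ u (r / r') (c / c') := by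
  rw [div_eq_mul_inv, div_eq_mul_inv]
  exact h.mul (h'.inv hc)

lemma pow {r : GenericField n} {c : ℂ} (h : HasValueAt q₁ q₃ u r c) (m : ℕ) :
    HasValueAt q₁ q₃ u (r ^ m) (c ^ m) := by
  induction m with
  | zero => simpa using one
  | succ m ih => rw [pow_succ, pow_succ]; exact ih.mul h

lemma zpow {r : GenericField n} {c : ℂ} (h : HasValueAt q₁ q₃ u r c) (hc : c ≠ 0) (m : ℤ) :
    HasValueAt q₁ q₃ u (r ^ m) (c ^ m) := by
  cases m with
  | ofNat m => simpa using h.pow m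
  | negSucc m => rw [zpow_negSucc, zpow_negSucc]; exact (h.pow _).inv (pow_ne_zero _ hc)

lemma prod {ι : Type} (S : Finset ι) {r : ι → GenericField n} {c : ι → ℂ}
    (h : ∀ i ∈ S, HasValueAt q₁ q₃ u (r i) (c i)) :
    HasValueAt q₁ q₃ u (∏ i ∈ S, r i) (∏ i ∈ S, c i) := by
  classical
  induction S using Finset.induction_on with
  | empty => simpa using one
  | insert i S hi ih =>
    rw [Finset.prod_insert hi, Finset.prod_insert hi]
    exact (h i (Finset.mem_insert_self i S)).mul
      (ih fun j hj => h j (Finset.mem_insert_of_mem hj))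

lemma unique {r : GenericField n} {c c' : ℂ} (h : HasValueAt q₁ q₃ u r c)
    (h' : HasValueAt q₁ q₃ u r c') : c = c' := by
  obtain ⟨N, D, h1, h2, rfl⟩ := h
  obtain ⟨N', D', h1', h2', rfl⟩ := h'
  have e : N * D' = N' * D := by
    apply IsFractionRing.injective (ParamPoly n) (GenericField n)
    rw [map_mul, map_mul, ← h1, ← h1']; ring
  rw [div_eq_div_iff h2 h2', ← map_mul, ← map_mul, e]

/-- Used to prove generic statements: one specialisation with a non-zero value suffices. -/
lemma ne_zero {r : GenericField n} {c : ℂ} (h : HasValueAt q₁ q₃ u r c) (hc : c ≠ 0) : r ≠ 0 := by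
  rintro rfl
  have h0 := h.sub h
  rw [sub_self] at h0
  exact hc (by simpa using h.unique h0)

lemma genQ1 : HasValueAt q₁ q₃ u (genQ1 n) q₁ := by
  unfold QuantumCgl.genQ1
  simpa using of_poly (q₁ := q₁) (q₃ := q₃) (u := u) (MvPolynomial.X (Sum.inl 0))

lemma genQ3 : HasValueAt q₁ q₃ u (genQ3 n) q₃ := by
  unfold QuantumCgl.genQ3
  simpa using of_poly (q₁ := q₁) (q₃ := q₃) (u := u) (MvPolynomial.X (Sum.inl 1))

lemma genU (i : Fin n) : HasValueAt q₁ q₃ u (genU n i) (u i) := by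
  unfold QuantumCgl.genU
  simpa using of_poly (q₁ := q₁) (q₃ := q₃) (u := u) (MvPolynomial.X (Sum.inr i))

lemma col (P : Fin n → ℕ →₀ ℕ) (α : Fin n × ℕ) :
    HasValueAt q₁ q₃ u (QuantumCgl.col (QuantumCgl.genQ1 n) (QuantumCgl.genQ3 n)
      (QuantumCgl.genU n) P α) (QuantumCgl.col q₁ q₃ u P α) :=
  ((genQ1.pow _).mul (genQ3.pow _)).mul (genU _)

/-- Only the denominators z - t and z - q₁⁻¹t can prevent specialisation; the two hypotheses say
that they survive. -/
lemma selProd {q₂ : ℂ} (hq : q₁ * q₂ * q₃ = 1) (P : Fin n → ℕ →₀ ℕ) (S : Fin n × ℕ → Prop)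
    [DecidablePred S] (L : ℕ) {z : GenericField n} {z₀ : ℂ} (hz : HasValueAt q₁ q₃ u z z₀)
    (h0 : ∀ β, S β → z₀ ≠ QuantumCgl.col q₁ q₃ u P β)
    (h1 : ∀ β, S β → z₀ ≠ q₁⁻¹ * QuantumCgl.col q₁ q₃ u P β) :
    HasValueAt q₁ q₃ u (QuantumCgl.selProd (QuantumCgl.genQ1 n) (genQ2 n) (QuantumCgl.genQ3 n)
      (QuantumCgl.genU n) P S L z) (QuantumCgl.selProd q₁ q₂ q₃ u P S L z₀) := by
  have hq1 : q₁ ≠ 0 := by rintro rfl; simp at hq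
  have hq3 : q₃ ≠ 0 := by rintro rfl; simp at hq
  have hq2 : HasValueAt q₁ q₃ u (genQ2 n) q₂ := by
    have : q₂ = (q₁ * q₃)⁻¹ := by field_simp; linear_combination hq
    rw [this]
    exact (genQ1.mul genQ3).inv (mul_ne_zero hq1 hq3)
  refine mul (prod _ fun β _ => ?_) (prod _ fun β _ => ?_)
  · split_ifs with h
    · exact (hz.sub (hq2.mul (col P β))).div (hz.sub (col P β)) (sub_ne_zero.2 (h0 β h))
    · exact one
  · split_ifs with h
    · exact (hz.sub (genQ3.mul (col P β))).div (hz.sub ((genQ1.inv hq1).mul (col P β)))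
        (sub_ne_zero.2 (h1 β h))
    · exact one

end HasValueAt

lemma genQ1_mul_genQ2_mul_genQ3 : genQ1 n * genQ2 n * genQ3 n = 1 := by
  have h1 : genQ1 n ≠ 0 :=
    (HasValueAt.genQ1 (q₁ := 1) (q₃ := 1) (u := fun _ => 1)).ne_zero one_ne_zero
  have h3 : genQ3 n ≠ 0 :=
    (HasValueAt.genQ3 (q₁ := 1) (q₃ := 1) (u := fun _ => 1)).ne_zero one_ne_zero
  rw [genQ2]
  field_simp

lemma generic_exponents (i j : ℤ) (h : genQ1 n ^ i * genQ3 n ^ j = 1) : i = 0 ∧ j = 0 := by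
  have key : ∀ x y : ℂ, x ≠ 0 → y ≠ 0 → x ^ i * y ^ j = 1 := by
    intro x y hx hy
    have := (HasValueAt.genQ1 (q₁ := x) (q₃ := y) (u := (0 : Fin n → ℂ))).zpow hx i |>.mul
      (HasValueAt.genQ3.zpow hy j)
    rw [h] at this
    exact this.unique HasValueAt.one
  have two : ∀ m : ℤ, (2 : ℂ) ^ m = 1 → m = 0 := by
    intro m hm
    have : (2 : ℝ) ^ m = 1 := by simpa using congrArg norm hm
    exact (zpow_eq_one_iff_right₀ (by norm_num) (by norm_num)).1 this
  -- At (2, 1) only the first exponent remains, at (1, 2) only the second.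
  exact ⟨two i (by simpa using key 2 1), two j (by simpa using key 1 2)⟩

lemma generic_col_ne (P : Fin n → ℕ →₀ ℕ) {l : Fin n} {α : Fin n × ℕ} (hl : l ≠ α.1) (i j : ℤ) :
    genQ1 n ^ i * genQ3 n ^ j * genU n l ≠ col (genQ1 n) (genQ3 n) (genU n) P α := by
  intro h
  -- With q₁ = q₃ = 1, u_l = 1 and every other parameter zero, the two sides take the values 1 and
  -- 0.
  have h1 := ((HasValueAt.genQ1 (q₁ := 1) (q₃ := 1) (u := Pi.single l (1 : ℂ))).zpow
    one_ne_zero i |>.mul (HasValueAt.genQ3.zpow one_ne_zero j)).mul (HasValueAt.genU l)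
  rw [h] at h1
  have := h1.unique (HasValueAt.col P α)
  simp [col_def, hl.symm] at this

lemma generic_col_ne_zero (P : Fin n → ℕ →₀ ℕ) (α : Fin n × ℕ) :
    col (genQ1 n) (genQ3 n) (genU n) P α ≠ 0 := by
  refine (HasValueAt.col (q₁ := 1) (q₃ := 1) (u := fun _ => 1) P α).ne_zero ?_
  simp [col_def]

end Values

/-! ### The eigenvalues of `ψ^±(z)` -/

section Psi

variable {n : ℕ} {q₁ q₂ q₃ : ℂ} {u : Fin n → ℂ}

/-- The eigenvalue of `ψ⁺(z)`, as a Laurent series in `z⁻¹`. -/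
def psiInf (q₁ q₂ q₃ : ℂ) (u : Fin n → ℂ) (P : Fin n → ℕ →₀ ℕ) : LaurentSeries ℂ :=
  ∏ k : Fin n, fockPsi (K := LaurentSeries ℂ) (HahnSeries.C q₁) (HahnSeries.C q₂)
    (HahnSeries.C q₃) (P k) (HahnSeries.single (1 : ℤ) (u k))

/-- The eigenvalue of `ψ⁻(z)`, as a Laurent series in `z`. -/
def psiZero (q₁ q₂ q₃ : ℂ) (u : Fin n → ℂ) (P : Fin n → ℕ →₀ ℕ) : LaurentSeries ℂ :=
  ∏ k : Fin n, fockPsi (K := LaurentSeries ℂ) (HahnSeries.C q₁) (HahnSeries.C q₂)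
    (HahnSeries.C q₃) (P k) (HahnSeries.single (-1 : ℤ) (u k))

/-- The product over all rows, over the field of Laurent series. -/
def laurentProd (q₁ q₂ q₃ : ℂ) (u : Fin n → ℂ) (P : Fin n → ℕ →₀ ℕ) (L : ℕ)
    (ζ : LaurentSeries ℂ) : LaurentSeries ℂ :=
  selProd (K := LaurentSeries ℂ) (HahnSeries.C q₁) (HahnSeries.C q₂) (HahnSeries.C q₃)
    (fun l => HahnSeries.C (u l)) P (fun _ => True) L ζ

lemma C_hq (hq : q₁ * q₂ * q₃ = 1) :
    (HahnSeries.C q₁ * HahnSeries.C q₂ * HahnSeries.C q₃ : LaurentSeries ℂ) = 1 := by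
  rw [← map_mul, ← map_mul, hq, map_one]

lemma psiInf_eq (hq : q₁ * q₂ * q₃ = 1) {P : Fin n → ℕ →₀ ℕ} {L : ℕ}
    (hP : ∀ l j, L ≤ j → P l j = 0) : psiInf q₁ q₂ q₃ u P = laurentProd q₁ q₂ q₃ u P L zInf := by
  have h0 : zInf ≠ 0 := left_ne_zero_of_mul_eq_one zInf_mul_zZero
  rw [laurentProd, ← prod_fockPsi_eq (C_hq hq) h0 L hP]
  · refine Finset.prod_congr rfl fun k _ => ?_
    congr 1
    rw [eq_div_iff h0]
    simp [HahnSeries.C_apply]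
  · intro l i j
    rw [← map_zpow₀, ← map_zpow₀, ← map_mul, ← map_mul]
    exact (zInf_ne _).symm

lemma psiZero_eq (hq : q₁ * q₂ * q₃ = 1) {P : Fin n → ℕ →₀ ℕ} {L : ℕ}
    (hP : ∀ l j, L ≤ j → P l j = 0) :
    psiZero q₁ q₂ q₃ u P = laurentProd q₁ q₂ q₃ u P L zZero := by
  have h0 : zZero ≠ 0 := right_ne_zero_of_mul_eq_one zInf_mul_zZero
  rw [laurentProd, ← prod_fockPsi_eq (C_hq hq) h0 L hP]
  · refine Finset.prod_congr rfl fun k _ => ?_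
    congr 1
    rw [eq_div_iff h0]
    simp [HahnSeries.C_apply]
  · intro l i j
    rw [← map_zpow₀, ← map_zpow₀, ← map_mul, ← map_mul]
    exact (zZero_ne _).symm

lemma C_col (P : Fin n → ℕ →₀ ℕ) (β : Fin n × ℕ) :
    col (K := LaurentSeries ℂ) (HahnSeries.C q₁) (HahnSeries.C q₃) (fun l => HahnSeries.C (u l)) P β
      = HahnSeries.C (col q₁ q₃ u P β) := by
  simp only [col_def, map_mul, map_pow]

/-- The indices of the factors in the product over the rows up to number `L`. -/
def factorSet (n L : ℕ) : Finset ((Fin n × ℕ) ⊕ (Fin n × ℕ)) := (rows n (L + 1)).disjSum (rows n L)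

/-- The zeros of the product over all rows. -/
def zeroAt (q₁ q₂ q₃ : ℂ) (u : Fin n → ℂ) (P : Fin n → ℕ →₀ ℕ) :
    (Fin n × ℕ) ⊕ (Fin n × ℕ) → ℂ :=
  Sum.elim (fun β => q₂ * col q₁ q₃ u P β) fun β => q₃ * col q₁ q₃ u P β

/-- The poles of the product over all rows. -/
def poleAt (q₁ q₃ : ℂ) (u : Fin n → ℂ) (P : Fin n → ℕ →₀ ℕ) :
    (Fin n × ℕ) ⊕ (Fin n × ℕ) → ℂ :=
  Sum.elim (fun β => col q₁ q₃ u P β) fun β => q₁⁻¹ * col q₁ q₃ u P β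

lemma laurentProd_eq (P : Fin n → ℕ →₀ ℕ) (L : ℕ) (ζ : LaurentSeries ℂ) :
    laurentProd q₁ q₂ q₃ u P L ζ = ∏ i ∈ factorSet n L,
      ((ζ - HahnSeries.C (zeroAt q₁ q₂ q₃ u P i)) / (ζ - HahnSeries.C (poleAt q₁ q₃ u P i))) := by
  rw [laurentProd, selProd, factorSet, Finset.prod_disjSum]
  simp only [if_true, headFactor, tailFactor, C_col, zeroAt, poleAt, Sum.elim_inl, Sum.elim_inr,
    map_mul, map_inv₀]

variable [NeZero n] {a b : Fin n → ℕ}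

namespace Resonant

lemma psiInf_powerSeries (h : Resonant q₁ q₂ q₃ u a b) {P : Fin n → ℕ →₀ ℕ} (hP : IsT a b P) :
    ∃ F : PowerSeries ℂ, psiInf q₁ q₂ q₃ u P = HahnSeries.ofPowerSeries ℤ ℂ F ∧
      PowerSeries.constantCoeff F ≠ 0 := by
  rw [psiInf_eq h.hq (L := size P) (fun l j hj => hP.eq_zero l hj), laurentProd_eq]
  obtain ⟨F, h1, h2⟩ := exists_powerSeries_zInf (factorSet n (size P)) (zeroAt q₁ q₂ q₃ u P)
    (poleAt q₁ q₃ u P)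
  exact ⟨F, h1, by rw [h2]; exact one_ne_zero⟩

lemma psiZero_powerSeries (h : Resonant q₁ q₂ q₃ u a b) {P : Fin n → ℕ →₀ ℕ} (hP : IsT a b P) :
    ∃ F : PowerSeries ℂ, psiZero q₁ q₂ q₃ u P = HahnSeries.ofPowerSeries ℤ ℂ F ∧
      PowerSeries.constantCoeff F ≠ 0 := by
  rw [psiZero_eq h.hq (L := size P) (fun l j hj => hP.eq_zero l hj), laurentProd_eq]
  have := h.q₁_ne
  refine exists_powerSeries_zZero _ _ _ ?_ ?_ <;>
  · rintro (β | β) _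
    all_goals simp [zeroAt, poleAt, h.q₁_ne, h.q₂_ne, h.q₃_ne, h.col_ne P β]

/-- The series ζ is no constant, so all the genericity conditions of `selProd_add_bx` hold
automatically. -/
lemma laurentProd_add (h : Resonant q₁ q₂ q₃ u a b) (P : Fin n → ℕ →₀ ℕ) {α : Fin n × ℕ}
    {L : ℕ} (hL : α.2 < L) {ζ : LaurentSeries ℂ} (hζ : ∀ t : ℂ, ζ ≠ HahnSeries.C t) :
    laurentProd q₁ q₂ q₃ u (P + bx α) L ζ * gpol (HahnSeries.C q₁) (HahnSeries.C q₂)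
        (HahnSeries.C q₃) ζ (HahnSeries.C (col q₁ q₃ u P α)) =
      -(gpol (HahnSeries.C q₁) (HahnSeries.C q₂) (HahnSeries.C q₃)
        (HahnSeries.C (col q₁ q₃ u P α)) ζ * laurentProd q₁ q₂ q₃ u P L ζ) := by
  rw [← C_col]
  refine selProd_add_bx (C_hq h.hq) hL trivial ?_ ?_ ?_ ?_ <;> rw [C_col]
  · intro e
    apply hζ (q₁⁻¹ * col q₁ q₃ u P α)
    rw [map_mul, ← e, ← mul_assoc, ← map_mul, inv_mul_cancel₀ h.q₁_ne, map_one, one_mul]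
  all_goals rw [← map_mul]; exact hζ _

end Resonant

/-- Comparison of coefficients in `g(z, v) F(z) = -g(v, z) G(z)`. -/
lemma coeff_gpol (cf : ℤ → LaurentSeries ℂ →+ ℂ) (ζ : LaurentSeries ℂ)
    (hC : ∀ i c F, cf i (HahnSeries.C c * F) = c * cf i F) (hζ : ∀ i F, cf i (ζ * F) = cf (i + 1) F)
    {F G : LaurentSeries ℂ} {v : ℂ}
    (h : F * gpol (HahnSeries.C q₁) (HahnSeries.C q₂) (HahnSeries.C q₃) ζ (HahnSeries.C v) =
      -(gpol (HahnSeries.C q₁) (HahnSeries.C q₂) (HahnSeries.C q₃) (HahnSeries.C v) ζ * G))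
    (i : ℤ) :
    ∑ k : Fin 4, gCoeff q₁ q₂ q₃ k * v ^ (k : ℕ) * cf (i + 3 - (k : ℕ)) F =
      -∑ k : Fin 4, gCoeff q₁ q₂ q₃ k * v ^ (3 - (k : ℕ)) * cf (i + (k : ℕ)) G := by
  have e1 : F * gpol (HahnSeries.C q₁) (HahnSeries.C q₂) (HahnSeries.C q₃) ζ (HahnSeries.C v) =
      ζ * (ζ * (ζ * F)) + HahnSeries.C (-(q₁ + q₂ + q₃) * v) * (ζ * (ζ * F)) +
      HahnSeries.C ((q₁ * q₂ + q₁ * q₃ + q₂ * q₃) * v ^ 2) * (ζ * F) +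
      HahnSeries.C (-(q₁ * q₂ * q₃) * v ^ 3) * F := by
    simp only [gpol, map_mul, map_add, map_neg, map_pow]; ring
  have e2 : gpol (HahnSeries.C q₁) (HahnSeries.C q₂) (HahnSeries.C q₃) (HahnSeries.C v) ζ * G =
      HahnSeries.C (v ^ 3) * G + HahnSeries.C (-(q₁ + q₂ + q₃) * v ^ 2) * (ζ * G) +
      HahnSeries.C ((q₁ * q₂ + q₁ * q₃ + q₂ * q₃) * v) * (ζ * (ζ * G)) +
      HahnSeries.C (-(q₁ * q₂ * q₃) * 1) * (ζ * (ζ * (ζ * G))) := by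
    simp only [gpol, map_mul, map_add, map_neg, map_pow, map_one]; ring
  rw [e1, e2] at h
  have h := congrArg (cf i) h
  simp only [map_add, map_neg, hC, hζ] at h
  rw [show i + 1 + 1 + 1 = i + 3 by ring, show i + 1 + 1 = i + 2 by ring] at h
  simp only [Fin.sum_univ_four, gCoeff]
  have f1 : i + 3 - 1 = i + 2 := by ring
  have f2 : i + 3 - 2 = i + 1 := by ring
  have f3 : i + 3 - 3 = i := by ring
  simp [f1, f2, f3]
  linear_combination h

/-- The coefficient of `z^{-i}` in the eigenvalue of `ψ⁺(z)`. -/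
def psiP (q₁ q₂ q₃ : ℂ) (u : Fin n → ℂ) (P : Fin n → ℕ →₀ ℕ) (i : ℤ) : ℂ :=
  (psiInf q₁ q₂ q₃ u P).coeff i

/-- The coefficient of `z^{-i}` in the eigenvalue of `ψ⁻(z)`. -/
def psiM (q₁ q₂ q₃ : ℂ) (u : Fin n → ℂ) (P : Fin n → ℕ →₀ ℕ) (i : ℤ) : ℂ :=
  (psiZero q₁ q₂ q₃ u P).coeff (-i)

namespace Resonant

lemma psiP_of_neg (h : Resonant q₁ q₂ q₃ u a b) {P : Fin n → ℕ →₀ ℕ} (hP : IsT a b P) {i : ℤ}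
    (hi : i < 0) : psiP q₁ q₂ q₃ u P i = 0 := by
  obtain ⟨F, h1, -⟩ := h.psiInf_powerSeries hP
  rw [psiP, h1, PowerSeries.coeff_coe, if_pos hi]

lemma psiM_of_pos (h : Resonant q₁ q₂ q₃ u a b) {P : Fin n → ℕ →₀ ℕ} (hP : IsT a b P) {i : ℤ}
    (hi : 0 < i) : psiM q₁ q₂ q₃ u P i = 0 := by
  obtain ⟨F, h1, -⟩ := h.psiZero_powerSeries hP
  rw [psiM, h1, PowerSeries.coeff_coe, if_pos (by omega)]

lemma psiP_zero_ne (h : Resonant q₁ q₂ q₃ u a b) {P : Fin n → ℕ →₀ ℕ} (hP : IsT a b P) :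
    psiP q₁ q₂ q₃ u P 0 ≠ 0 := by
  obtain ⟨F, h1, h2⟩ := h.psiInf_powerSeries hP
  rw [psiP, h1, PowerSeries.coeff_coe]
  simpa using h2

lemma psiM_zero_ne (h : Resonant q₁ q₂ q₃ u a b) {P : Fin n → ℕ →₀ ℕ} (hP : IsT a b P) :
    psiM q₁ q₂ q₃ u P 0 ≠ 0 := by
  obtain ⟨F, h1, h2⟩ := h.psiZero_powerSeries hP
  rw [psiM, h1, PowerSeries.coeff_coe]
  simpa using h2

lemma psiP_add (h : Resonant q₁ q₂ q₃ u a b) {P : Fin n → ℕ →₀ ℕ} (hP : IsT a b P)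
    {α : Fin n × ℕ} (hα : IsT a b (P + bx α)) (i : ℤ) :
    ∑ k : Fin 4, gCoeff q₁ q₂ q₃ k * col q₁ q₃ u P α ^ (k : ℕ) *
        psiP q₁ q₂ q₃ u (P + bx α) (i + 3 - (k : ℕ)) =
      -∑ k : Fin 4, gCoeff q₁ q₂ q₃ k * col q₁ q₃ u P α ^ (3 - (k : ℕ)) *
        psiP q₁ q₂ q₃ u P (i + (k : ℕ)) := by
  refine coeff_gpol (F := psiInf q₁ q₂ q₃ u (P + bx α)) (G := psiInf q₁ q₂ q₃ u P)
    (fun i => HahnSeries.coeff.addMonoidHom i) zInf ?_ ?_ ?_ i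
  · intro i c F; simp
  · intro i F
    have := HahnSeries.coeff_single_mul_add (r := (1 : ℂ)) (x := F) (a := i + 1) (b := (-1 : ℤ))
    rw [add_neg_cancel_right, one_mul] at this
    exact this
  · have hL := hα.row_le
    rw [psiInf_eq h.hq (L := size P + 1) (fun l j hj => hα.eq_zero l (by rw [size_add_bx]; omega)),
      psiInf_eq h.hq (L := size P + 1) (fun l j hj => hP.eq_zero l (by omega))]
    exact h.laurentProd_add P (by omega) zInf_ne

lemma psiM_add (h : Resonant q₁ q₂ q₃ u a b) {P : Fin n → ℕ →₀ ℕ} (hP : IsT a b P)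
    {α : Fin n × ℕ} (hα : IsT a b (P + bx α)) (i : ℤ) :
    ∑ k : Fin 4, gCoeff q₁ q₂ q₃ k * col q₁ q₃ u P α ^ (k : ℕ) *
        psiM q₁ q₂ q₃ u (P + bx α) (i + 3 - (k : ℕ)) =
      -∑ k : Fin 4, gCoeff q₁ q₂ q₃ k * col q₁ q₃ u P α ^ (3 - (k : ℕ)) *
        psiM q₁ q₂ q₃ u P (i + (k : ℕ)) := by
  refine coeff_gpol (F := psiZero q₁ q₂ q₃ u (P + bx α)) (G := psiZero q₁ q₂ q₃ u P)
    (fun i => HahnSeries.coeff.addMonoidHom (-i)) zZero ?_ ?_ ?_ i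
  · intro i c F; simp
  · intro i F
    have := HahnSeries.coeff_single_mul_add (r := (1 : ℂ)) (x := F) (a := -(i + 1)) (b := (1 : ℤ))
    rw [show -(i + 1) + 1 = -i by ring, one_mul] at this
    exact this
  · have hL := hα.row_le
    rw [psiZero_eq h.hq (L := size P + 1) (fun l j hj => hα.eq_zero l (by rw [size_add_bx]; omega)),
      psiZero_eq h.hq (L := size P + 1) (fun l j hj => hP.eq_zero l (by omega))]
    exact h.laurentProd_add P (by omega) zZero_ne

open Classical in
/-- The factors which contribute a pole: those for the rows to which a box can be added or from
which a box can be removed. -/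
def _root_.QuantumCgl.poleSet (a b : Fin n → ℕ) (P : Fin n → ℕ →₀ ℕ) (L : ℕ) :
    Finset ((Fin n × ℕ) ⊕ (Fin n × ℕ)) :=
  ((rows n (L + 1)).filter fun α => IsT a b (P + bx α)).disjSum
    ((rows n L).filter fun γ => ∃ R, IsT a b R ∧ P = R + bx γ)

/-- At an addable row this is injectivity of colours together with `col_ne_inv`. For a removable row
it is compared with the tuple R before the box was added, where the pole is the colour of γ. -/
lemma poleAt_unique (h : Resonant q₁ q₂ q₃ u a b) {P : Fin n → ℕ →₀ ℕ} (hP : IsT a b P) {L : ℕ}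
    {k : (Fin n × ℕ) ⊕ (Fin n × ℕ)} (hk : k ∈ poleSet a b P L) (i : (Fin n × ℕ) ⊕ (Fin n × ℕ)) :
    poleAt q₁ q₃ u P i = poleAt q₁ q₃ u P k ↔ i = k := by
  refine ⟨fun e => ?_, fun e => by rw [e]⟩
  have q1 := h.q₁_ne
  rcases k with α | γ
  · have hα : IsT a b (P + bx α) := by
      simp only [poleSet, Finset.inl_mem_disjSum, Finset.mem_filter] at hk
      exact hk.2
    rcases i with β | β
    · exact congrArg _ (h.col_injective hP e)
    · exact absurd e.symm (h.col_ne_inv hP hα)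
  · obtain ⟨R, hR, hPR⟩ : ∃ R, IsT a b R ∧ P = R + bx γ := by
      simp only [poleSet, Finset.inr_mem_disjSum, Finset.mem_filter] at hk
      exact hk.2
    rcases i with β | β
    · exfalso
      have e : col q₁ q₃ u P β = q₁⁻¹ * col q₁ q₃ u P γ := e
      rw [hPR, col_add_self, inv_mul_cancel_left₀ q1] at e
      by_cases hβ : γ = β
      · subst hβ
        rw [col_add_self] at e
        exact h.q₁_col_ne hR (hPR ▸ hP) e.symm
      · rw [col_add_of_ne _ _ _ _ hβ] at e
        exact hβ (h.col_injective hR e).symm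
    · have e : q₁⁻¹ * col q₁ q₃ u P β = q₁⁻¹ * col q₁ q₃ u P γ := e
      exact congrArg _ (h.col_injective hP (mul_left_cancel₀ (inv_ne_zero q1) e))

/-- By injectivity each of the two families of denominators vanishes at w at most once. If both do,
`double_block` provides two zeros. If one does, its row either admits the corresponding move or has
an obstruction, which is a zero at w. -/
lemma card_poles_le (h : Resonant q₁ q₂ q₃ u a b) {P : Fin n → ℕ →₀ ℕ} (hP : IsT a b P) {L : ℕ}
    (hL : size P ≤ L) (w : ℂ) :
    ((factorSet n L).filter fun i => poleAt q₁ q₃ u P i = w).card ≤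
      ((factorSet n L).filter fun i => zeroAt q₁ q₂ q₃ u P i = w).card +
        ((poleSet a b P L).filter fun k => poleAt q₁ q₃ u P k = w).card := by
  classical
  have q1 := h.q₁_ne
  have mem_pole : ∀ i, i ∈ (factorSet n L).filter (fun i => poleAt q₁ q₃ u P i = w) ↔
      (∃ β, β.2 ≤ L ∧ col q₁ q₃ u P β = w ∧ i = Sum.inl β) ∨
      ∃ γ, γ.2 < L ∧ q₁⁻¹ * col q₁ q₃ u P γ = w ∧ i = Sum.inr γ := by
    rintro (i | i) <;> rw [Finset.mem_filter] <;>
      simp [factorSet, mem_rows, poleAt, -Prod.exists]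
  have hz2 : ∀ β, β.2 ≤ L → q₂ * col q₁ q₃ u P β = w →
      Sum.inl β ∈ (factorSet n L).filter fun i => zeroAt q₁ q₂ q₃ u P i = w := by
    intro β h1 h2
    rw [Finset.mem_filter]
    simpa [factorSet, mem_rows, zeroAt, Nat.lt_succ_iff] using ⟨h1, h2⟩
  have hz3 : ∀ β, β.2 < L → q₃ * col q₁ q₃ u P β = w →
      Sum.inr β ∈ (factorSet n L).filter fun i => zeroAt q₁ q₂ q₃ u P i = w := by
    intro β h1 h2
    rw [Finset.mem_filter]
    simpa [factorSet, mem_rows, zeroAt] using ⟨h1, h2⟩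
  by_cases c1 : ∃ β : Fin n × ℕ, β.2 ≤ L ∧ col q₁ q₃ u P β = w <;>
    by_cases c2 : ∃ γ : Fin n × ℕ, γ.2 < L ∧ q₁⁻¹ * col q₁ q₃ u P γ = w
  · obtain ⟨β, hβ, eβ⟩ := c1
    obtain ⟨γ, hγ, eγ⟩ := c2
    obtain ⟨δ, ε, -, -, -, -, -, r1, r2, e1, e2⟩ := h.double_block hP (α := γ) (γ := β)
      (by rw [eβ, ← eγ, mul_inv_cancel_left₀ q1])
    have le2 : ((factorSet n L).filter fun i => poleAt q₁ q₃ u P i = w).card ≤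
        ({Sum.inl β, Sum.inr γ} : Finset ((Fin n × ℕ) ⊕ (Fin n × ℕ))).card := by
      refine Finset.card_le_card fun i hi => ?_
      rcases (mem_pole i).1 hi with ⟨β', -, e, rfl⟩ | ⟨γ', -, e, rfl⟩
      · rw [h.col_injective hP (e.trans eβ.symm)]; simp
      · rw [h.col_injective hP (mul_left_cancel₀ (inv_ne_zero q1) (e.trans eγ.symm))]; simp
    have ge2 : ({Sum.inl ε, Sum.inr δ} : Finset ((Fin n × ℕ) ⊕ (Fin n × ℕ))).card ≤
        ((factorSet n L).filter fun i => zeroAt q₁ q₂ q₃ u P i = w).card := by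
      refine Finset.card_le_card fun i hi => ?_
      rcases Finset.mem_insert.1 hi with rfl | hi
      · exact hz2 ε (by omega) (e2.trans eβ)
      · rw [Finset.mem_singleton.1 hi]
        exact hz3 δ (by omega) (e1.trans eβ)
    rw [Finset.card_pair (by simp)] at le2 ge2
    omega
  · obtain ⟨β, hβ, eβ⟩ := c1
    have le1 : ((factorSet n L).filter fun i => poleAt q₁ q₃ u P i = w).card ≤
        ({Sum.inl β} : Finset ((Fin n × ℕ) ⊕ (Fin n × ℕ))).card := by
      refine Finset.card_le_card fun i hi => ?_
      rcases (mem_pole i).1 hi with ⟨β', -, e, rfl⟩ | ⟨γ', e', e, rfl⟩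
      · rw [h.col_injective hP (e.trans eβ.symm)]; simp
      · exact absurd ⟨γ', e', e⟩ c2
    rw [Finset.card_singleton] at le1
    by_cases hadd : IsT a b (P + bx β)
    · have : 0 < ((poleSet a b P L).filter fun k => poleAt q₁ q₃ u P k = w).card :=
        Finset.card_pos.2 ⟨Sum.inl β, by
          rw [Finset.mem_filter]
          simpa [poleSet, mem_rows, poleAt, Nat.lt_succ_iff] using ⟨⟨hβ, hadd⟩, eβ⟩⟩
      omega
    · have : 0 < ((factorSet n L).filter fun i => zeroAt q₁ q₂ q₃ u P i = w).card := by
        -- The position of the obstruction relative to β keeps the cancelling zero inside the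
        -- truncated product.
        obtain ⟨δ, ⟨e, r⟩ | ⟨e, r⟩⟩ := h.blocked hP hadd
        · exact Finset.card_pos.2 ⟨_, hz3 δ (by omega) (e.trans eβ)⟩
        · exact Finset.card_pos.2 ⟨_, hz2 δ (by omega) (e.trans eβ)⟩
      omega
  · obtain ⟨γ, hγ, eγ⟩ := c2
    have le1 : ((factorSet n L).filter fun i => poleAt q₁ q₃ u P i = w).card ≤
        ({Sum.inr γ} : Finset ((Fin n × ℕ) ⊕ (Fin n × ℕ))).card := by
      refine Finset.card_le_card fun i hi => ?_
      rcases (mem_pole i).1 hi with ⟨β', e', e, rfl⟩ | ⟨γ', -, e, rfl⟩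
      · exact absurd ⟨β', e', e⟩ c1
      · rw [h.col_injective hP (mul_left_cancel₀ (inv_ne_zero q1) (e.trans eγ.symm))]; simp
    rw [Finset.card_singleton] at le1
    by_cases hrem : ∃ R, IsT a b R ∧ P = R + bx γ
    · have : 0 < ((poleSet a b P L).filter fun k => poleAt q₁ q₃ u P k = w).card :=
        Finset.card_pos.2 ⟨Sum.inr γ, by
          rw [Finset.mem_filter]
          simpa only [poleSet, mem_rows, poleAt, Finset.mem_filter, Finset.inr_mem_disjSum,
            Sum.elim_inr] using ⟨⟨hγ, hrem⟩, eγ⟩⟩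
      omega
    · have : 0 < ((factorSet n L).filter fun i => zeroAt q₁ q₂ q₃ u P i = w).card := by
        obtain ⟨δ, ⟨e, r⟩ | ⟨e, r⟩⟩ := h.blocked_removal hP hrem
        · exact Finset.card_pos.2 ⟨_, hz2 δ (by omega) (e.trans eγ)⟩
        · refine Finset.card_pos.2 ⟨_, hz3 δ ?_ (e.trans eγ)⟩
          by_contra hlt
          exact r (hP.eq_zero _ (by omega))
      omega
  · have : (factorSet n L).filter (fun i => poleAt q₁ q₃ u P i = w) = ∅ := by
      rw [Finset.eq_empty_iff_forall_notMem]
      intro i hi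
      rcases (mem_pole i).1 hi with ⟨β', e', e, rfl⟩ | ⟨γ', e', e, rfl⟩
      · exact c1 ⟨β', e', e⟩
      · exact c2 ⟨γ', e', e⟩
    rw [this]
    simp

/-- The residue of the product over all rows at a pole, divided by the position of the pole. -/
def _root_.QuantumCgl.residue (q₁ q₂ q₃ : ℂ) (u : Fin n → ℂ) (P : Fin n → ℕ →₀ ℕ) (L : ℕ)
    (k : (Fin n × ℕ) ⊕ (Fin n × ℕ)) : ℂ :=
  (poleAt q₁ q₃ u P k - zeroAt q₁ q₂ q₃ u P k) * ∏ i ∈ (factorSet n L).erase k,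
    ((poleAt q₁ q₃ u P k - zeroAt q₁ q₂ q₃ u P i) / (poleAt q₁ q₃ u P k - poleAt q₁ q₃ u P i))

/-- The difference of the two expansions of the eigenvalue is a sum of delta functions. -/
lemma psiP_sub_psiM (h : Resonant q₁ q₂ q₃ u a b) {P : Fin n → ℕ →₀ ℕ} (hP : IsT a b P) {L : ℕ}
    (hL : size P ≤ L) (m : ℤ) :
    psiP q₁ q₂ q₃ u P m - psiM q₁ q₂ q₃ u P m =
      ∑ k ∈ poleSet a b P L, residue q₁ q₂ q₃ u P L k * poleAt q₁ q₃ u P k ^ (m - 1) := by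
  classical
  have hsub : poleSet a b P L ⊆ factorSet n L := by
    rintro (i | i) hi <;> simp only [poleSet, factorSet, Finset.inl_mem_disjSum,
      Finset.inr_mem_disjSum, Finset.mem_filter] at hi ⊢ <;> exact hi.1
  have pf := fun (ζ : LaurentSeries ℂ) hζ => partial_fractions (HahnSeries.C : ℂ →+* _) ζ hζ
    (factorSet n L) (zeroAt q₁ q₂ q₃ u P) (poleAt q₁ q₃ u P) (poleSet a b P L)
    (poleAt q₁ q₃ u P) (fun i _ k hk e => (h.poleAt_unique hP hk i).1 e)
    (by convert h.card_poles_le hP hL) id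
    (fun k hk => hsub hk) (fun k hk i _ => h.poleAt_unique hP hk i)
  have hb : ∀ l j, L ≤ j → P l j = 0 := fun l j hj => hP.eq_zero l (by omega)
  rw [psiP, psiM, psiInf_eq h.hq hb, psiZero_eq h.hq hb, laurentProd_eq, laurentProd_eq,
    pf _ zInf_ne, pf _ zZero_ne]
  simp only [div_eq_mul_inv]
  rw [HahnSeries.coeff_add, HahnSeries.coeff_add, HahnSeries.coeff_sum, HahnSeries.coeff_sum]
  -- The term 1 of the partial fractions expands identically at both points and drops out.
  have e1 : (1 : LaurentSeries ℂ).coeff m = (1 : LaurentSeries ℂ).coeff (-m) := by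
    simp [HahnSeries.coeff_one]
  rw [e1, add_sub_add_left_eq_sub, ← Finset.sum_sub_distrib]
  refine Finset.sum_congr rfl fun k _ => ?_
  have hk0 : poleAt q₁ q₃ u P k ≠ 0 := by
    rcases k with β | β <;> simp [poleAt, h.q₁_ne, h.col_ne P β]
  rw [HahnSeries.C_mul_eq_smul, HahnSeries.C_mul_eq_smul, HahnSeries.coeff_smul,
    HahnSeries.coeff_smul, smul_eq_mul, smul_eq_mul, ← mul_sub, coeff_inv_sub hk0, residue]
  simp only [id, div_eq_mul_inv]

end Resonant

end Psi

/-! ### The residues and the products of coefficients -/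

section Residues

variable {n : ℕ} [NeZero n] {q₁ q₂ q₃ : ℂ} {u : Fin n → ℂ} {a b : Fin n → ℕ}

/-- The coefficients of `e(z)`. -/
def eCoef (q₁ q₂ q₃ : ℂ) (u : Fin n → ℂ) (a b : Fin n → ℕ) :
    (Fin n → ℕ →₀ ℕ) → Fin n × ℕ → ℂ :=
  coefBy q₁ q₂ q₃ u a b (1 - q₁)⁻¹ Prec

/-- The coefficients of `f(z)`. -/
def fCoef (q₁ q₂ q₃ : ℂ) (u : Fin n → ℂ) (a b : Fin n → ℕ) :
    (Fin n → ℕ →₀ ℕ) → Fin n × ℕ → ℂ :=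
  coefBy q₁ q₂ q₃ u a b (q₁ / (1 - q₁)) fun α β => Prec β α

open Classical in
/-- For a function `c` of a tuple and a row to which a box is added: the corresponding function of a
tuple and a row from which a box is removed. -/
def down {n : ℕ} (c : (Fin n → ℕ →₀ ℕ) → Fin n × ℕ → ℂ) (P : Fin n → ℕ →₀ ℕ)
    (α : Fin n × ℕ) : ℂ :=
  if P = P - bx α + bx α then c (P - bx α) α else 0

lemma down_add_bx {n : ℕ} (c : (Fin n → ℕ →₀ ℕ) → Fin n × ℕ → ℂ) (P : Fin n → ℕ →₀ ℕ)
    (α : Fin n × ℕ) : down c (P + bx α) α = c P α := by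
  rw [down, add_tsub_cancel_right, if_pos rfl]

lemma down_of_not {n : ℕ} {c : (Fin n → ℕ →₀ ℕ) → Fin n × ℕ → ℂ} {P : Fin n → ℕ →₀ ℕ}
    {α : Fin n × ℕ} (h : ¬ ∃ R, P = R + bx α) : down c P α = 0 := by
  rw [down, if_neg]
  exact fun e => h ⟨_, e⟩

lemma prod_eq_mul_prod_ite {ι K : Type} [DecidableEq ι] [Field K] {S : Finset ι} {i : ι} (hi : i ∈ S)
    (f : ι → K) : ∏ j ∈ S, f j = f i * ∏ j ∈ S, if j ≠ i then f j else 1 := by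
  rw [← Finset.mul_prod_erase S f hi, ← Finset.mul_prod_erase S _ hi, if_neg (by simp), one_mul]
  congr 1
  exact Finset.prod_congr rfl fun j hj => (if_pos (Finset.ne_of_mem_erase hj)).symm

lemma prod_erase_eq_ite {ι K : Type} [DecidableEq ι] [Field K] (S : Finset ι) (i : ι)
    (f : ι → K) : ∏ j ∈ S.erase i, f j = ∏ j ∈ S, if j ≠ i then f j else 1 := by
  rw [← Finset.prod_erase S (a := i) (by simp)]
  exact Finset.prod_congr rfl fun j hj => (if_pos (Finset.ne_of_mem_erase hj)).symm

/-- The pole comes from the head factor of row α: its numerator and the tail factor of α stay in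
front, and the other rows form the product shared by the coefficients of e and f. -/
lemma residue_inl {n : ℕ} {u : Fin n → ℂ} (P : Fin n → ℕ →₀ ℕ) {L : ℕ} {α : Fin n × ℕ} (hL : α.2 < L) :
    residue q₁ q₂ q₃ u P L (Sum.inl α) =
      (col q₁ q₃ u P α - q₂ * col q₁ q₃ u P α) * tailFactor q₁ q₃ (col q₁ q₃ u P α)
        (col q₁ q₃ u P α) * selProd q₁ q₂ q₃ u P (fun β => β ≠ α) L (col q₁ q₃ u P α) := by
  rw [residue, prod_erase_eq_ite, factorSet, Finset.prod_disjSum]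
  simp only [poleAt, zeroAt, Sum.elim_inl, Sum.elim_inr, ne_eq, Sum.inl.injEq, reduceCtorEq,
    not_false_eq_true, if_true]
  rw [prod_eq_mul_prod_ite (mem_rows.2 hL), selProd]
  simp only [headFactor, tailFactor, ne_eq]
  ring

lemma residue_inr {n : ℕ} {u : Fin n → ℂ} (P : Fin n → ℕ →₀ ℕ) {L : ℕ} {γ : Fin n × ℕ} (hL : γ.2 < L) :
    residue q₁ q₂ q₃ u P L (Sum.inr γ) =
      (q₁⁻¹ * col q₁ q₃ u P γ - q₃ * col q₁ q₃ u P γ) * headFactor q₂ (col q₁ q₃ u P γ)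
        (q₁⁻¹ * col q₁ q₃ u P γ) *
        selProd q₁ q₂ q₃ u P (fun β => β ≠ γ) L (q₁⁻¹ * col q₁ q₃ u P γ) := by
  rw [residue, prod_erase_eq_ite, factorSet, Finset.prod_disjSum]
  simp only [poleAt, zeroAt, Sum.elim_inl, Sum.elim_inr, ne_eq, Sum.inr.injEq, reduceCtorEq,
    not_false_eq_true, if_true]
  rw [prod_eq_mul_prod_ite (mem_rows.2 (show γ.2 < L + 1 by omega)), selProd]
  simp only [headFactor, tailFactor, ne_eq]
  ring

namespace Resonant

lemma one_sub_q₁_ne (h : Resonant q₁ q₂ q₃ u a b) : 1 - q₁ ≠ 0 := fun e => by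
  have := h.exponents (x := 1) (y := 0) (by rw [zpow_one, zpow_zero]; linear_combination -e)
  omega

lemma one_sub_q₃_ne (h : Resonant q₁ q₂ q₃ u a b) : 1 - q₃ ≠ 0 := fun e => by
  have := h.exponents (x := 0) (y := 1) (by rw [zpow_one, zpow_zero]; linear_combination -e)
  omega

lemma one_sub_q₂_ne (h : Resonant q₁ q₂ q₃ u a b) : 1 - q₂ ≠ 0 := fun e => by
  have := h.exponents (x := 1) (y := 1) (by
    rw [zpow_one, zpow_one]; linear_combination h.hq + q₁ * q₃ * e)
  omega

lemma g_one_ne (h : Resonant q₁ q₂ q₃ u a b) : (1 - q₁) * (1 - q₂) * (1 - q₃) ≠ 0 :=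
  mul_ne_zero (mul_ne_zero h.one_sub_q₁_ne h.one_sub_q₂_ne) h.one_sub_q₃_ne

lemma eCoef_mul_fCoef (h : Resonant q₁ q₂ q₃ u a b) {P : Fin n → ℕ →₀ ℕ} {α : Fin n × ℕ}
    (hP : IsT a b P) (hα : IsT a b (P + bx α)) {L : ℕ} (hL : size P + 1 ≤ L) :
    eCoef q₁ q₂ q₃ u a b P α * fCoef q₁ q₂ q₃ u a b P α =
      (1 - q₁)⁻¹ * (q₁ / (1 - q₁)) *
        selProd q₁ q₂ q₃ u P (fun β => β ≠ α) L (col q₁ q₃ u P α) := by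
  have := h.coefBy_mul_coefBy (c := (1 - q₁)⁻¹) (d := q₁ / (1 - q₁)) prec_rowOrder
    prec_rowOrder_flip hP hα hL
  rw [eCoef, fCoef, this]

/-- The difference of the two expansions of the eigenvalue in terms of the coefficients of `e(z)`
and `f(z)`. -/
lemma psiP_sub_psiM_eq (h : Resonant q₁ q₂ q₃ u a b) {P : Fin n → ℕ →₀ ℕ} (hP : IsT a b P) {L : ℕ}
    (hL : size P + 1 ≤ L) (m : ℤ) :
    psiP q₁ q₂ q₃ u P m - psiM q₁ q₂ q₃ u P m = (1 - q₁) * (1 - q₂) * (1 - q₃) *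
      (∑ γ ∈ rows n (L + 1), down (fun R α => eCoef q₁ q₂ q₃ u a b R α * fCoef q₁ q₂ q₃ u a b R α *
          col q₁ q₃ u R α ^ m) P γ -
        ∑ α ∈ rows n (L + 1), eCoef q₁ q₂ q₃ u a b P α * fCoef q₁ q₂ q₃ u a b P α *
          col q₁ q₃ u P α ^ m) := by
  classical
  have q1 := h.q₁_ne
  have q1' := h.one_sub_q₁_ne
  have q1'' : q₁ - 1 ≠ 0 := by rw [← neg_ne_zero, neg_sub]; exact q1'
  rw [h.psiP_sub_psiM hP (L := L) (by omega), poleSet, Finset.sum_disjSum, add_comm, mul_sub]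
  have split : ∀ {x y z w : ℂ}, x = z → y = -w → x + y = z - w := fun h₁ h₂ => by
    rw [h₁, h₂, sub_eq_add_neg]
  -- Removable boxes give the terms of ef, addable boxes those of fe with the opposite sign. In both
  -- cases q₁q₂q₃ = 1 turns the prefactor of the residue into ±q₁(1-q₂)(1-q₃)/(1-q₁).
  refine split ?_ ?_
  · rw [Finset.mul_sum, Finset.sum_filter]
    -- Row L is empty and loses no box, so its inclusion costs nothing and gives both sums one
    -- range.
    have hsub : rows n L ⊆ rows n (L + 1) := fun β hβ =>
      mem_rows.2 ((mem_rows.1 hβ).trans (Nat.lt_succ_self L))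
    refine Eq.trans ?_ (Finset.sum_subset hsub ?_)
    · refine Finset.sum_congr rfl fun γ hγ => ?_
      split_ifs with hR
      · obtain ⟨R, hR, rfl⟩ := hR
        have hsz : size R + 2 ≤ L := by rw [size_add_bx] at hL; omega
        rw [down_add_bx, residue_inr _ (mem_rows.1 hγ), h.eCoef_mul_fCoef hR hP (L := L) (by omega),
          poleAt, Sum.elim_inr, col_add_self, inv_mul_cancel_left₀ q1,
          selProd_congr (S := fun β => β ≠ γ) (S' := fun β => β ≠ γ) (P := R + bx γ) (P' := R)
            (fun _ => Iff.rfl) (fun β hβ => add_bx_of_ne R (Ne.symm hβ)), headFactor,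
          zpow_sub_one₀ (h.col_ne R γ)]
        have ht := h.col_ne R γ
        generalize col q₁ q₃ u R γ = t at *
        generalize selProd q₁ q₂ q₃ u R (fun β => β ≠ γ) L t = Y
        have e : t - q₁ * t = t * (1 - q₁) := by ring
        rw [e]
        field_simp
        linear_combination (-Y * (1 - q₁)) * h.hq
      · symm
        rw [mul_eq_zero]
        right
        rw [down]
        split_ifs with e
        · rw [eCoef, coefBy_of_not fun hh => hR ⟨_, hh.1, e⟩]; simp
        · rfl
    · intro γ _ hγ
      rw [mem_rows, not_lt] at hγ
      rw [down_of_not, mul_zero]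
      rintro ⟨R, e⟩
      have := hP.eq_zero γ.1 (j := γ.2) (by omega)
      rw [e, add_bx_self] at this
      omega
  · rw [← mul_neg, ← Finset.sum_neg_distrib, Finset.mul_sum, Finset.sum_filter]
    refine Finset.sum_congr rfl fun α _ => ?_
    split_ifs with hα
    · have hr := hα.row_le
      rw [residue_inl _ (show α.2 < L by omega), h.eCoef_mul_fCoef hP hα hL, poleAt, Sum.elim_inl,
        tailFactor, zpow_sub_one₀ (h.col_ne P α)]
      have ht := h.col_ne P α
      generalize col q₁ q₃ u P α = t at *
      generalize selProd q₁ q₂ q₃ u P (fun β => β ≠ α) L t = Y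
      have e : t - q₁⁻¹ * t = -(t * q₁⁻¹ * (1 - q₁)) := by field_simp; ring
      rw [e]
      field_simp
    · rw [eCoef, coefBy_of_not fun hh => hα hh.2]; simp

end Resonant

end Residues

/-! ### The cubic relation -/

section Cubic

/-- The weight of a path of three boxes in `[e_0, [e_1, e_{-1}]]`. -/
def cubicWeight (x y z : ℂ) : ℂ := x⁻¹ * y - x * y⁻¹ - y⁻¹ * z + y * z⁻¹

variable {q₁ q₂ q₃ : ℂ}

/-- Here w is `cubicWeight` with the denominator xyz cleared, and g has leading and last
coefficients 1 and -1. The vanishing of this signed sum over the six orders is the polynomial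
content of the cubic relation and needs no condition on s and t. -/
lemma cubic_identity (s t x y z : ℂ) :
    let g := fun z w : ℂ => z ^ 3 - s * z ^ 2 * w + t * z * w ^ 2 - w ^ 3
    let w := fun x y z : ℂ => y * y * z - x * x * z - x * z * z + x * y * y
    g x y * g x z * g y z * w x y z - g y x * g x z * g y z * w y x z
      - g x y * g x z * g z y * w x z y + g x y * g z x * g z y * w z x y
      + g y x * g z x * g y z * w y z x - g y x * g z x * g z y * w z y x = 0 := by
  intro g w
  simp only [g, w]
  ring

lemma gpol_eq (hq : q₁ * q₂ * q₃ = 1) (z w : ℂ) : gpol q₁ q₂ q₃ z w =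
    z ^ 3 - (q₁ + q₂ + q₃) * z ^ 2 * w + (q₁ * q₂ + q₁ * q₃ + q₂ * q₃) * z * w ^ 2 - w ^ 3 := by
  rw [gpol]
  linear_combination -w ^ 3 * hq

lemma cubicWeight_eq {x y z : ℂ} (hx : x ≠ 0) (hy : y ≠ 0) (hz : z ≠ 0) :
    cubicWeight x y z = (y * y * z - x * x * z - x * z * z + x * y * y) / (x * y * z) := by
  rw [cubicWeight]
  field_simp

/-- Starting from one order with non-zero g's, the quadratic relations express the five other
coefficients through p; after clearing denominators `cubic_identity` remains. -/
lemma cubic_of_ne (hq : q₁ * q₂ * q₃ = 1) {x y z : ℂ} (hx : x ≠ 0) (hy : y ≠ 0) (hz : z ≠ 0)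
    {p a b c d e : ℂ}
    (ha : p * gpol q₁ q₂ q₃ y x = -(gpol q₁ q₂ q₃ x y * a))
    (hb : p * gpol q₁ q₂ q₃ z y = -(gpol q₁ q₂ q₃ y z * b))
    (hc : b * gpol q₁ q₂ q₃ z x = -(gpol q₁ q₂ q₃ x z * c))
    (hd : a * gpol q₁ q₂ q₃ z x = -(gpol q₁ q₂ q₃ x z * d))
    (he : c * gpol q₁ q₂ q₃ y x = -(gpol q₁ q₂ q₃ x y * e))
    (hn : gpol q₁ q₂ q₃ x y ≠ 0 ∧ gpol q₁ q₂ q₃ x z ≠ 0 ∧ gpol q₁ q₂ q₃ y z ≠ 0) :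
    p * cubicWeight x y z + a * cubicWeight y x z + b * cubicWeight x z y + c * cubicWeight z x y +
      d * cubicWeight y z x + e * cubicWeight z y x = 0 := by
  obtain ⟨h1, h2, h3⟩ := hn
  have ident := cubic_identity (q₁ + q₂ + q₃) (q₁ * q₂ + q₁ * q₃ + q₂ * q₃) x y z
  simp only [← gpol_eq hq] at ident
  have ea : a = -(p * gpol q₁ q₂ q₃ y x) / gpol q₁ q₂ q₃ x y := by
    rw [eq_div_iff h1]; linear_combination ha
  have eb : b = -(p * gpol q₁ q₂ q₃ z y) / gpol q₁ q₂ q₃ y z := by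
    rw [eq_div_iff h3]; linear_combination hb
  have ec : c = -(b * gpol q₁ q₂ q₃ z x) / gpol q₁ q₂ q₃ x z := by
    rw [eq_div_iff h2]; linear_combination hc
  have ed : d = -(a * gpol q₁ q₂ q₃ z x) / gpol q₁ q₂ q₃ x z := by
    rw [eq_div_iff h2]; linear_combination hd
  have ee : e = -(c * gpol q₁ q₂ q₃ y x) / gpol q₁ q₂ q₃ x y := by
    rw [eq_div_iff h1]; linear_combination he
  rw [ee, ed, ec, eb, ea, cubicWeight_eq hx hy hz, cubicWeight_eq hy hx hz,
    cubicWeight_eq hx hz hy, cubicWeight_eq hz hx hy, cubicWeight_eq hy hz hx,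
    cubicWeight_eq hz hy hx]
  generalize gpol q₁ q₂ q₃ x y = g1 at *
  generalize gpol q₁ q₂ q₃ x z = g2 at *
  generalize gpol q₁ q₂ q₃ y z = g3 at *
  generalize gpol q₁ q₂ q₃ y x = g4 at *
  generalize gpol q₁ q₂ q₃ z x = g5 at *
  generalize gpol q₁ q₂ q₃ z y = g6 at *
  field_simp
  linear_combination p * ident

/-- The cubic relation for six numbers, one for each order of three boxes of colours `x`, `y`, `z`,
which satisfy the quadratic relations. -/
lemma cubic_hexagon (hq : q₁ * q₂ * q₃ = 1) {x y z : ℂ} (hx : x ≠ 0) (hy : y ≠ 0) (hz : z ≠ 0)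
    {p₁ p₂ p₃ p₄ p₅ p₆ : ℂ}
    (r₁ : p₁ * gpol q₁ q₂ q₃ y x = -(gpol q₁ q₂ q₃ x y * p₂))
    (r₂ : p₁ * gpol q₁ q₂ q₃ z y = -(gpol q₁ q₂ q₃ y z * p₃))
    (r₃ : p₃ * gpol q₁ q₂ q₃ z x = -(gpol q₁ q₂ q₃ x z * p₄))
    (r₄ : p₂ * gpol q₁ q₂ q₃ z x = -(gpol q₁ q₂ q₃ x z * p₅))
    (r₅ : p₄ * gpol q₁ q₂ q₃ y x = -(gpol q₁ q₂ q₃ x y * p₆))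
    (r₆ : p₅ * gpol q₁ q₂ q₃ z y = -(gpol q₁ q₂ q₃ y z * p₆))
    (n₁ : p₁ ≠ 0 → gpol q₁ q₂ q₃ x y ≠ 0 ∧ gpol q₁ q₂ q₃ x z ≠ 0 ∧ gpol q₁ q₂ q₃ y z ≠ 0)
    (n₂ : p₂ ≠ 0 → gpol q₁ q₂ q₃ y x ≠ 0 ∧ gpol q₁ q₂ q₃ y z ≠ 0 ∧ gpol q₁ q₂ q₃ x z ≠ 0)
    (n₃ : p₃ ≠ 0 → gpol q₁ q₂ q₃ x z ≠ 0 ∧ gpol q₁ q₂ q₃ x y ≠ 0 ∧ gpol q₁ q₂ q₃ z y ≠ 0)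
    (n₄ : p₄ ≠ 0 → gpol q₁ q₂ q₃ z x ≠ 0 ∧ gpol q₁ q₂ q₃ z y ≠ 0 ∧ gpol q₁ q₂ q₃ x y ≠ 0)
    (n₅ : p₅ ≠ 0 → gpol q₁ q₂ q₃ y z ≠ 0 ∧ gpol q₁ q₂ q₃ y x ≠ 0 ∧ gpol q₁ q₂ q₃ z x ≠ 0)
    (n₆ : p₆ ≠ 0 → gpol q₁ q₂ q₃ z y ≠ 0 ∧ gpol q₁ q₂ q₃ z x ≠ 0 ∧ gpol q₁ q₂ q₃ y x ≠ 0) :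
    p₁ * cubicWeight x y z + p₂ * cubicWeight y x z + p₃ * cubicWeight x z y +
      p₄ * cubicWeight z x y + p₅ * cubicWeight y z x + p₆ * cubicWeight z y x = 0 := by
  -- Any order with a non-zero coefficient can serve as the starting point; this reorients the edges
  -- of the hexagon accordingly.
  have flip : ∀ {p p' g g' : ℂ}, p * g = -(g' * p') → p' * g' = -(g * p) := fun h => by
    linear_combination h
  by_cases h₁ : p₁ = 0
  swap
  · exact cubic_of_ne hq hx hy hz r₁ r₂ r₃ r₄ r₅ (n₁ h₁)
  by_cases h₂ : p₂ = 0
  swap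
  · linear_combination cubic_of_ne hq hy hx hz (flip r₁) r₄ r₆ r₂ (flip r₅) (n₂ h₂)
  by_cases h₃ : p₃ = 0
  swap
  · linear_combination cubic_of_ne hq hx hz hy r₃ (flip r₂) r₁ r₅ r₄ (n₃ h₃)
  by_cases h₄ : p₄ = 0
  swap
  · linear_combination cubic_of_ne hq hz hx hy (flip r₃) r₅ (flip r₆) (flip r₂) (flip r₄) (n₄ h₄)
  by_cases h₅ : p₅ = 0
  swap
  · linear_combination cubic_of_ne hq hy hz hx r₆ (flip r₄) (flip r₁) (flip r₅) r₂ (n₅ h₅)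
  by_cases h₆ : p₆ = 0
  swap
  · linear_combination cubic_of_ne hq hz hy hx (flip r₆) (flip r₅) (flip r₃) (flip r₄) (flip r₂)
      (n₆ h₆)
  simp [h₁, h₂, h₃, h₄, h₅, h₆]

end Cubic

/-! ### The cubic relation along paths of three boxes. -/

section CubicCoefficients

variable {n : ℕ} [NeZero n] {q₁ q₂ q₃ : ℂ} {u : Fin n → ℂ} {a b : Fin n → ℕ}

/-- The product of the coefficients of `c` along the path which adds the boxes `α`, `β`, `γ`. -/
def pathCoef (c : (Fin n → ℕ →₀ ℕ) → Fin n × ℕ → ℂ) (P : Fin n → ℕ →₀ ℕ) (α β γ : Fin n × ℕ) : ℂ :=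
  c P α * c (P + bx α) β * c (P + bx α + bx β) γ

/-- The contribution of a path to `[e_0, [e_1, e_{-1}]]`. -/
def pathCubic (q₁ q₃ : ℂ) (u : Fin n → ℂ) (c : (Fin n → ℕ →₀ ℕ) → Fin n × ℕ → ℂ)
    (P : Fin n → ℕ →₀ ℕ) (α β γ : Fin n × ℕ) : ℂ :=
  pathCoef c P α β γ * cubicWeight (col q₁ q₃ u P α) (col q₁ q₃ u (P + bx α) β)
    (col q₁ q₃ u (P + bx α + bx β) γ)

lemma gpol_ne_zero_iff {x y : ℂ} :
    gpol q₁ q₂ q₃ x y ≠ 0 ↔ x ≠ q₁ * y ∧ x ≠ q₂ * y ∧ x ≠ q₃ * y := by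
  simp [gpol, sub_eq_zero, not_or, and_assoc]

namespace Resonant

/-- A non-zero coefficient means that all tuples on the path lie in the index set, where `path_two`
and `path_three` exclude the zeros of g. -/
lemma gpol_ne_zero_of_pathCoef (h : Resonant q₁ q₂ q₃ u a b) {c : ℂ}
    {R : Fin n × ℕ → Fin n × ℕ → Prop} {P : Fin n → ℕ →₀ ℕ} {α β γ : Fin n × ℕ}
    (hp : pathCoef (coefBy q₁ q₂ q₃ u a b c R) P α β γ ≠ 0) {x y z : ℂ}
    (hx : col q₁ q₃ u P α = x) (hy : col q₁ q₃ u (P + bx α) β = y)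
    (hz : col q₁ q₃ u (P + bx α + bx β) γ = z) :
    gpol q₁ q₂ q₃ x y ≠ 0 ∧ gpol q₁ q₂ q₃ x z ≠ 0 ∧ gpol q₁ q₂ q₃ y z ≠ 0 := by
  obtain ⟨⟨hc1, hc2⟩, hc3⟩ : (_ ∧ _) ∧ _ := by simpa [pathCoef, not_or] using hp
  obtain ⟨hP, hα⟩ := isT_of_coefBy hc1
  have hβ := (isT_of_coefBy hc2).2
  have hγ := (isT_of_coefBy hc3).2
  subst hx hy hz
  simp only [gpol_ne_zero_iff]
  exact ⟨⟨h.path_two hP hα hβ 1, h.path_two hP hα hβ 2, h.path_two hP hα hβ 3⟩,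
    ⟨h.path_three hP hα hβ hγ 1, h.path_three hP hα hβ hγ 2, h.path_three hP hα hβ hγ 3⟩,
    ⟨h.path_two hα hβ hγ 1, h.path_two hα hβ hγ 2, h.path_two hα hβ hγ 3⟩⟩

lemma pathCoef_swap_left (h : Resonant q₁ q₂ q₃ u a b) {c : ℂ}
    {R : Fin n × ℕ → Fin n × ℕ → Prop} (hR : RowOrder R) (P : Fin n → ℕ →₀ ℕ)
    {α β : Fin n × ℕ} (γ : Fin n × ℕ) (hne : α ≠ β) {x y : ℂ} (hx : col q₁ q₃ u P α = x)
    (hy : col q₁ q₃ u P β = y) :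
    pathCoef (coefBy q₁ q₂ q₃ u a b c R) P α β γ * gpol q₁ q₂ q₃ y x =
      -(gpol q₁ q₂ q₃ x y * pathCoef (coefBy q₁ q₂ q₃ u a b c R) P β α γ) := by
  subst hx hy
  rw [pathCoef, pathCoef, add_right_comm P (bx β) (bx α)]
  linear_combination coefBy q₁ q₂ q₃ u a b c R (P + bx α + bx β) γ * h.coefBy_quadratic hR P hne

lemma pathCoef_swap_right (h : Resonant q₁ q₂ q₃ u a b) {c : ℂ}
    {R : Fin n × ℕ → Fin n × ℕ → Prop} (hR : RowOrder R) (P : Fin n → ℕ →₀ ℕ)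
    (α : Fin n × ℕ) {β γ : Fin n × ℕ} (hne : β ≠ γ) {y z : ℂ}
    (hy : col q₁ q₃ u (P + bx α) β = y) (hz : col q₁ q₃ u (P + bx α) γ = z) :
    pathCoef (coefBy q₁ q₂ q₃ u a b c R) P α β γ * gpol q₁ q₂ q₃ z y =
      -(gpol q₁ q₂ q₃ y z * pathCoef (coefBy q₁ q₂ q₃ u a b c R) P α γ β) := by
  subst hy hz
  rw [pathCoef, pathCoef]
  linear_combination coefBy q₁ q₂ q₃ u a b c R P α * h.coefBy_quadratic hR (P + bx α) hne

lemma pathCubic_distinct (h : Resonant q₁ q₂ q₃ u a b) {c : ℂ}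
    {R : Fin n × ℕ → Fin n × ℕ → Prop} (hR : RowOrder R) (P : Fin n → ℕ →₀ ℕ)
    {α β γ : Fin n × ℕ} (hαβ : α ≠ β) (hαγ : α ≠ γ) (hβγ : β ≠ γ) :
    pathCubic q₁ q₃ u (coefBy q₁ q₂ q₃ u a b c R) P α β γ +
      pathCubic q₁ q₃ u (coefBy q₁ q₂ q₃ u a b c R) P β α γ +
      pathCubic q₁ q₃ u (coefBy q₁ q₂ q₃ u a b c R) P α γ β +
      pathCubic q₁ q₃ u (coefBy q₁ q₂ q₃ u a b c R) P γ α β +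
      pathCubic q₁ q₃ u (coefBy q₁ q₂ q₃ u a b c R) P β γ α +
      pathCubic q₁ q₃ u (coefBy q₁ q₂ q₃ u a b c R) P γ β α = 0 := by
  have one : ∀ {α β}, α ≠ β → col q₁ q₃ u (P + bx α) β = col q₁ q₃ u P β :=
    fun h => col_add_of_ne _ _ _ _ h
  have two : ∀ {α β γ}, α ≠ γ → β ≠ γ → col q₁ q₃ u (P + bx α + bx β) γ = col q₁ q₃ u P γ :=
    fun h h' => by rw [col_add_of_ne _ _ _ _ h', col_add_of_ne _ _ _ _ h]
  simp only [pathCubic, one hαβ, one hαβ.symm, one hαγ, one hαγ.symm, one hβγ, one hβγ.symm,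
    two hαγ hβγ, two hβγ hαγ, two hαβ hβγ.symm, two hβγ.symm hαβ, two hαβ.symm hαγ.symm,
    two hαγ.symm hαβ.symm]
  exact cubic_hexagon h.hq (h.col_ne P α) (h.col_ne P β) (h.col_ne P γ)
    (h.pathCoef_swap_left hR P γ hαβ rfl rfl)
    (h.pathCoef_swap_right hR P α hβγ (one hαβ) (one hαγ))
    (h.pathCoef_swap_left hR P β hαγ rfl rfl)
    (h.pathCoef_swap_right hR P β hαγ (one hαβ.symm) (one hβγ))
    (h.pathCoef_swap_right hR P γ hαβ (one hαγ.symm) (one hβγ.symm))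
    (h.pathCoef_swap_left hR P α hβγ rfl rfl)
    (fun hp => h.gpol_ne_zero_of_pathCoef hp rfl (one hαβ) (two hαγ hβγ))
    (fun hp => h.gpol_ne_zero_of_pathCoef hp rfl (one hαβ.symm) (two hβγ hαγ))
    (fun hp => h.gpol_ne_zero_of_pathCoef hp rfl (one hαγ) (two hαβ hβγ.symm))
    (fun hp => h.gpol_ne_zero_of_pathCoef hp rfl (one hαγ.symm) (two hβγ.symm hαβ))
    (fun hp => h.gpol_ne_zero_of_pathCoef hp rfl (one hβγ) (two hαβ.symm hαγ.symm))
    (fun hp => h.gpol_ne_zero_of_pathCoef hp rfl (one hβγ.symm) (two hαγ.symm hαβ.symm))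

/-- A degenerate hexagon: the two boxes in α have colours x and q₁x, and the three orders with q₁x
before x are given coefficient 0. This is consistent with the quadratic relations because g(q₁x, x)
= 0. -/
lemma pathCubic_repeated (h : Resonant q₁ q₂ q₃ u a b) {c : ℂ}
    {R : Fin n × ℕ → Fin n × ℕ → Prop} (hR : RowOrder R) (P : Fin n → ℕ →₀ ℕ)
    {α γ : Fin n × ℕ} (hne : α ≠ γ) :
    pathCubic q₁ q₃ u (coefBy q₁ q₂ q₃ u a b c R) P α α γ +
      pathCubic q₁ q₃ u (coefBy q₁ q₂ q₃ u a b c R) P α γ α +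
      pathCubic q₁ q₃ u (coefBy q₁ q₂ q₃ u a b c R) P γ α α = 0 := by
  have s1 : col q₁ q₃ u (P + bx α) α = q₁ * col q₁ q₃ u P α := col_add_self _ _ _ _ _
  have s2 : col q₁ q₃ u (P + bx α) γ = col q₁ q₃ u P γ := col_add_of_ne _ _ _ _ hne
  have s3 : col q₁ q₃ u (P + bx γ) α = col q₁ q₃ u P α := col_add_of_ne _ _ _ _ hne.symm
  have s4 : col q₁ q₃ u (P + bx α + bx α) γ = col q₁ q₃ u P γ := by
    rw [col_add_of_ne _ _ _ _ hne, s2]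
  have s5 : col q₁ q₃ u (P + bx α + bx γ) α = q₁ * col q₁ q₃ u P α := by
    rw [col_add_of_ne _ _ _ _ hne.symm, s1]
  have s6 : col q₁ q₃ u (P + bx γ + bx α) α = q₁ * col q₁ q₃ u P α := by
    rw [add_right_comm, s5]
  have g0 : gpol q₁ q₂ q₃ (q₁ * col q₁ q₃ u P α) (col q₁ q₃ u P α) = 0 := by simp [gpol]
  simp only [pathCubic, s1, s2, s3, s4, s5, s6]
  have := cubic_hexagon h.hq (h.col_ne P α) (mul_ne_zero h.q₁_ne (h.col_ne P α)) (h.col_ne P γ)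
    (p₁ := pathCoef (coefBy q₁ q₂ q₃ u a b c R) P α α γ) (p₂ := 0)
    (p₃ := pathCoef (coefBy q₁ q₂ q₃ u a b c R) P α γ α)
    (p₄ := pathCoef (coefBy q₁ q₂ q₃ u a b c R) P γ α α) (p₅ := 0) (p₆ := 0)
    (by rw [g0]; simp) (h.pathCoef_swap_right hR P α hne s1 s2)
    (h.pathCoef_swap_left hR P α hne rfl rfl) (by simp) (by rw [g0]; simp) (by simp)
    (fun hp => h.gpol_ne_zero_of_pathCoef hp rfl s1 s4) (fun hp => absurd rfl hp)
    (fun hp => by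
      obtain ⟨h1, h2, h3⟩ := h.gpol_ne_zero_of_pathCoef hp rfl s2 s5
      exact ⟨h1, h2, h3⟩)
    (fun hp => h.gpol_ne_zero_of_pathCoef hp rfl s3 s6) (fun hp => absurd rfl hp)
    (fun hp => absurd rfl hp)
  linear_combination this

/-- The colours x, q₁x, q₁²x form a geometric progression, on which the cubic weight vanishes. -/
lemma pathCubic_constant (h : Resonant q₁ q₂ q₃ u a b)
    (c : (Fin n → ℕ →₀ ℕ) → Fin n × ℕ → ℂ) (P : Fin n → ℕ →₀ ℕ) (α : Fin n × ℕ) :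
    pathCubic q₁ q₃ u c P α α α = 0 := by
  have q1 := h.q₁_ne
  have hx := h.col_ne P α
  rw [pathCubic, cubicWeight]
  simp only [col_add_self]
  field_simp
  ring

/-- The cubic relation between the coefficients. -/
lemma pathCubic_symm (h : Resonant q₁ q₂ q₃ u a b) {c : ℂ}
    {R : Fin n × ℕ → Fin n × ℕ → Prop} (hR : RowOrder R) (P : Fin n → ℕ →₀ ℕ)
    (α β γ : Fin n × ℕ) :
    pathCubic q₁ q₃ u (coefBy q₁ q₂ q₃ u a b c R) P α β γ +
      pathCubic q₁ q₃ u (coefBy q₁ q₂ q₃ u a b c R) P β α γ +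
      pathCubic q₁ q₃ u (coefBy q₁ q₂ q₃ u a b c R) P α γ β +
      pathCubic q₁ q₃ u (coefBy q₁ q₂ q₃ u a b c R) P γ α β +
      pathCubic q₁ q₃ u (coefBy q₁ q₂ q₃ u a b c R) P β γ α +
      pathCubic q₁ q₃ u (coefBy q₁ q₂ q₃ u a b c R) P γ β α = 0 := by
  by_cases hαβ : α = β
  -- When exactly two of the rows coincide, each of the three distinct orders occurs twice among the
  -- six terms.
  · subst hαβ
    by_cases hαγ : α = γ
    · subst hαγ
      simp [h.pathCubic_constant]
    · linear_combination 2 * h.pathCubic_repeated (c := c) hR P hαγ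
  · by_cases hαγ : α = γ
    · subst hαγ
      linear_combination 2 * h.pathCubic_repeated (c := c) hR P hαβ
    · by_cases hβγ : β = γ
      · subst hβγ
        linear_combination 2 * h.pathCubic_repeated (c := c) hR P (Ne.symm hαβ)
      · exact h.pathCubic_distinct hR P hαβ hαγ hβγ

end Resonant

end CubicCoefficients

/-! ### Operators which add and remove boxes -/

section Operators

variable {n : ℕ} [NeZero n] {a b : Fin n → ℕ}

open Classical in
/-- The basis vector `|P⟩`, or zero if `P` is not in the index set. -/
def ketX (a b : Fin n → ℕ) (P : Fin n → ℕ →₀ ℕ) : Space a b :=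
  if h : IsT a b P then ket ⟨P, h⟩ else 0

lemma exists_tuple {P : Fin n → ℕ →₀ ℕ} (hP : IsT a b P) : ∃ Q : Tuples a b, Q.1 = P :=
  ⟨⟨P, hP⟩, rfl⟩

lemma ketX_val (P : Tuples a b) : ketX a b P.1 = ket P := dif_pos P.2

lemma ketX_of_not {P : Fin n → ℕ →₀ ℕ} (h : ¬ IsT a b P) : ketX a b P = 0 := dif_neg h

lemma ketX_apply_self (P : Tuples a b) : ketX a b P.1 P = 1 := by
  rw [ketX_val, ket, Finsupp.single_eq_same]

lemma ketX_apply_of_ne {P : Fin n → ℕ →₀ ℕ} {Q : Tuples a b} (h : P ≠ Q.1) :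
    ketX a b P Q = 0 := by
  by_cases hP : IsT a b P
  · obtain ⟨P, rfl⟩ := exists_tuple hP
    rw [ketX_val, ket, Finsupp.single_eq_of_ne]
    rintro rfl
    exact h rfl
  · rw [ketX_of_not hP]; rfl

lemma space_hom_ext {V : Type*} [AddCommGroup V] [Module ℂ V] {A B : Space a b →ₗ[ℂ] V}
    (h : ∀ P : Tuples a b, A (ket P) = B (ket P)) : A = B :=
  Finsupp.lhom_ext' fun P => LinearMap.ext_ring (h P)

lemma linearCombination_ket {V : Type*} [AddCommGroup V] [Module ℂ V] (v : Tuples a b → V)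
    (P : Tuples a b) : Finsupp.linearCombination ℂ v (ket P) = v P := by
  rw [ket, Finsupp.linearCombination_single, one_smul]

/-- The operator on `Space a b` which adds boxes, with coefficients `w`. -/
def upOp (a b : Fin n → ℕ) (w : (Fin n → ℕ →₀ ℕ) → Fin n × ℕ → ℂ) :
    Module.End ℂ (Space a b) :=
  Finsupp.linearCombination ℂ fun P : Tuples a b =>
    ∑ α ∈ rows n (size P.1 + 1), w P.1 α • ketX a b (P.1 + bx α)

/-- The operator on `Space a b` which removes boxes, with coefficients `w`. -/
def downOp (a b : Fin n → ℕ) (w : (Fin n → ℕ →₀ ℕ) → Fin n × ℕ → ℂ) :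
    Module.End ℂ (Space a b) :=
  Finsupp.linearCombination ℂ fun P : Tuples a b =>
    ∑ α ∈ rows n (size P.1), down w P.1 α • ketX a b (P.1 - bx α)

/-- The diagonal operator with eigenvalues `χ`. -/
def diagOp (a b : Fin n → ℕ) (χ : (Fin n → ℕ →₀ ℕ) → ℂ) : Module.End ℂ (Space a b) :=
  Finsupp.linearCombination ℂ fun P : Tuples a b => χ P.1 • ket P

lemma diagOp_ket (χ : (Fin n → ℕ →₀ ℕ) → ℂ) (P : Tuples a b) :
    diagOp a b χ (ket P) = χ P.1 • ket P := linearCombination_ket _ _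

lemma diagOp_ketX (χ : (Fin n → ℕ →₀ ℕ) → ℂ) (P : Fin n → ℕ →₀ ℕ) :
    diagOp a b χ (ketX a b P) = χ P • ketX a b P := by
  by_cases hP : IsT a b P
  · obtain ⟨P, rfl⟩ := exists_tuple hP
    rw [ketX_val, diagOp_ket]
  · rw [ketX_of_not hP]; simp

/-- The coefficients `w` vanish unless both tuples are in the index set. -/
def Supported (a b : Fin n → ℕ) (w : (Fin n → ℕ →₀ ℕ) → Fin n × ℕ → ℂ) : Prop :=
  ∀ P α, w P α ≠ 0 → IsT a b P ∧ IsT a b (P + bx α)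

lemma Supported.eq_zero {w : (Fin n → ℕ →₀ ℕ) → Fin n × ℕ → ℂ} (hw : Supported a b w)
    {P : Fin n → ℕ →₀ ℕ} {α : Fin n × ℕ} (h : ¬ (IsT a b P ∧ IsT a b (P + bx α))) :
    w P α = 0 := by
  by_contra hne
  exact h (hw P α hne)

lemma rows_subset {n : ℕ} {L L' : ℕ} (h : L ≤ L') : rows n L ⊆ rows n L' := fun _ hβ =>
  mem_rows.2 ((mem_rows.1 hβ).trans_le h)

lemma upOp_ketX {w : (Fin n → ℕ →₀ ℕ) → Fin n × ℕ → ℂ} (hw : Supported a b w)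
    (P : Fin n → ℕ →₀ ℕ) {N : ℕ} (hN : size P + 1 ≤ N) :
    upOp a b w (ketX a b P) = ∑ α ∈ rows n N, w P α • ketX a b (P + bx α) := by
  by_cases hP : IsT a b P
  · obtain ⟨P, rfl⟩ := exists_tuple hP
    rw [ketX_val, upOp, linearCombination_ket]
    refine Finset.sum_subset (rows_subset hN) fun α _ hα => ?_
    rw [hw.eq_zero, zero_smul]
    rintro ⟨-, h⟩
    exact hα (mem_rows.2 (Nat.lt_succ_of_le h.row_le))
  · rw [ketX_of_not hP, map_zero]
    refine (Finset.sum_eq_zero fun α _ => ?_).symm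
    rw [hw.eq_zero fun h => hP h.1, zero_smul]

lemma downOp_ketX {w : (Fin n → ℕ →₀ ℕ) → Fin n × ℕ → ℂ} (hw : Supported a b w)
    (P : Fin n → ℕ →₀ ℕ) {N : ℕ} (hN : size P ≤ N) :
    downOp a b w (ketX a b P) = ∑ α ∈ rows n N, down w P α • ketX a b (P - bx α) := by
  by_cases hP : IsT a b P
  · obtain ⟨P, rfl⟩ := exists_tuple hP
    rw [ketX_val, downOp, linearCombination_ket]
    refine Finset.sum_subset (rows_subset hN) fun α _ hα => ?_
    rw [down_of_not, zero_smul]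
    rintro ⟨R, e⟩
    have h0 := hP.eq_zero α.1 (j := α.2) (by simpa [mem_rows] using hα)
    rw [e, add_bx_self] at h0
    omega
  · rw [ketX_of_not hP, map_zero]
    refine (Finset.sum_eq_zero fun α _ => ?_).symm
    rw [down]
    split_ifs with e
    · rw [hw.eq_zero fun h => hP (e ▸ h.2), zero_smul]
    · rw [zero_smul]

lemma upOp_ket_apply {w : (Fin n → ℕ →₀ ℕ) → Fin n × ℕ → ℂ} {P Q : Tuples a b} {α : Fin n × ℕ}
    (h : Q.1 = P.1 + bx α) : upOp a b w (ket P) Q = w P.1 α := by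
  have hr : α.2 ≤ size P.1 := IsT.row_le (a := a) (b := b) (h ▸ Q.2)
  rw [upOp, linearCombination_ket, Finsupp.finsetSum_apply,
    Finset.sum_eq_single_of_mem α (mem_rows.2 (Nat.lt_succ_of_le hr))]
  · rw [Finsupp.smul_apply, ← h, ketX_apply_self, smul_eq_mul, mul_one]
  · intro β _ hβ
    rw [Finsupp.smul_apply, ketX_apply_of_ne, smul_zero]
    rw [h]
    exact fun e => hβ (bx_injective (add_left_cancel e))

lemma upOp_ket_apply_of_ne {w : (Fin n → ℕ →₀ ℕ) → Fin n × ℕ → ℂ} {P Q : Tuples a b}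
    (h : ∀ α, Q.1 ≠ P.1 + bx α) : upOp a b w (ket P) Q = 0 := by
  rw [upOp, linearCombination_ket, Finsupp.finsetSum_apply]
  refine Finset.sum_eq_zero fun β _ => ?_
  rw [Finsupp.smul_apply, ketX_apply_of_ne (h β).symm, smul_zero]

lemma downOp_ket_apply {w : (Fin n → ℕ →₀ ℕ) → Fin n × ℕ → ℂ} {P Q : Tuples a b}
    {α : Fin n × ℕ} (h : Q.1 = P.1 + bx α) : downOp a b w (ket Q) P = w P.1 α := by
  have hr : α.2 ≤ size P.1 := IsT.row_le (a := a) (b := b) (h ▸ Q.2)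
  have hs : size Q.1 = size P.1 + 1 := by rw [h, size_add_bx]
  rw [downOp, linearCombination_ket, Finsupp.finsetSum_apply,
    Finset.sum_eq_single_of_mem α (mem_rows.2 (by omega))]
  · rw [Finsupp.smul_apply, h, down_add_bx, add_tsub_cancel_right, ketX_apply_self, smul_eq_mul,
      mul_one]
  · intro β _ hβ
    rw [Finsupp.smul_apply, down]
    split_ifs with e
    · rw [ketX_apply_of_ne, smul_zero]
      intro e'
      rw [e', h] at e
      exact hβ (bx_injective (add_left_cancel e)).symm
    · rw [zero_smul]

lemma downOp_ket_apply_of_ne {w : (Fin n → ℕ →₀ ℕ) → Fin n × ℕ → ℂ} {P Q : Tuples a b}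
    (h : ∀ α, Q.1 ≠ P.1 + bx α) : downOp a b w (ket Q) P = 0 := by
  rw [downOp, linearCombination_ket, Finsupp.finsetSum_apply]
  refine Finset.sum_eq_zero fun β _ => ?_
  rw [Finsupp.smul_apply, down]
  split_ifs with e
  · rw [ketX_apply_of_ne, smul_zero]
    intro e'
    rw [e'] at e
    exact h β e
  · rw [zero_smul]

/-- `A` and `B` are transposes of each other. -/
def Transposed (A B : Module.End ℂ (Space a b)) : Prop :=
  ∀ P Q : Tuples a b, A (ket P) Q = B (ket Q) P

/-- Relations for f thereby follow from those for a current which adds boxes with the coefficients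
of f, that is, for the opposite row order. -/
lemma transposed_downOp_upOp (w : (Fin n → ℕ →₀ ℕ) → Fin n × ℕ → ℂ) :
    Transposed (downOp a b w) (upOp a b w) := by
  intro Q P
  by_cases h : ∃ α, Q.1 = P.1 + bx α
  · obtain ⟨α, h⟩ := h
    rw [downOp_ket_apply h, upOp_ket_apply h]
  · rw [not_exists] at h
    rw [downOp_ket_apply_of_ne h, upOp_ket_apply_of_ne h]

lemma transposed_diagOp (χ : (Fin n → ℕ →₀ ℕ) → ℂ) :
    Transposed (diagOp a b χ) (diagOp a b χ) := by
  intro P Q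
  rw [diagOp_ket, diagOp_ket, Finsupp.smul_apply, Finsupp.smul_apply, ket, ket]
  by_cases h : P = Q
  · rw [h]
  · rw [Finsupp.single_eq_of_ne (Ne.symm h), Finsupp.single_eq_of_ne h, smul_zero, smul_zero]

namespace Transposed

variable {A B A' B' : Module.End ℂ (Space a b)}

lemma smul (c : ℂ) (h : Transposed A B) : Transposed (c • A) (c • B) := fun P Q => by
  rw [LinearMap.smul_apply, LinearMap.smul_apply, Finsupp.smul_apply, Finsupp.smul_apply, h]

lemma sub (h : Transposed A B) (h' : Transposed A' B') : Transposed (A - A') (B - B') :=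
  fun P Q => by
    rw [LinearMap.sub_apply, LinearMap.sub_apply, Finsupp.sub_apply, Finsupp.sub_apply, h, h']

lemma sum {ι : Type*} (s : Finset ι) {A B : ι → Module.End ℂ (Space a b)}
    (h : ∀ i, Transposed (A i) (B i)) : Transposed (∑ i ∈ s, A i) (∑ i ∈ s, B i) := fun P Q => by
  simp only [LinearMap.sum_apply, Finsupp.finsetSum_apply, h _ P Q]

lemma mul (h : Transposed A B) (h' : Transposed A' B') : Transposed (A * A') (B' * B) := by
  have expand : ∀ (v : Space a b), v = v.sum fun R c => c • ket R := fun v => by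
    conv_lhs => rw [← Finsupp.sum_single v]
    simp [ket]
  have key : ∀ {A B : Module.End ℂ (Space a b)}, Transposed A B → ∀ (v : Space a b) (Q : Tuples a b),
      A v Q = v.sum fun R c => c * B (ket Q) R := fun {A B} h v Q => by
    conv_lhs => rw [expand v]
    rw [Finsupp.sum, map_sum, Finsupp.finsetSum_apply]
    refine Finset.sum_congr rfl fun R _ => ?_
    rw [map_smul, Finsupp.smul_apply, h, smul_eq_mul]
  have symm : Transposed B' A' := fun P Q => (h' Q P).symm
  classical
  intro P Q
  rw [Module.End.mul_apply, Module.End.mul_apply, key h, key symm, Finsupp.sum, Finsupp.sum]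
  -- Both matrix products are sums over finite supports, extended by zeros to the common union.
  rw [Finset.sum_subset (Finset.subset_union_left (s₁ := (A' (ket P)).support)
      (s₂ := (B (ket Q)).support)),
    Finset.sum_subset (s₁ := (B (ket Q)).support) (Finset.subset_union_right
      (s₁ := (A' (ket P)).support) (s₂ := (B (ket Q)).support))]
  · exact Finset.sum_congr rfl fun R _ => mul_comm _ _
  · intro R _ hR
    rw [Finsupp.notMem_support_iff.1 hR, zero_mul]
  · intro R _ hR
    rw [Finsupp.notMem_support_iff.1 hR, zero_mul]

lemma lie (h : Transposed A B) (h' : Transposed A' B') : Transposed ⁅A, A'⁆ ⁅B', B⁆ :=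
  (h.mul h').sub (h'.mul h)

lemma eq_zero (h : Transposed A B) (hB : B = 0) : A = 0 := by
  refine space_hom_ext fun P => Finsupp.ext fun Q => ?_
  rw [h, hB]
  rfl

lemma eq_neg (h : Transposed A B) (h' : Transposed A' B') (hB : B' = -B) : A = -A' := by
  refine space_hom_ext fun P => Finsupp.ext fun Q => ?_
  rw [LinearMap.neg_apply, Finsupp.neg_apply, h, h', hB, LinearMap.neg_apply, Finsupp.neg_apply,
    neg_neg]

end Transposed

end Operators

/-! ### The relations between the operators -/

section Relations

variable {n : ℕ} [NeZero n] {q₁ q₂ q₃ : ℂ} {u : Fin n → ℂ} {a b : Fin n → ℕ}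

/-- The coefficients of the mode number `m`. -/
def mode (q₁ q₃ : ℂ) (u : Fin n → ℂ) (c : (Fin n → ℕ →₀ ℕ) → Fin n × ℕ → ℂ) (m : ℤ)
    (P : Fin n → ℕ →₀ ℕ) (α : Fin n × ℕ) : ℂ := c P α * col q₁ q₃ u P α ^ m

lemma supported_mode {c : (Fin n → ℕ →₀ ℕ) → Fin n × ℕ → ℂ} (hc : Supported a b c) (m : ℤ) :
    Supported a b (mode q₁ q₃ u c m) := fun P α h => hc P α (left_ne_zero_of_mul h)

lemma supported_coefBy (c : ℂ) (R : Fin n × ℕ → Fin n × ℕ → Prop) :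
    Supported a b (coefBy q₁ q₂ q₃ u a b c R) := fun _ _ => isT_of_coefBy

lemma upOp_mul_upOp {w w' : (Fin n → ℕ →₀ ℕ) → Fin n × ℕ → ℂ} (hw : Supported a b w)
    (hw' : Supported a b w') (P : Fin n → ℕ →₀ ℕ) {N : ℕ} (hN : size P + 2 ≤ N) :
    (upOp a b w * upOp a b w') (ketX a b P) = ∑ α ∈ rows n N, ∑ β ∈ rows n N,
      (w' P α * w (P + bx α) β) • ketX a b (P + bx α + bx β) := by
  rw [Module.End.mul_apply, upOp_ketX hw' P (N := N) (by omega), map_sum]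
  refine Finset.sum_congr rfl fun α _ => ?_
  rw [map_smul, upOp_ketX hw _ (N := N) (by rw [size_add_bx]; omega), Finset.smul_sum]
  simp only [smul_smul]

lemma upOp_mul_upOp_mul_upOp {w w' w'' : (Fin n → ℕ →₀ ℕ) → Fin n × ℕ → ℂ}
    (hw : Supported a b w) (hw' : Supported a b w') (hw'' : Supported a b w'')
    (P : Fin n → ℕ →₀ ℕ) {N : ℕ} (hN : size P + 3 ≤ N) :
    (upOp a b w * (upOp a b w' * upOp a b w'')) (ketX a b P) =
      ∑ α ∈ rows n N, ∑ β ∈ rows n N, ∑ γ ∈ rows n N,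
        (w'' P α * w' (P + bx α) β * w (P + bx α + bx β) γ) •
          ketX a b (P + bx α + bx β + bx γ) := by
  rw [Module.End.mul_apply, upOp_mul_upOp hw' hw'' P (N := N) (by omega), map_sum]
  refine Finset.sum_congr rfl fun α _ => ?_
  rw [map_sum]
  refine Finset.sum_congr rfl fun β _ => ?_
  rw [map_smul, upOp_ketX hw _ (N := N) (by rw [size_add_bx, size_add_bx]; omega),
    Finset.smul_sum]
  simp only [smul_smul]

lemma sum_eq_zero_of_antisymm {ι V : Type*} [AddCommGroup V] [Module ℂ V] (S : Finset ι)
    {T : ι → ι → V} (h : ∀ α β, T α β = -T β α) : ∑ α ∈ S, ∑ β ∈ S, T α β = 0 := by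
  have h1 : ∑ α ∈ S, ∑ β ∈ S, T α β = -∑ α ∈ S, ∑ β ∈ S, T α β := by
    conv_lhs => rw [Finset.sum_comm]
    rw [← Finset.sum_neg_distrib]
    refine Finset.sum_congr rfl fun α _ => ?_
    rw [← Finset.sum_neg_distrib]
    exact Finset.sum_congr rfl fun β _ => h β α
  have h2 : (2 : ℂ) • ∑ α ∈ S, ∑ β ∈ S, T α β = 0 := by
    rw [two_smul]
    nth_rewrite 1 [h1]
    exact neg_add_cancel _
  exact (smul_eq_zero.1 h2).resolve_left two_ne_zero

lemma sum_eq_zero_of_symm_three {ι V : Type*} [AddCommGroup V] [Module ℂ V] (S : Finset ι)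
    {T : ι → ι → ι → V}
    (h : ∀ α β γ, T α β γ + T β α γ + T α γ β + T γ α β + T β γ α + T γ β α = 0) :
    ∑ α ∈ S, ∑ β ∈ S, ∑ γ ∈ S, T α β γ = 0 := by
  have h₁ : ∀ T : ι → ι → ι → V, ∑ α ∈ S, ∑ β ∈ S, ∑ γ ∈ S, T β α γ =
      ∑ α ∈ S, ∑ β ∈ S, ∑ γ ∈ S, T α β γ := fun T => Finset.sum_comm
  have h₂ : ∀ T : ι → ι → ι → V, ∑ α ∈ S, ∑ β ∈ S, ∑ γ ∈ S, T α γ β =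
      ∑ α ∈ S, ∑ β ∈ S, ∑ γ ∈ S, T α β γ := fun T => Finset.sum_congr rfl fun _ _ =>
    Finset.sum_comm
  have h₃ := (h₂ fun α β γ => T β α γ).trans (h₁ T)
  have h₄ := (h₁ fun α β γ => T α γ β).trans (h₂ T)
  have h₅ := (h₁ fun α β γ => T γ α β).trans h₃
  have h6 : (6 : ℂ) • ∑ α ∈ S, ∑ β ∈ S, ∑ γ ∈ S, T α β γ = 0 := by
    have := Finset.sum_eq_zero (s := S) fun α _ => Finset.sum_eq_zero (s := S) fun β _ =>
      Finset.sum_eq_zero (s := S) fun γ _ => h α β γ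
    simp only [Finset.sum_add_distrib] at this
    rw [h₁ T, h₂ T, h₃, h₄, h₅] at this
    rw [← this]
    module
  exact (smul_eq_zero.1 h6).resolve_left (by norm_num)

lemma gpol_eq_sum (z w : ℂ) : gpol q₁ q₂ q₃ z w =
    ∑ k : Fin 4, gCoeff q₁ q₂ q₃ k * z ^ (3 - (k : ℕ)) * w ^ (k : ℕ) := by
  simp [Fin.sum_univ_four, gCoeff, gpol]
  ring

lemma gpol_zpow {z w : ℂ} (hz : z ≠ 0) (hw : w ≠ 0) (i j : ℤ) :
    ∑ k : Fin 4, gCoeff q₁ q₂ q₃ k * (z ^ (i + 3 - (k : ℕ)) * w ^ (j + (k : ℕ))) =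
      z ^ i * w ^ j * gpol q₁ q₂ q₃ z w := by
  rw [gpol_eq_sum, Finset.mul_sum]
  refine Finset.sum_congr rfl fun k _ => ?_
  have hk : (k : ℕ) ≤ 3 := by omega
  rw [add_sub_assoc, zpow_add₀ hz, zpow_add₀ hw, show (3 : ℤ) - (k : ℕ) = ((3 - (k : ℕ) : ℕ) : ℤ) by
    push_cast [hk]; ring, zpow_natCast, zpow_natCast]
  ring

namespace Resonant

/-- The quadratic relation between the modes of a current which adds boxes. -/
lemma upOp_quadratic (h : Resonant q₁ q₂ q₃ u a b) {c : ℂ} {R : Fin n × ℕ → Fin n × ℕ → Prop}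
    (hR : RowOrder R) (i j : ℤ) :
    ∑ k : Fin 4, gCoeff q₁ q₂ q₃ k •
      (upOp a b (mode q₁ q₃ u (coefBy q₁ q₂ q₃ u a b c R) (i + 3 - (k : ℕ))) *
        upOp a b (mode q₁ q₃ u (coefBy q₁ q₂ q₃ u a b c R) (j + (k : ℕ)))) =
    -∑ k : Fin 4, gCoeff q₁ q₂ q₃ k •
      (upOp a b (mode q₁ q₃ u (coefBy q₁ q₂ q₃ u a b c R) (j + 3 - (k : ℕ))) *
        upOp a b (mode q₁ q₃ u (coefBy q₁ q₂ q₃ u a b c R) (i + (k : ℕ)))) := by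
  have hs := supported_mode (q₁ := q₁) (q₃ := q₃) (u := u)
    (supported_coefBy (q₁ := q₁) (q₂ := q₂) (q₃ := q₃) (u := u) (a := a) (b := b) c R)
  have key : ∀ (i j : ℤ) (P : Tuples a b), (∑ k : Fin 4, gCoeff q₁ q₂ q₃ k •
      (upOp a b (mode q₁ q₃ u (coefBy q₁ q₂ q₃ u a b c R) (i + 3 - (k : ℕ))) *
        upOp a b (mode q₁ q₃ u (coefBy q₁ q₂ q₃ u a b c R) (j + (k : ℕ))))) (ket P) =
      ∑ α ∈ rows n (size P.1 + 2), ∑ β ∈ rows n (size P.1 + 2),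
        (coefBy q₁ q₂ q₃ u a b c R P.1 α * coefBy q₁ q₂ q₃ u a b c R (P.1 + bx α) β *
          (col q₁ q₃ u (P.1 + bx α) β ^ i * col q₁ q₃ u P.1 α ^ j *
            gpol q₁ q₂ q₃ (col q₁ q₃ u (P.1 + bx α) β) (col q₁ q₃ u P.1 α))) •
          ketX a b (P.1 + bx α + bx β) := by
    intro i j P
    simp only [LinearMap.sum_apply, LinearMap.smul_apply, ← ketX_val,
      upOp_mul_upOp (hs _) (hs _) P.1 le_rfl, Finset.smul_sum, smul_smul]
    rw [Finset.sum_comm]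
    refine Finset.sum_congr rfl fun α _ => ?_
    rw [Finset.sum_comm]
    refine Finset.sum_congr rfl fun β _ => ?_
    rw [← Finset.sum_smul, ← gpol_zpow (h.col_ne _ _) (h.col_ne _ _), Finset.mul_sum]
    congr 1
    refine Finset.sum_congr rfl fun k _ => ?_
    simp only [mode]
    ring
  refine space_hom_ext fun P => ?_
  rw [LinearMap.neg_apply, key, key]
  refine eq_neg_of_add_eq_zero_left ?_
  simp only [← Finset.sum_add_distrib, ← add_smul]
  refine sum_eq_zero_of_antisymm _ fun α β => ?_
  -- Two boxes in one row have colours x and q₁x, where g vanishes; for distinct rows the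
  -- coefficient relation is used once with each assignment of the powers i and j.
  by_cases hαβ : α = β
  · subst hαβ
    simp [gpol, col_add_self]
  · rw [add_right_comm P.1 (bx β) (bx α), ← neg_smul, col_add_of_ne _ _ _ _ hαβ,
      col_add_of_ne _ _ _ _ (Ne.symm hαβ)]
    congr 1
    linear_combination (col q₁ q₃ u P.1 β ^ i * col q₁ q₃ u P.1 α ^ j +
      col q₁ q₃ u P.1 β ^ j * col q₁ q₃ u P.1 α ^ i) * h.coefBy_quadratic hR P.1 hαβ

/-- The cubic relation between the modes of a current which adds boxes. -/
lemma upOp_cubic (h : Resonant q₁ q₂ q₃ u a b) {c : ℂ} {R : Fin n × ℕ → Fin n × ℕ → Prop}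
    (hR : RowOrder R) :
    ⁅upOp a b (mode q₁ q₃ u (coefBy q₁ q₂ q₃ u a b c R) 0),
      ⁅upOp a b (mode q₁ q₃ u (coefBy q₁ q₂ q₃ u a b c R) 1),
        upOp a b (mode q₁ q₃ u (coefBy q₁ q₂ q₃ u a b c R) (-1))⁆⁆ = 0 := by
  have hs := supported_mode (q₁ := q₁) (q₃ := q₃) (u := u)
    (supported_coefBy (q₁ := q₁) (q₂ := q₂) (q₃ := q₃) (u := u) (a := a) (b := b) c R)
  refine space_hom_ext fun P => ?_
  rw [LinearMap.zero_apply, Ring.lie_def, Ring.lie_def, mul_sub, sub_mul, mul_assoc, mul_assoc,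
    ← ketX_val]
  simp only [LinearMap.sub_apply, upOp_mul_upOp_mul_upOp (hs _) (hs _) (hs _) P.1 le_rfl]
  simp only [← Finset.sum_sub_distrib, ← sub_smul]
  -- All six orders of the same three boxes end at the same tuple, so the relation is needed only
  -- after symmetrisation.
  refine sum_eq_zero_of_symm_three _ fun α β γ => ?_
  have e : ∀ α β γ : Fin n × ℕ, P.1 + bx α + bx β + bx γ = P.1 + (bx α + bx β + bx γ) :=
    fun _ _ _ => by simp only [add_assoc]
  have e1 : bx β + bx α + bx γ = bx α + bx β + bx γ := by abel
  have e2 : bx α + bx γ + bx β = bx α + bx β + bx γ := by abel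
  have e3 : bx γ + bx α + bx β = bx α + bx β + bx γ := by abel
  have e4 : bx β + bx γ + bx α = bx α + bx β + bx γ := by abel
  have e5 : bx γ + bx β + bx α = bx α + bx β + bx γ := by abel
  simp only [e, e1, e2, e3, e4, e5, ← add_smul]
  convert zero_smul ℂ _ using 2
  rw [← h.pathCubic_symm (c := c) hR P.1 α β γ]
  simp only [mode, pathCubic, pathCoef, cubicWeight, zpow_zero, zpow_one, zpow_neg_one]
  ring

/-- The relation between a diagonal current and a current which adds boxes. -/
lemma diagOp_upOp (h : Resonant q₁ q₂ q₃ u a b) {c : (Fin n → ℕ →₀ ℕ) → Fin n × ℕ → ℂ}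
    (hc : Supported a b c) {χ : ℤ → (Fin n → ℕ →₀ ℕ) → ℂ}
    (hχ : ∀ P α, IsT a b P → IsT a b (P + bx α) → ∀ i : ℤ,
      ∑ k : Fin 4, gCoeff q₁ q₂ q₃ k * col q₁ q₃ u P α ^ (k : ℕ) * χ (i + 3 - (k : ℕ)) (P + bx α) =
        -∑ k : Fin 4, gCoeff q₁ q₂ q₃ k * col q₁ q₃ u P α ^ (3 - (k : ℕ)) * χ (i + (k : ℕ)) P)
    (i j : ℤ) :
    ∑ k : Fin 4, gCoeff q₁ q₂ q₃ k • (diagOp a b (χ (i + 3 - (k : ℕ))) *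
        upOp a b (mode q₁ q₃ u c (j + (k : ℕ)))) =
      -∑ k : Fin 4, gCoeff q₁ q₂ q₃ k • (upOp a b (mode q₁ q₃ u c (j + 3 - (k : ℕ))) *
        diagOp a b (χ (i + (k : ℕ)))) := by
  have hs := supported_mode (q₁ := q₁) (q₃ := q₃) (u := u) hc
  refine space_hom_ext fun P => ?_
  simp only [LinearMap.neg_apply, LinearMap.sum_apply, LinearMap.smul_apply, Module.End.mul_apply,
    ← ketX_val, diagOp_ketX, map_smul, upOp_ketX (hs _) P.1 le_rfl, map_sum, Finset.smul_sum,
    smul_smul]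
  rw [Finset.sum_comm, Finset.sum_comm (s := Finset.univ), ← Finset.sum_neg_distrib]
  refine Finset.sum_congr rfl fun α _ => ?_
  rw [← Finset.sum_smul, ← Finset.sum_smul, ← neg_smul]
  by_cases hα : IsT a b (P.1 + bx α)
  swap
  · rw [ketX_of_not hα, smul_zero, smul_zero]
  congr 1
  have hx := h.col_ne P.1 α
  have e1 : ∀ k : Fin 4, mode q₁ q₃ u c (j + (k : ℕ)) P.1 α =
      c P.1 α * col q₁ q₃ u P.1 α ^ j * col q₁ q₃ u P.1 α ^ (k : ℕ) := fun k => by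
    rw [mode, zpow_add₀ hx, zpow_natCast, mul_assoc]
  have e2 : ∀ k : Fin 4, mode q₁ q₃ u c (j + 3 - (k : ℕ)) P.1 α =
      c P.1 α * col q₁ q₃ u P.1 α ^ j * col q₁ q₃ u P.1 α ^ (3 - (k : ℕ)) := fun k => by
    have hk : (k : ℕ) ≤ 3 := by omega
    rw [mode, add_sub_assoc, zpow_add₀ hx, show (3 : ℤ) - (k : ℕ) = ((3 - (k : ℕ) : ℕ) : ℤ) by
      push_cast [hk]; ring, zpow_natCast, mul_assoc]
  simp only [e1, e2]
  have := congrArg (fun t => c P.1 α * col q₁ q₃ u P.1 α ^ j * t) (hχ P.1 α P.2 hα i)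
  simp only [mul_neg, Finset.mul_sum] at this
  refine Eq.trans (Finset.sum_congr rfl fun k _ => ?_)
    (this.trans (congrArg _ (Finset.sum_congr rfl fun k _ => ?_))) <;> ring

end Resonant

end Relations

/-! ### The module structure -/

section ModuleStructure

variable {n : ℕ} [NeZero n] {q₁ q₂ q₃ : ℂ} {u : Fin n → ℂ} {a b : Fin n → ℕ}

lemma diagOp_congr {χ χ' : (Fin n → ℕ →₀ ℕ) → ℂ} (h : ∀ P, IsT a b P → χ P = χ' P) :
    diagOp a b χ = diagOp a b χ' :=
  space_hom_ext fun P => by rw [diagOp_ket, diagOp_ket, h _ P.2]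

lemma diagOp_mul (χ χ' : (Fin n → ℕ →₀ ℕ) → ℂ) :
    diagOp a b χ * diagOp a b χ' = diagOp a b fun P => χ P * χ' P :=
  space_hom_ext fun P => by
    rw [Module.End.mul_apply, diagOp_ket, map_smul, diagOp_ket, diagOp_ket, smul_smul, mul_comm]

lemma diagOp_one : diagOp a b (fun _ => 1) = 1 :=
  space_hom_ext fun P => by rw [diagOp_ket, one_smul, Module.End.one_apply]

lemma diagOp_zero : diagOp a b (fun _ => 0) = 0 :=
  space_hom_ext fun P => by rw [diagOp_ket, zero_smul, LinearMap.zero_apply]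

lemma add_bx_add_bx_sub {n : ℕ} (R : Fin n → ℕ →₀ ℕ) (α β : Fin n × ℕ) :
    R + bx β + bx α - bx β = R + bx α := by
  rw [add_right_comm, add_tsub_cancel_right]

lemma exists_of_add_eq_add {n : ℕ} {Q R : Fin n → ℕ →₀ ℕ} {α β : Fin n × ℕ} (hne : α ≠ β)
    (h : Q + bx α = R + bx β) : ∃ R', Q = R' + bx β := by
  refine ⟨Q - bx β, (tsub_add_cancel_of_le fun l r => ?_).symm⟩
  rw [bx_apply]
  split_ifs with e
  · have h1 := DFunLike.congr_fun (congrFun h l) r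
    rw [add_bx_apply, add_bx_apply, if_pos e, if_neg (by rw [← e]; exact hne)] at h1
    omega
  · exact Nat.zero_le _

/-- The operator `e_m`. -/
def opE (q₁ q₂ q₃ : ℂ) (u : Fin n → ℂ) (a b : Fin n → ℕ) (m : ℤ) : Module.End ℂ (Space a b) :=
  upOp a b (mode q₁ q₃ u (eCoef q₁ q₂ q₃ u a b) m)

/-- The operator `f_m`. -/
def opF (q₁ q₂ q₃ : ℂ) (u : Fin n → ℂ) (a b : Fin n → ℕ) (m : ℤ) : Module.End ℂ (Space a b) :=
  downOp a b (mode q₁ q₃ u (fCoef q₁ q₂ q₃ u a b) m)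

/-- The operator `ψ⁺_m`. -/
def opPlus (q₁ q₂ q₃ : ℂ) (u : Fin n → ℂ) (a b : Fin n → ℕ) (m : ℤ) : Module.End ℂ (Space a b) :=
  diagOp a b fun P => psiP q₁ q₂ q₃ u P m

/-- The operator `ψ⁻_m`. -/
def opMinus (q₁ q₂ q₃ : ℂ) (u : Fin n → ℂ) (a b : Fin n → ℕ) (m : ℤ) :
    Module.End ℂ (Space a b) :=
  diagOp a b fun P => psiM q₁ q₂ q₃ u P m

lemma supported_eCoef : Supported a b (eCoef q₁ q₂ q₃ u a b) := supported_coefBy _ _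

lemma supported_fCoef : Supported a b (fCoef q₁ q₂ q₃ u a b) := supported_coefBy _ _

lemma opE_mul_opF (Q : Tuples a b) {N : ℕ} (hN : size Q.1 + 1 ≤ N) (i j : ℤ) :
    (opE q₁ q₂ q₃ u a b i * opF q₁ q₂ q₃ u a b j) (ket Q) = ∑ β ∈ rows n N, ∑ α ∈ rows n N,
      (down (mode q₁ q₃ u (fCoef q₁ q₂ q₃ u a b) j) Q.1 β *
        mode q₁ q₃ u (eCoef q₁ q₂ q₃ u a b) i (Q.1 - bx β) α) •
        ketX a b (Q.1 - bx β + bx α) := by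
  rw [Module.End.mul_apply, ← ketX_val, opF,
    downOp_ketX (supported_mode supported_fCoef j) Q.1 (N := N) (by omega), map_sum]
  refine Finset.sum_congr rfl fun β _ => ?_
  by_cases hβ : ∃ R, Q.1 = R + bx β
  · obtain ⟨R, hR⟩ := hβ
    have hs : size Q.1 = size R + 1 := by rw [hR, size_add_bx]
    rw [map_smul, opE, upOp_ketX (supported_mode supported_eCoef i) _ (N := N)
      (by rw [hR, add_tsub_cancel_right]; omega), Finset.smul_sum]
    simp only [smul_smul]
  · rw [down_of_not hβ, zero_smul, map_zero]
    simp

lemma opF_mul_opE (Q : Tuples a b) {N : ℕ} (hN : size Q.1 + 1 ≤ N) (i j : ℤ) :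
    (opF q₁ q₂ q₃ u a b j * opE q₁ q₂ q₃ u a b i) (ket Q) = ∑ α ∈ rows n N, ∑ β ∈ rows n N,
      (mode q₁ q₃ u (eCoef q₁ q₂ q₃ u a b) i Q.1 α *
        down (mode q₁ q₃ u (fCoef q₁ q₂ q₃ u a b) j) (Q.1 + bx α) β) •
        ketX a b (Q.1 + bx α - bx β) := by
  rw [Module.End.mul_apply, ← ketX_val, opE,
    upOp_ketX (supported_mode supported_eCoef i) Q.1 (N := N) hN, map_sum]
  refine Finset.sum_congr rfl fun α _ => ?_
  rw [map_smul, opF, downOp_ketX (supported_mode supported_fCoef j) _ (N := N)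
    (by rw [size_add_bx]; omega), Finset.smul_sum]
  simp only [smul_smul]

namespace Resonant

/-- This is `coefBy_commute` on the tuple without the box β. If Q has no box in β, a box added to
another row does not create one. -/
lemma commutator_off_diagonal (h : Resonant q₁ q₂ q₃ u a b) (Q : Fin n → ℕ →₀ ℕ) (i j : ℤ)
    {α β : Fin n × ℕ} (hne : α ≠ β) :
    (down (mode q₁ q₃ u (fCoef q₁ q₂ q₃ u a b) j) Q β *
        mode q₁ q₃ u (eCoef q₁ q₂ q₃ u a b) i (Q - bx β) α) • ketX a b (Q - bx β + bx α) =
      (mode q₁ q₃ u (eCoef q₁ q₂ q₃ u a b) i Q α *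
        down (mode q₁ q₃ u (fCoef q₁ q₂ q₃ u a b) j) (Q + bx α) β) •
        ketX a b (Q + bx α - bx β) := by
  by_cases hβ : ∃ R, Q = R + bx β
  · obtain ⟨R, rfl⟩ := hβ
    rw [down_add_bx, add_tsub_cancel_right, add_bx_add_bx_sub, add_right_comm R, down_add_bx]
    congr 1
    have := h.coefBy_commute (c := (1 - q₁)⁻¹) (d := q₁ / (1 - q₁)) prec_rowOrder
      prec_rowOrder_flip R (α := β) (β := α) hne.symm
    rw [mode, mode, mode, mode, col_add_of_ne _ _ _ _ hne, col_add_of_ne _ _ _ _ hne.symm]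
    rw [eCoef, fCoef]
    linear_combination col q₁ q₃ u R β ^ j * col q₁ q₃ u R α ^ i * this
  · rw [down_of_not hβ, down_of_not (P := Q + bx α)]
    · simp
    · rintro ⟨R, e⟩
      exact hβ (exists_of_add_eq_add hne e)

/-- The commutator of `e_i` and `f_j`. -/
lemma opE_opF_commutator (h : Resonant q₁ q₂ q₃ u a b) (i j : ℤ) :
    opE q₁ q₂ q₃ u a b i * opF q₁ q₂ q₃ u a b j - opF q₁ q₂ q₃ u a b j * opE q₁ q₂ q₃ u a b i =
      ((1 - q₁) * (1 - q₂) * (1 - q₃))⁻¹ •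
        (opPlus q₁ q₂ q₃ u a b (i + j) - opMinus q₁ q₂ q₃ u a b (i + j)) := by
  refine space_hom_ext fun Q => ?_
  rw [LinearMap.sub_apply, opE_mul_opF Q (N := size Q.1 + 2) (by omega),
    opF_mul_opE Q (N := size Q.1 + 2) (by omega), Finset.sum_comm, ← Finset.sum_sub_distrib,
    LinearMap.smul_apply, LinearMap.sub_apply, opPlus, opMinus, diagOp_ket, diagOp_ket, ← sub_smul,
    h.psiP_sub_psiM_eq Q.2 le_rfl, smul_smul, inv_mul_cancel_left₀ h.g_one_ne, sub_smul,
    Finset.sum_smul, Finset.sum_smul, ← Finset.sum_sub_distrib]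
  have hw : ∀ R α, mode q₁ q₃ u (eCoef q₁ q₂ q₃ u a b) i R α *
      mode q₁ q₃ u (fCoef q₁ q₂ q₃ u a b) j R α =
      eCoef q₁ q₂ q₃ u a b R α * fCoef q₁ q₂ q₃ u a b R α * col q₁ q₃ u R α ^ (i + j) :=
    fun R α => by rw [mode, mode, zpow_add₀ (h.col_ne R α)]; ring
  -- Moves in different rows commute and cancel; what remains is diagonal and was identified with
  -- the expansion difference through the residues.
  refine Finset.sum_congr rfl fun α hα => ?_
  rw [← Finset.sum_sub_distrib, Finset.sum_eq_single_of_mem α hα]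
  · rw [down_add_bx, add_tsub_cancel_right, hw, ketX_val]
    congr 1
    by_cases hR : ∃ R, Q.1 = R + bx α
    · obtain ⟨R, hR⟩ := hR
      rw [← ketX_val Q, hR, down_add_bx, down_add_bx, add_tsub_cancel_right, mul_comm, hw]
    · rw [down_of_not hR, down_of_not hR, zero_mul, zero_smul, zero_smul]
  · intro β _ hβ
    rw [h.commutator_off_diagonal Q.1 i j hβ.symm, sub_self]

end Resonant

/-- The action of the generators. -/
def genOp (q₁ q₂ q₃ : ℂ) (u : Fin n → ℂ) (a b : Fin n → ℕ) : Gen → Module.End ℂ (Space a b)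
  | .e m => opE q₁ q₂ q₃ u a b m
  | .f m => opF q₁ q₂ q₃ u a b m
  | .psiPlus m => opPlus q₁ q₂ q₃ u a b m
  | .psiMinus m => opMinus q₁ q₂ q₃ u a b (-m)
  | .psiPlusInv => diagOp a b fun P => (psiP q₁ q₂ q₃ u P 0)⁻¹
  | .psiMinusInv => diagOp a b fun P => (psiM q₁ q₂ q₃ u P 0)⁻¹

/-- The action of the free algebra. -/
def freeAction (q₁ q₂ q₃ : ℂ) (u : Fin n → ℂ) (a b : Fin n → ℕ) :
    FreeGen →ₐ[ℂ] Module.End ℂ (Space a b) :=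
  FreeAlgebra.lift ℂ (genOp q₁ q₂ q₃ u a b)

lemma freeAction_e (m : ℤ) : freeAction q₁ q₂ q₃ u a b (freeE m) = opE q₁ q₂ q₃ u a b m := by
  rw [freeAction, freeE, FreeAlgebra.lift_ι_apply, genOp]

lemma freeAction_f (m : ℤ) : freeAction q₁ q₂ q₃ u a b (freeF m) = opF q₁ q₂ q₃ u a b m := by
  rw [freeAction, freeF, FreeAlgebra.lift_ι_apply, genOp]

namespace Resonant

/-- Negative modes are zero in the free algebra; they act by zero as well, because the eigenvalue is
a power series in z⁻¹. -/
lemma freeAction_psiPlus (h : Resonant q₁ q₂ q₃ u a b) (m : ℤ) :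
    freeAction q₁ q₂ q₃ u a b (freePsiPlus m) = opPlus q₁ q₂ q₃ u a b m := by
  rw [freePsiPlus]
  split_ifs with hm
  · rw [freeAction, FreeAlgebra.lift_ι_apply, genOp, Int.toNat_of_nonneg hm]
  · rw [map_zero, opPlus, ← diagOp_zero]
    exact diagOp_congr fun P hP => (h.psiP_of_neg hP (not_le.1 hm)).symm

lemma freeAction_psiMinus (h : Resonant q₁ q₂ q₃ u a b) (m : ℤ) :
    freeAction q₁ q₂ q₃ u a b (freePsiMinus m) = opMinus q₁ q₂ q₃ u a b m := by
  rw [freePsiMinus]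
  split_ifs with hm
  · rw [freeAction, FreeAlgebra.lift_ι_apply, genOp, Int.toNat_of_nonneg (by omega), neg_neg]
  · rw [map_zero, opMinus, ← diagOp_zero]
    exact diagOp_congr fun P hP => (h.psiM_of_pos hP (not_le.1 hm)).symm

lemma transposed_opF (m : ℤ) : Transposed (opF q₁ q₂ q₃ u a b m)
    (upOp a b (mode q₁ q₃ u (fCoef q₁ q₂ q₃ u a b) m)) := transposed_downOp_upOp _

lemma opE_quadratic (h : Resonant q₁ q₂ q₃ u a b) (i j : ℤ) :
    ∑ k : Fin 4, gCoeff q₁ q₂ q₃ k •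
      (opE q₁ q₂ q₃ u a b (i + 3 - (k : ℕ)) * opE q₁ q₂ q₃ u a b (j + (k : ℕ))) =
    -∑ k : Fin 4, gCoeff q₁ q₂ q₃ k •
      (opE q₁ q₂ q₃ u a b (j + 3 - (k : ℕ)) * opE q₁ q₂ q₃ u a b (i + (k : ℕ))) :=
  h.upOp_quadratic prec_rowOrder i j

/-- Transposition reverses products, which accounts for the exchange of g(z,w) and g(w,z) between
the relations for e and f. -/
lemma opF_quadratic (h : Resonant q₁ q₂ q₃ u a b) (i j : ℤ) :
    ∑ k : Fin 4, gCoeff q₁ q₂ q₃ k •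
      (opF q₁ q₂ q₃ u a b (i + (k : ℕ)) * opF q₁ q₂ q₃ u a b (j + 3 - (k : ℕ))) =
    -∑ k : Fin 4, gCoeff q₁ q₂ q₃ k •
      (opF q₁ q₂ q₃ u a b (j + (k : ℕ)) * opF q₁ q₂ q₃ u a b (i + 3 - (k : ℕ))) := by
  exact Transposed.eq_neg (.sum _ fun k => .smul _ (.mul (transposed_opF _) (transposed_opF _)))
    (.sum _ fun k => .smul _ (.mul (transposed_opF _) (transposed_opF _)))
    (h.upOp_quadratic (c := q₁ / (1 - q₁)) prec_rowOrder_flip i j)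

lemma opF_cubic (h : Resonant q₁ q₂ q₃ u a b) :
    ⁅opF q₁ q₂ q₃ u a b 0, ⁅opF q₁ q₂ q₃ u a b 1, opF q₁ q₂ q₃ u a b (-1)⁆⁆ = 0 := by
  have t := transposed_opF (q₁ := q₁) (q₂ := q₂) (q₃ := q₃) (u := u) (a := a) (b := b)
  refine Transposed.eq_zero (.lie (t 0) (.lie (t 1) (t (-1)))) ?_
  -- The transpose reverses both brackets, and the two signs cancel.
  have e : ∀ A B C : Module.End ℂ (Space a b), ⁅⁅C, B⁆, A⁆ = ⁅A, ⁅B, C⁆⁆ := fun A B C => by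
    simp only [Ring.lie_def, mul_sub, sub_mul, mul_assoc]
    abel
  rw [e]
  exact h.upOp_cubic prec_rowOrder_flip

lemma diagOp_opF (h : Resonant q₁ q₂ q₃ u a b) {χ : ℤ → (Fin n → ℕ →₀ ℕ) → ℂ}
    (hχ : ∀ P α, IsT a b P → IsT a b (P + bx α) → ∀ i : ℤ,
      ∑ k : Fin 4, gCoeff q₁ q₂ q₃ k * col q₁ q₃ u P α ^ (k : ℕ) * χ (i + 3 - (k : ℕ)) (P + bx α) =
        -∑ k : Fin 4, gCoeff q₁ q₂ q₃ k * col q₁ q₃ u P α ^ (3 - (k : ℕ)) * χ (i + (k : ℕ)) P)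
    (i j : ℤ) :
    ∑ k : Fin 4, gCoeff q₁ q₂ q₃ k • (diagOp a b (χ (i + (k : ℕ))) *
        opF q₁ q₂ q₃ u a b (j + 3 - (k : ℕ))) =
      -∑ k : Fin 4, gCoeff q₁ q₂ q₃ k • (opF q₁ q₂ q₃ u a b (j + (k : ℕ)) *
        diagOp a b (χ (i + 3 - (k : ℕ)))) := by
  exact Transposed.eq_neg
    (.sum _ fun k => .smul _ (.mul (transposed_diagOp _) (transposed_opF _)))
    (.sum _ fun k => .smul _ (.mul (transposed_opF _) (transposed_diagOp _)))
    (h.diagOp_upOp supported_fCoef hχ i j)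

/-- The defining relations hold. -/
lemma freeAction_rel (h : Resonant q₁ q₂ q₃ u a b) ⦃x y : FreeGen⦄ (hr : Rel q₁ q₂ q₃ x y) :
    freeAction q₁ q₂ q₃ u a b x = freeAction q₁ q₂ q₃ u a b y := by
  cases hr with
  | ee i j =>
    simp only [gzw, gwzOp, map_neg, map_sum, map_smul, map_mul, freeAction_e]
    exact h.opE_quadratic i j
  | ff i j =>
    simp only [gwz, gzwOp, map_neg, map_sum, map_smul, map_mul, freeAction_f]
    exact h.opF_quadratic i j
  | psiPlus_e i j =>
    simp only [gzw, gwzOp, map_neg, map_sum, map_smul, map_mul, freeAction_e, h.freeAction_psiPlus]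
    exact h.diagOp_upOp supported_eCoef (χ := fun i P => psiP q₁ q₂ q₃ u P i)
      (fun P α hP hα => h.psiP_add hP hα) i j
  | psiMinus_e i j =>
    simp only [gzw, gwzOp, map_neg, map_sum, map_smul, map_mul, freeAction_e,
      h.freeAction_psiMinus]
    exact h.diagOp_upOp supported_eCoef (χ := fun i P => psiM q₁ q₂ q₃ u P i)
      (fun P α hP hα => h.psiM_add hP hα) i j
  | psiPlus_f i j =>
    simp only [gwz, gzwOp, map_neg, map_sum, map_smul, map_mul, freeAction_f, h.freeAction_psiPlus]
    exact h.diagOp_opF (χ := fun i P => psiP q₁ q₂ q₃ u P i)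
      (fun P α hP hα => h.psiP_add hP hα) i j
  | psiMinus_f i j =>
    simp only [gwz, gzwOp, map_neg, map_sum, map_smul, map_mul, freeAction_f,
      h.freeAction_psiMinus]
    exact h.diagOp_opF (χ := fun i P => psiM q₁ q₂ q₃ u P i)
      (fun P α hP hα => h.psiM_add hP hα) i j
  | ef i j =>
    simp only [map_sub, map_smul, map_mul, freeAction_e, freeAction_f, h.freeAction_psiPlus,
      h.freeAction_psiMinus]
    exact h.opE_opF_commutator i j
  | psiPlus_psiPlus i j =>
    simp only [map_mul, h.freeAction_psiPlus, opPlus, diagOp_mul, mul_comm]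
  | psiMinus_psiMinus i j =>
    simp only [map_mul, h.freeAction_psiMinus, opMinus, diagOp_mul, mul_comm]
  | psiPlus_psiMinus i j =>
    simp only [map_mul, h.freeAction_psiPlus, h.freeAction_psiMinus, opPlus, opMinus, diagOp_mul,
      mul_comm]
  | psiPlus_inv =>
    rw [map_mul, h.freeAction_psiPlus, freeAction, FreeAlgebra.lift_ι_apply, genOp, opPlus,
      diagOp_mul, map_one, ← diagOp_one]
    exact diagOp_congr fun P hP => mul_inv_cancel₀ (h.psiP_zero_ne hP)
  | psiPlus_inv_left =>
    rw [map_mul, h.freeAction_psiPlus, freeAction, FreeAlgebra.lift_ι_apply, genOp, opPlus,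
      diagOp_mul, map_one, ← diagOp_one]
    exact diagOp_congr fun P hP => inv_mul_cancel₀ (h.psiP_zero_ne hP)
  | psiMinus_inv =>
    rw [map_mul, h.freeAction_psiMinus, freeAction, FreeAlgebra.lift_ι_apply, genOp, opMinus,
      diagOp_mul, map_one, ← diagOp_one]
    exact diagOp_congr fun P hP => mul_inv_cancel₀ (h.psiM_zero_ne hP)
  | psiMinus_inv_left =>
    rw [map_mul, h.freeAction_psiMinus, freeAction, FreeAlgebra.lift_ι_apply, genOp, opMinus,
      diagOp_mul, map_one, ← diagOp_one]
    exact diagOp_congr fun P hP => inv_mul_cancel₀ (h.psiM_zero_ne hP)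
  | serre_e =>
    have := h.upOp_cubic (c := (1 - q₁)⁻¹) prec_rowOrder
    simp only [Ring.lie_def, map_sub, map_mul, freeAction_e, map_zero] at this ⊢
    exact this
  | serre_f =>
    have := h.opF_cubic
    simp only [Ring.lie_def, map_sub, map_mul, freeAction_f, map_zero] at this ⊢
    exact this

/-- The action of `𝓔`. -/
def action (h : Resonant q₁ q₂ q₃ u a b) : Alg q₁ q₂ q₃ →ₐ[ℂ] Module.End ℂ (Space a b) :=
  RingQuot.liftAlgHom ℂ ⟨freeAction q₁ q₂ q₃ u a b, h.freeAction_rel⟩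

lemma action_gen (h : Resonant q₁ q₂ q₃ u a b) (x : Gen) :
    h.action (gen q₁ q₂ q₃ x) = genOp q₁ q₂ q₃ u a b x := by
  rw [action, gen, RingQuot.liftAlgHom_mkAlgHom_apply, freeAction, FreeAlgebra.lift_ι_apply]

end Resonant

end ModuleStructure

/-! ### The matrix coefficients as values of the generic ones. -/

section Values

variable {n : ℕ} [NeZero n] {q₁ q₂ q₃ : ℂ} {u : Fin n → ℂ} {a b : Fin n → ℕ}

namespace Resonant

/-- At a row that can receive a box the only possible vanishing denominator is that of the row
itself, and S omits it. -/
lemma hasValueAt_selProd (h : Resonant q₁ q₂ q₃ u a b) {P : Fin n → ℕ →₀ ℕ} {α : Fin n × ℕ}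
    (hP : IsT a b P) (hα : IsT a b (P + bx α)) (S : Fin n × ℕ → Prop) [DecidablePred S]
    (hS : ¬ S α) (L : ℕ) :
    HasValueAt q₁ q₃ u (selProd (genQ1 n) (genQ2 n) (genQ3 n) (genU n) P S L
        (col (genQ1 n) (genQ3 n) (genU n) P α))
      (selProd q₁ q₂ q₃ u P S L (col q₁ q₃ u P α)) := by
  refine HasValueAt.selProd h.hq P S L (HasValueAt.col P α) (fun β hβ e => ?_)
    fun β _ => h.col_ne_inv hP hα
  obtain rfl := h.col_injective hP e
  exact hS hβ

lemma hasValueAt_tensorE (h : Resonant q₁ q₂ q₃ u a b) {P : Fin n → ℕ →₀ ℕ} {k : Fin n} {s : ℕ}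
    (hP : IsT a b P) (hα : IsT a b (P + bx (k, s))) (m : ℤ) :
    HasValueAt q₁ q₃ u (tensorE (genQ1 n) (genQ2 n) (genQ3 n) (genU n) P k s m)
      (mode q₁ q₃ u (eCoef q₁ q₂ q₃ u a b) m P (k, s)) := by
  have hr : s ≤ size P := hα.row_le
  rw [tensorE_eq genQ1_mul_genQ2_mul_genQ3 k s (size P + 1) m (by omega)
    (fun l j hj => hP.eq_zero l (by omega)) (generic_col_ne_zero P _)
    (fun l hl => generic_col_ne P (α := (k, s)) hl), mode, eCoef,
    h.coefBy_eq prec_rowOrder hP hα le_rfl]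
  refine (((HasValueAt.one.sub HasValueAt.genQ1).inv h.one_sub_q₁_ne).mul ?_).mul
    ((HasValueAt.col P _).zpow (h.col_ne P _) m)
  convert h.hasValueAt_selProd hP hα (fun β => Prec β (k, s)) (prec_rowOrder.irrefl _) (size P + 1)

lemma hasValueAt_tensorF (h : Resonant q₁ q₂ q₃ u a b) {P : Fin n → ℕ →₀ ℕ} {k : Fin n} {s : ℕ}
    (hP : IsT a b P) (hα : IsT a b (P + bx (k, s))) (m : ℤ) :
    HasValueAt q₁ q₃ u (tensorF (genQ1 n) (genQ2 n) (genQ3 n) (genU n) P k s m)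
      (mode q₁ q₃ u (fCoef q₁ q₂ q₃ u a b) m P (k, s)) := by
  have hr : s ≤ size P := hα.row_le
  rw [tensorF_eq genQ1_mul_genQ2_mul_genQ3 k s (size P + 1) m (by omega)
    (fun l j hj => hP.eq_zero l (by omega)) (generic_col_ne_zero P _) generic_exponents
    (fun l hl => generic_col_ne P (α := (k, s)) hl), mode, fCoef,
    h.coefBy_eq prec_rowOrder_flip hP hα le_rfl]
  refine ((HasValueAt.genQ1.div (HasValueAt.one.sub HasValueAt.genQ1) h.one_sub_q₁_ne).mul
    ?_).mul ((HasValueAt.col P _).zpow (h.col_ne P _) m)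
  convert h.hasValueAt_selProd hP hα (fun β => Prec (k, s) β) (prec_rowOrder.irrefl _)
    (size P + 1)

/-- The action of `𝓔` has the required matrix coefficients. -/
lemma isModuleStructure (h : Resonant q₁ q₂ q₃ u a b) :
    IsModuleStructure q₁ q₂ q₃ u a b h.action where
  e_box m P Q k s hQ := by
    rw [h.action_gen, genOp, opE, upOp_ket_apply (α := (k, s)) hQ]
    exact h.hasValueAt_tensorE P.2 (hQ ▸ Q.2) m
  e_zero m P Q hQ := by
    rw [h.action_gen, genOp, opE, upOp_ket_apply_of_ne fun α => hQ α.1 α.2]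
  f_box m P Q k s hQ := by
    rw [h.action_gen, genOp, opF, downOp_ket_apply (α := (k, s)) hQ]
    exact h.hasValueAt_tensorF P.2 (hQ ▸ Q.2) m
  f_zero m P Q hQ := by
    rw [h.action_gen, genOp, opF, downOp_ket_apply_of_ne fun α => hQ α.1 α.2]
  psiPlus_eig m P := by
    rw [h.action_gen, genOp, opPlus, diagOp_ket]
    rfl
  psiMinus_eig m P := by
    rw [h.action_gen, genOp, opMinus, diagOp_ket, psiM, neg_neg]
    rfl

end Resonant

end Values

/-! ### The cyclic symmetry -/

section Cyclic

variable {n : ℕ} [NeZero n] {q₁ q₂ q₃ : ℂ} {u : Fin n → ℂ} {a b : Fin n → ℕ}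

/-- The row of a tuple which becomes the row `β` after the cyclic shift. -/
def nextRow (β : Fin n × ℕ) : Fin n × ℕ := (β.1 + 1, β.2)

lemma nextRow_bijective : Function.Bijective (nextRow (n := n)) := by
  refine ⟨fun α β h => ?_, fun α => ⟨(α.1 - 1, α.2), by simp [nextRow]⟩⟩
  simp only [nextRow, Prod.mk.injEq, add_left_inj] at h
  exact Prod.ext h.1 h.2

lemma cyc_injective {α : Type} : Function.Injective (cyc (n := n) (α := α)) := fun x y h => by
  funext i
  have := congrFun h (i - 1)
  simpa [cyc] using this

lemma cyc_add_bx (P : Fin n → ℕ →₀ ℕ) (β : Fin n × ℕ) :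
    cyc (P + bx (nextRow β)) = cyc P + bx β := by
  funext l
  ext r
  rw [cyc, add_bx_apply, add_bx_apply, cyc]
  congr 1
  refine if_congr ?_ rfl rfl
  exact nextRow_bijective.1.eq_iff (a := β) (b := (l, r))

lemma prod_cyc {K : Type} [CommMonoid K] (f : Fin n → K) : ∏ i, f (i + 1) = ∏ i, f i :=
  Equiv.prod_comp (Equiv.addRight 1) f

lemma isT_cyc {P : Fin n → ℕ →₀ ℕ} : IsT (cyc a) (cyc b) (cyc P) ↔ IsT a b P := by
  refine ⟨fun h => ⟨fun i => ?_, fun i s => ?_⟩, fun h => ⟨fun i => h.1 (i + 1), fun i s =>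
    h.2 (i + 1) s⟩⟩
  · simpa [cyc] using h.1 (i - 1)
  · simpa [cyc] using h.2 (i - 1) s

lemma size_cyc (P : Fin n → ℕ →₀ ℕ) : size (cyc P) = size P :=
  Equiv.sum_comp (Equiv.addRight 1) fun i => (P i).degree

lemma col_cyc (P : Fin n → ℕ →₀ ℕ) (β : Fin n × ℕ) :
    col q₁ q₃ (cyc u) (cyc P) β = col q₁ q₃ u P (nextRow β) := rfl

lemma prod_rows_nextRow {K : Type} [CommMonoid K] (L : ℕ) (f : Fin n × ℕ → K) :
    ∏ β ∈ rows n L, f (nextRow β) = ∏ β ∈ rows n L, f β := by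
  refine Finset.prod_bijective nextRow nextRow_bijective (fun β => ?_) fun _ _ => rfl
  rw [mem_rows, mem_rows]
  rfl

lemma selProd_cyc (P : Fin n → ℕ →₀ ℕ) (S : Fin n × ℕ → Prop) [DecidablePred S] (L : ℕ) (z : ℂ) :
    selProd q₁ q₂ q₃ (cyc u) (cyc P) (fun β => S (nextRow β)) L z =
      selProd q₁ q₂ q₃ u P S L z := by
  simp only [selProd, col_cyc]
  rw [prod_rows_nextRow (L + 1) fun β => if S β then headFactor q₂ (col q₁ q₃ u P β) z else 1,
    prod_rows_nextRow L fun β => if S β then tailFactor q₁ q₃ (col q₁ q₃ u P β) z else 1]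

lemma psiP_cyc (P : Fin n → ℕ →₀ ℕ) (m : ℤ) :
    psiP q₁ q₂ q₃ (cyc u) (cyc P) m = psiP q₁ q₂ q₃ u P m := by
  refine congrArg (fun F : LaurentSeries ℂ => F.coeff m) ?_
  exact prod_cyc fun k => fockPsi (K := LaurentSeries ℂ) (HahnSeries.C q₁) (HahnSeries.C q₂)
    (HahnSeries.C q₃) (P k) (HahnSeries.single (1 : ℤ) (u k))

lemma psiM_cyc (P : Fin n → ℕ →₀ ℕ) (m : ℤ) :
    psiM q₁ q₂ q₃ (cyc u) (cyc P) m = psiM q₁ q₂ q₃ u P m := by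
  refine congrArg (fun F : LaurentSeries ℂ => F.coeff (-m)) ?_
  exact prod_cyc fun k => fockPsi (K := LaurentSeries ℂ) (HahnSeries.C q₁) (HahnSeries.C q₂)
    (HahnSeries.C q₃) (P k) (HahnSeries.single (-1 : ℤ) (u k))

/-- A function with given multiplicative increments. -/
lemma exists_potential {r : (Fin n → ℕ →₀ ℕ) → Fin n × ℕ → ℂ}
    (h0 : ∀ P α, IsT a b P → IsT a b (P + bx α) → r P α ≠ 0)
    (hr : ∀ P α β, α ≠ β → IsT a b P → IsT a b (P + bx α) → IsT a b (P + bx β) →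
      r P α * r (P + bx α) β = r P β * r (P + bx β) α) :
    ∃ c : (Fin n → ℕ →₀ ℕ) → ℂ, (∀ P, IsT a b P → c P ≠ 0) ∧
      ∀ P α, IsT a b P → IsT a b (P + bx α) → c (P + bx α) = c P * r P α := by
  classical
  -- The potential is defined by recursion on the number of boxes, along one chosen predecessor in
  -- the index set; tuples without a predecessor get the value 1.
  let below : (Fin n → ℕ →₀ ℕ) → Prop := fun P =>
    ∃ x : (Fin n → ℕ →₀ ℕ) × (Fin n × ℕ), P = x.1 + bx x.2 ∧ IsT a b x.1
  let cs : ℕ → (Fin n → ℕ →₀ ℕ) → ℂ := fun N => Nat.rec (fun _ => 1)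
    (fun _ c P => if h : below P then c h.choose.1 * r h.choose.1 h.choose.2 else 1) N
  have step : ∀ R α, IsT a b R → ∃ R' α', R + bx α = R' + bx α' ∧ IsT a b R' ∧
      cs (size (R + bx α)) (R + bx α) = cs (size R') R' * r R' α' := by
    intro R α hR
    have hb : below (R + bx α) := ⟨(R, α), rfl, hR⟩
    refine ⟨hb.choose.1, hb.choose.2, hb.choose_spec.1, hb.choose_spec.2, ?_⟩
    have hs := congrArg size hb.choose_spec.1
    rw [size_add_bx, size_add_bx] at hs
    rw [size_add_bx, ← Nat.succ_injective hs]
    exact dif_pos hb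
  have incr : ∀ N R α, size R = N → IsT a b R → IsT a b (R + bx α) →
      cs (size (R + bx α)) (R + bx α) = cs (size R) R * r R α := by
    intro N
    induction N with
    | zero =>
      intro R α hN hR _
      obtain ⟨R', α', e, hR', hc⟩ := step R α hR
      have hs := congrArg size e
      rw [size_add_bx, size_add_bx] at hs
      have hα : α = α' := by
        by_contra hne
        obtain ⟨S, hS⟩ := exists_of_add_eq_add hne e
        rw [hS, size_add_bx] at hN
        omega
      subst hα
      rw [hc, add_right_cancel e]
    | succ N ih =>
      intro R α hN hR hRα
      obtain ⟨R', α', e, hR', hc⟩ := step R α hR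
      by_cases hα : α = α'
      · subst hα
        rw [hc, add_right_cancel e]
      -- The given and the chosen predecessor are both one box above S, which lies in the index set
      -- by `isT_meet`. The hypothesis `hr` on this square, with induction at S, gives independence
      -- of the choice.
      · obtain ⟨S, rfl⟩ := exists_of_add_eq_add hα e
        obtain rfl : R' = S + bx α := by
          rw [add_right_comm] at e
          exact (add_right_cancel e).symm
        have hS := isT_meet hα hR' hR
        have hN' : size S = N := by rw [size_add_bx] at hN; omega
        rw [hc, ih S α hN' hS hR', ih S α' hN' hS hR, mul_assoc, mul_assoc,
          hr S α α' hα hS hR' hR]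
  refine ⟨fun P => cs (size P) P, fun P => ?_, fun P α => incr _ P α rfl⟩
  have nonzero : ∀ N P, IsT a b P → cs N P ≠ 0 := by
    intro N
    induction N with
    | zero => exact fun P _ => one_ne_zero
    | succ N ih =>
      intro P hP
      by_cases hb : below P
      · have : cs (N + 1) P = cs N hb.choose.1 * r hb.choose.1 hb.choose.2 := dif_pos hb
        rw [this]
        exact mul_ne_zero (ih _ hb.choose_spec.2) (h0 _ _ hb.choose_spec.2
          (hb.choose_spec.1 ▸ hP))
      · have : cs (N + 1) P = 1 := dif_neg hb
        rw [this]
        exact one_ne_zero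
  exact nonzero _ P

namespace Resonant

lemma cyc (h : Resonant q₁ q₂ q₃ u a b) :
    Resonant q₁ q₂ q₃ (QuantumCgl.cyc u) (QuantumCgl.cyc a) (QuantumCgl.cyc b) where
  two_le := h.two_le
  hq := h.hq
  u_ne i := h.u_ne (i + 1)
  shift i := h.shift (i + 1)
  res x y hxy := by
    have e : ∀ c : Fin n → ℕ, ∑ i, (QuantumCgl.cyc c i + 1) = ∑ i, (c i + 1) := fun c =>
      Equiv.sum_comp (Equiv.addRight 1) fun i => c i + 1
    rw [e, e]
    exact h.res x y hxy

lemma eCoef_ne_zero (h : Resonant q₁ q₂ q₃ u a b) {P : Fin n → ℕ →₀ ℕ} {α : Fin n × ℕ}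
    (hP : IsT a b P) (hα : IsT a b (P + bx α)) : eCoef q₁ q₂ q₃ u a b P α ≠ 0 :=
  h.coefBy_ne_zero (inv_ne_zero h.one_sub_q₁_ne) prec_rowOrder hP hα

/-- The products of the coefficients of `e(z)` and `f(z)` are invariant under the cyclic shift. -/
lemma eCoef_mul_fCoef_cyc (h : Resonant q₁ q₂ q₃ u a b) {P : Fin n → ℕ →₀ ℕ} {β : Fin n × ℕ}
    (hP : IsT a b P) (hα : IsT a b (P + bx (nextRow β))) :
    eCoef q₁ q₂ q₃ (QuantumCgl.cyc u) (QuantumCgl.cyc a) (QuantumCgl.cyc b)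
        (QuantumCgl.cyc P) β *
      fCoef q₁ q₂ q₃ (QuantumCgl.cyc u) (QuantumCgl.cyc a) (QuantumCgl.cyc b)
        (QuantumCgl.cyc P) β =
      eCoef q₁ q₂ q₃ u a b P (nextRow β) * fCoef q₁ q₂ q₃ u a b P (nextRow β) := by
  rw [h.cyc.eCoef_mul_fCoef (isT_cyc.2 hP) (by rw [← cyc_add_bx]; exact isT_cyc.2 hα)
    (L := size P + 1) (by rw [size_cyc]), h.eCoef_mul_fCoef hP hα le_rfl, col_cyc,
    ← selProd_cyc P fun γ => γ ≠ nextRow β]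
  congr 1
  exact selProd_congr (S := fun γ => γ ≠ β) (S' := fun γ => nextRow γ ≠ nextRow β)
    (fun γ => nextRow_bijective.1.ne_iff.symm) fun _ _ => rfl

/-- The constants in the isomorphism. -/
lemma exists_constants (h : Resonant q₁ q₂ q₃ u a b) :
    ∃ c : (Fin n → ℕ →₀ ℕ) → ℂ, (∀ P, IsT a b P → c P ≠ 0) ∧
      ∀ P β, IsT a b P → IsT a b (P + bx (nextRow β)) →
        c (P + bx (nextRow β)) * eCoef q₁ q₂ q₃ u a b P (nextRow β) =
          c P * eCoef q₁ q₂ q₃ (QuantumCgl.cyc u) (QuantumCgl.cyc a) (QuantumCgl.cyc b)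
            (QuantumCgl.cyc P) β := by
  -- The inverse relabelling of rows, so that the increments are indexed by rows before the shift.
  obtain ⟨rot, hrot⟩ := nextRow_bijective (n := n).2.hasRightInverse
  have cyc_add : ∀ (P : Fin n → ℕ →₀ ℕ) α, QuantumCgl.cyc (P + bx α) =
      QuantumCgl.cyc P + bx (rot α) := fun P α => by rw [← cyc_add_bx, hrot]
  have cyc_col : ∀ (P : Fin n → ℕ →₀ ℕ) α, col q₁ q₃ (QuantumCgl.cyc u) (QuantumCgl.cyc P) (rot α) =
      col q₁ q₃ u P α := fun P α => by rw [col_cyc, hrot]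
  have ne : ∀ P α, IsT a b P → IsT a b (P + bx α) → eCoef q₁ q₂ q₃ (QuantumCgl.cyc u)
      (QuantumCgl.cyc a) (QuantumCgl.cyc b) (QuantumCgl.cyc P) (rot α) ≠ 0 := fun P α hP hα =>
    h.cyc.eCoef_ne_zero (isT_cyc.2 hP) (by rw [← cyc_add]; exact isT_cyc.2 hα)
  obtain ⟨c, hc, hc'⟩ := exists_potential (a := a) (b := b) (r := fun P α =>
      eCoef q₁ q₂ q₃ (QuantumCgl.cyc u) (QuantumCgl.cyc a) (QuantumCgl.cyc b) (QuantumCgl.cyc P)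
        (rot α) / eCoef q₁ q₂ q₃ u a b P α)
    (fun P α hP hα => div_ne_zero (ne P α hP hα) (h.eCoef_ne_zero hP hα)) (by
      intro P α β hne hP hα hβ
      have hαβ := isT_join hne hα hβ
      have hβα : IsT a b (P + bx β + bx α) := by rwa [add_right_comm]
      have hne' : rot α ≠ rot β := fun e => hne (by rw [← hrot α, e, hrot])
      -- The same two boxes satisfy the quadratic relation before and after the shift, with
      -- identical colours and hence identical, non-zero g's; dividing one by the other gives the
      -- condition on the square.
      have r1 := h.coefBy_quadratic (c := (1 - q₁)⁻¹) prec_rowOrder P hne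
      have r2 := h.cyc.coefBy_quadratic (c := (1 - q₁)⁻¹) prec_rowOrder (QuantumCgl.cyc P) hne'
      rw [cyc_col, cyc_col, ← cyc_add, ← cyc_add] at r2
      have fold : ∀ (u : Fin n → ℂ) a b P α, coefBy q₁ q₂ q₃ u a b (1 - q₁)⁻¹ Prec P α =
          eCoef q₁ q₂ q₃ u a b P α := fun _ _ _ _ _ => rfl
      simp only [fold] at r1 r2
      have g1 := h.gpol_ne_zero hP hα hβ
      have g2 := h.gpol_ne_zero hP hβ hα
      have n1 := h.eCoef_ne_zero hP hα
      have n2 := h.eCoef_ne_zero hP hβ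
      have n3 := h.eCoef_ne_zero hα hαβ
      have n4 := h.eCoef_ne_zero hβ hβα
      rw [div_mul_div_comm, div_mul_div_comm, div_eq_div_iff (mul_ne_zero n1 n3)
        (mul_ne_zero n2 n4)]
      apply mul_right_cancel₀ (mul_ne_zero g1 g2)
      linear_combination (gpol q₁ q₂ q₃ (col q₁ q₃ u P α) (col q₁ q₃ u P β) *
        eCoef q₁ q₂ q₃ u a b P β * eCoef q₁ q₂ q₃ u a b (P + bx β) α) * r2 -
        (gpol q₁ q₂ q₃ (col q₁ q₃ u P α) (col q₁ q₃ u P β) *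
        eCoef q₁ q₂ q₃ (QuantumCgl.cyc u) (QuantumCgl.cyc a) (QuantumCgl.cyc b)
          (QuantumCgl.cyc P) (rot β) * eCoef q₁ q₂ q₃ (QuantumCgl.cyc u) (QuantumCgl.cyc a)
          (QuantumCgl.cyc b) (QuantumCgl.cyc (P + bx β)) (rot α)) * r1)
  refine ⟨c, hc, fun P β hP hβ => ?_⟩
  have hrot' : rot (nextRow β) = β := nextRow_bijective.1 (hrot _)
  rw [hc' P _ hP hβ, hrot', mul_assoc, div_mul_cancel₀ _ (h.eCoef_ne_zero hP hβ)]

end Resonant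

end Cyclic

/-! ### The rescaled permutation as an isomorphism of modules. -/

section Isomorphism

variable {n : ℕ} [NeZero n] {q₁ q₂ q₃ : ℂ} {u : Fin n → ℂ} {a b : Fin n → ℕ}

lemma shift_bijective : Function.Bijective (Tuples.shift (a := a) (b := b)) := by
  refine ⟨fun P Q h => Subtype.ext (cyc_injective (congrArg Subtype.val h)), fun Q => ?_⟩
  have e : cyc (fun i => Q.1 (i - 1)) = Q.1 := by
    funext i
    simp [cyc]
  have hP : IsT a b fun i => Q.1 (i - 1) := isT_cyc.1 (by rw [e]; exact Q.2)
  exact ⟨⟨_, hP⟩, Subtype.ext e⟩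

/-- The diagonal operator with non-zero eigenvalues `c` as an isomorphism. -/
def diagIso (c : (Fin n → ℕ →₀ ℕ) → ℂ) (hc : ∀ P, IsT a b P → c P ≠ 0) :
    Space a b ≃ₗ[ℂ] Space a b :=
  LinearEquiv.ofLinearMap (diagOp a b c) (diagOp a b fun P => (c P)⁻¹)
    ((diagOp_mul _ _).trans ((diagOp_congr fun P hP => mul_inv_cancel₀ (hc P hP)).trans diagOp_one))
    ((diagOp_mul _ _).trans ((diagOp_congr fun P hP => inv_mul_cancel₀ (hc P hP)).trans
      diagOp_one))

/-- The linear isomorphism which permutes the tensor factors cyclically and rescales. -/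
def shiftIso (c : (Fin n → ℕ →₀ ℕ) → ℂ) (hc : ∀ P, IsT a b P → c P ≠ 0) :
    Space a b ≃ₗ[ℂ] Space (cyc a) (cyc b) :=
  (diagIso c hc).trans (Finsupp.domLCongr (Equiv.ofBijective _ shift_bijective))

lemma shiftIso_ket (c : (Fin n → ℕ →₀ ℕ) → ℂ) (hc : ∀ P, IsT a b P → c P ≠ 0) (P : Tuples a b) :
    shiftIso c hc (ket P) = c P.1 • ket P.shift := by
  have h : diagIso c hc (ket P) = c P.1 • ket P := diagOp_ket c P
  rw [shiftIso, LinearEquiv.trans_apply, h, map_smul, ket, Finsupp.domLCongr_single]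
  rfl

lemma shiftIso_apply (c : (Fin n → ℕ →₀ ℕ) → ℂ) (hc : ∀ P, IsT a b P → c P ≠ 0) (v : Space a b)
    (Q : Tuples a b) : shiftIso c hc v Q.shift = c Q.1 * v Q := by
  induction v using Finsupp.induction_linear with
  | zero => simp
  | add v w hv hw => rw [map_add, Finsupp.add_apply, Finsupp.add_apply, hv, hw, mul_add]
  | single P t =>
    have : (Finsupp.single P t : Space a b) = t • ket P := by simp [ket]
    rw [this, map_smul, shiftIso_ket, Finsupp.smul_apply, Finsupp.smul_apply, Finsupp.smul_apply,
      ket, ket]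
    by_cases hPQ : P = Q
    · subst hPQ
      simp [mul_comm]
    · rw [Finsupp.single_eq_of_ne (Ne.symm hPQ), Finsupp.single_eq_of_ne fun e => hPQ
        (shift_bijective.1 e.symm)]
      simp

lemma shift_eq_add_bx {P Q : Tuples a b} {β : Fin n × ℕ} :
    Q.shift.1 = P.shift.1 + bx β ↔ Q.1 = P.1 + bx (nextRow β) := by
  change cyc Q.1 = cyc P.1 + bx β ↔ _
  rw [← cyc_add_bx, cyc_injective.eq_iff]

lemma ne_of_shift_ne {P Q : Tuples a b} (h : ∀ β, Q.shift.1 ≠ P.shift.1 + bx β) (α : Fin n × ℕ) :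
    Q.1 ≠ P.1 + bx α := by
  obtain ⟨β, rfl⟩ := nextRow_bijective.2 α
  exact fun e => h β (shift_eq_add_bx.2 e)

/-- An operator is intertwined with another one as soon as the matrix coefficients agree. -/
lemma shiftIso_comm {c : (Fin n → ℕ →₀ ℕ) → ℂ} (hc : ∀ P, IsT a b P → c P ≠ 0)
    {A : Module.End ℂ (Space a b)} {A' : Module.End ℂ (Space (cyc a) (cyc b))}
    (h : ∀ P Q : Tuples a b, c Q.1 * A (ket P) Q = c P.1 * A' (ket P.shift) Q.shift) :
    (shiftIso c hc).conjAlgEquiv ℂ A = A' := by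
  have key : (shiftIso c hc).toLinearMap ∘ₗ A = A' ∘ₗ (shiftIso c hc).toLinearMap := by
    refine space_hom_ext fun P => Finsupp.ext fun Q => ?_
    obtain ⟨Q, rfl⟩ := shift_bijective.2 Q
    rw [LinearMap.comp_apply, LinearMap.comp_apply, LinearEquiv.coe_coe, shiftIso_apply,
      shiftIso_ket, map_smul, Finsupp.smul_apply, smul_eq_mul]
    exact h P Q
  rw [LinearEquiv.conjAlgEquiv_apply, ← LinearMap.comp_assoc, key, LinearMap.comp_assoc,
    LinearEquiv.comp_symm, LinearMap.comp_id]

lemma diagOp_shift {χ χ' : (Fin n → ℕ →₀ ℕ) → ℂ} (h : ∀ P, χ' (cyc P) = χ P)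
    (c : (Fin n → ℕ →₀ ℕ) → ℂ) (P Q : Tuples a b) :
    c Q.1 * diagOp a b χ (ket P) Q =
      c P.1 * diagOp (cyc a) (cyc b) χ' (ket P.shift) Q.shift := by
  have h' : χ' P.shift.1 = χ P.1 := h P.1
  rw [diagOp_ket, diagOp_ket, Finsupp.smul_apply, Finsupp.smul_apply, h', ket, ket]
  by_cases hPQ : P = Q
  · subst hPQ
    rw [Finsupp.single_eq_same, Finsupp.single_eq_same]
  · rw [Finsupp.single_eq_of_ne (Ne.symm hPQ), Finsupp.single_eq_of_ne fun e => hPQ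
      (shift_bijective.1 e.symm)]
    simp

lemma opE_shift {c : (Fin n → ℕ →₀ ℕ) → ℂ}
    (hc : ∀ P β, IsT a b P → IsT a b (P + bx (nextRow β)) →
      c (P + bx (nextRow β)) * eCoef q₁ q₂ q₃ u a b P (nextRow β) =
        c P * eCoef q₁ q₂ q₃ (cyc u) (cyc a) (cyc b) (cyc P) β) (m : ℤ) (P Q : Tuples a b) :
    c Q.1 * opE q₁ q₂ q₃ u a b m (ket P) Q =
      c P.1 * opE q₁ q₂ q₃ (cyc u) (cyc a) (cyc b) m (ket P.shift) Q.shift := by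
  rw [opE, opE]
  by_cases hPQ : ∃ β, Q.shift.1 = P.shift.1 + bx β
  · obtain ⟨β, hβ⟩ := hPQ
    have hβ' := shift_eq_add_bx.1 hβ
    rw [upOp_ket_apply hβ, upOp_ket_apply hβ', mode, mode, ← mul_assoc, ← mul_assoc, hβ',
      hc P.1 β P.2 (hβ' ▸ Q.2)]
    rfl
  · rw [not_exists] at hPQ
    rw [upOp_ket_apply_of_ne hPQ, upOp_ket_apply_of_ne (ne_of_shift_ne hPQ), mul_zero, mul_zero]

namespace Resonant

/-- No new condition on c arises: the product of the coefficients of e and f is invariant under the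
shift and the coefficient of e is non-zero, so f rescales inversely to e. -/
lemma opF_shift (h : Resonant q₁ q₂ q₃ u a b) {c : (Fin n → ℕ →₀ ℕ) → ℂ}
    (hc : ∀ P β, IsT a b P → IsT a b (P + bx (nextRow β)) →
      c (P + bx (nextRow β)) * eCoef q₁ q₂ q₃ u a b P (nextRow β) =
        c P * eCoef q₁ q₂ q₃ (QuantumCgl.cyc u) (QuantumCgl.cyc a) (QuantumCgl.cyc b)
          (QuantumCgl.cyc P) β) (m : ℤ) (P Q : Tuples a b) :
    c Q.1 * opF q₁ q₂ q₃ u a b m (ket P) Q =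
      c P.1 * opF q₁ q₂ q₃ (QuantumCgl.cyc u) (QuantumCgl.cyc a) (QuantumCgl.cyc b) m
        (ket P.shift) Q.shift := by
  rw [opF, opF]
  by_cases hPQ : ∃ β, P.shift.1 = Q.shift.1 + bx β
  · obtain ⟨β, hβ⟩ := hPQ
    have hβ' := shift_eq_add_bx.1 hβ
    have hP : IsT a b (Q.1 + bx (nextRow β)) := hβ' ▸ P.2
    have h1 := hc Q.1 β Q.2 hP
    have h2 := h.eCoef_mul_fCoef_cyc Q.2 hP
    have h3 := h.eCoef_ne_zero Q.2 hP
    rw [downOp_ket_apply hβ, downOp_ket_apply hβ', mode, mode, ← mul_assoc, ← mul_assoc, hβ']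
    refine congrArg₂ (· * ·) (mul_left_cancel₀ h3 ?_) rfl
    change _ = eCoef q₁ q₂ q₃ u a b Q.1 (nextRow β) * (c (Q.1 + bx (nextRow β)) *
      fCoef q₁ q₂ q₃ (QuantumCgl.cyc u) (QuantumCgl.cyc a) (QuantumCgl.cyc b)
        (QuantumCgl.cyc Q.1) β)
    linear_combination (-c Q.1) * h2 - fCoef q₁ q₂ q₃ (QuantumCgl.cyc u) (QuantumCgl.cyc a)
      (QuantumCgl.cyc b) (QuantumCgl.cyc Q.1) β * h1
  · rw [not_exists] at hPQ
    rw [downOp_ket_apply_of_ne hPQ, downOp_ket_apply_of_ne (ne_of_shift_ne hPQ), mul_zero,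
      mul_zero]

/-- The cyclic symmetry. -/
lemma exists_shift_iso (h : Resonant q₁ q₂ q₃ u a b) :
    ∃ (c : Tuples a b → ℂ)
      (ι : Space a b ≃ₗ[ℂ] Space (QuantumCgl.cyc a) (QuantumCgl.cyc b)),
      (∀ P, c P ≠ 0) ∧ (∀ P, ι (ket P) = c P • ket P.shift) ∧
        ∀ x v, ι (h.action x v) = h.cyc.action x (ι v) := by
  obtain ⟨c, hc0, hc⟩ := h.exists_constants
  refine ⟨fun P => c P.1, shiftIso c hc0, fun P => hc0 _ P.2, shiftIso_ket c hc0, fun x v => ?_⟩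
  -- Conjugation by the linear isomorphism is a homomorphism of algebras, so it is enough to compare
  -- the two actions on generators.
  have key : ((shiftIso c hc0).conjAlgEquiv ℂ).toAlgHom.comp h.action = h.cyc.action := by
    refine RingQuot.ringQuot_ext' _ _ _ (FreeAlgebra.hom_ext (funext fun g => ?_))
    change (shiftIso c hc0).conjAlgEquiv ℂ (h.action (gen q₁ q₂ q₃ g)) =
      h.cyc.action (gen q₁ q₂ q₃ g)
    rw [h.action_gen, h.cyc.action_gen]
    refine shiftIso_comm hc0 ?_
    cases g with
    | e m => exact opE_shift hc m
    | f m => exact h.opF_shift hc m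
    | psiPlus m =>
      exact diagOp_shift (χ := fun P => psiP q₁ q₂ q₃ u P m)
        (χ' := fun P => psiP q₁ q₂ q₃ (QuantumCgl.cyc u) P m) (fun P => psiP_cyc P _) c
    | psiMinus m =>
      exact diagOp_shift (χ := fun P => psiM q₁ q₂ q₃ u P (-m))
        (χ' := fun P => psiM q₁ q₂ q₃ (QuantumCgl.cyc u) P (-m)) (fun P => psiM_cyc P _) c
    | psiPlusInv =>
      exact diagOp_shift (χ := fun P => (psiP q₁ q₂ q₃ u P 0)⁻¹)
        (χ' := fun P => (psiP q₁ q₂ q₃ (QuantumCgl.cyc u) P 0)⁻¹) (fun P => congrArg _ (psiP_cyc P _)) c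
    | psiMinusInv =>
      exact diagOp_shift (χ := fun P => (psiM q₁ q₂ q₃ u P 0)⁻¹)
        (χ' := fun P => (psiM q₁ q₂ q₃ (QuantumCgl.cyc u) P 0)⁻¹) (fun P => congrArg _ (psiM_cyc P _)) c
  have := LinearMap.congr_fun (DFunLike.congr_fun key x) (shiftIso c hc0 v)
  rw [← this]
  change _ = shiftIso c hc0 (h.action x ((shiftIso c hc0).symm (shiftIso c hc0 v)))
  rw [LinearEquiv.symm_apply_apply]

end Resonant

/-- The relation at the last index, which closes the cycle: the product of all u i equals that of
all u (i + 1), and the product of all w i is 1, so the other n - 1 relations imply it. -/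
lemma cyclic_shift_of_shift (hu : ∀ i, u i ≠ 0) {w : Fin n → ℂ} (hw : ∏ i, w i = 1)
    (hshift : ∀ i : Fin n, (i : ℕ) + 1 < n → u i = u (i + 1) * w i) (i : Fin n) :
    u i = u (i + 1) * w i := by
  classical
  by_cases hi : (i : ℕ) + 1 < n
  · exact hshift i hi
  have hne : ∏ j ∈ Finset.univ.erase i, u (j + 1) ≠ 0 :=
    Finset.prod_ne_zero_iff.2 fun j _ => hu _
  have h1 : ∏ j ∈ Finset.univ.erase i, u j =
      (∏ j ∈ Finset.univ.erase i, u (j + 1)) * ∏ j ∈ Finset.univ.erase i, w j := by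
    rw [← Finset.prod_mul_distrib]
    refine Finset.prod_congr rfl fun j hj => hshift j ?_
    have : (j : ℕ) ≠ i := fun e => Finset.ne_of_mem_erase hj (Fin.ext e)
    omega
  have h2 := Finset.mul_prod_erase Finset.univ u (Finset.mem_univ i)
  have h3 := Finset.mul_prod_erase Finset.univ w (Finset.mem_univ i)
  have h4 := Finset.mul_prod_erase Finset.univ (fun j => u (j + 1)) (Finset.mem_univ i)
  rw [prod_cyc u, ← h2, h1] at h4
  rw [hw] at h3
  apply mul_right_cancel₀ hne
  linear_combination (-w i) * h4 - u i * (∏ j ∈ Finset.univ.erase i, u (j + 1)) * h3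

end Isomorphism

end QuantumCgl

end

theorem mainTheorem9 (n : ℕ) [NeZero n] (hn : 2 ≤ n)
    (q₁ q₂ q₃ : ℂ) (hq : q₁ * q₂ * q₃ = 1)
    (u : Fin n → ℂ) (hu : ∀ i, u i ≠ 0)
    (a b : Fin n → ℕ) (p' p : ℕ)
    (hp' : p' = ∑ i, (a i + 1)) (hp : p = ∑ i, (b i + 1)) (hne : p ≠ p')
    (hshift : ∀ i : Fin n, (i : ℕ) + 1 < n →
      u i = u (i + 1) * q₁ ^ (a i + 1) * q₃ ^ (b i + 1))
    (hres : ∀ x y : ℤ, q₁ ^ x * q₃ ^ y = 1 ↔ ∃ κ : ℤ, x = κ * p' ∧ y = κ * p) :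
    ∃ (ρ : QuantumCgl.Alg q₁ q₂ q₃ →ₐ[ℂ] Module.End ℂ (QuantumCgl.Space a b))
      (ρ' : QuantumCgl.Alg q₁ q₂ q₃ →ₐ[ℂ]
        Module.End ℂ (QuantumCgl.Space (QuantumCgl.cyc a) (QuantumCgl.cyc b))),
      QuantumCgl.IsModuleStructure q₁ q₂ q₃ u a b ρ ∧
      QuantumCgl.IsModuleStructure q₁ q₂ q₃ (QuantumCgl.cyc u) (QuantumCgl.cyc a)
        (QuantumCgl.cyc b) ρ' ∧
      ∃ (c : QuantumCgl.Tuples a b → ℂ)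
        (ι : QuantumCgl.Space a b ≃ₗ[ℂ]
          QuantumCgl.Space (QuantumCgl.cyc a) (QuantumCgl.cyc b)),
        (∀ P, c P ≠ 0) ∧
        (∀ P, ι (QuantumCgl.ket P) = c P • QuantumCgl.ket P.shift) ∧
        (∀ x v, ι (ρ x v) = ρ' x (ι v)) := by
  have hone : q₁ ^ p' * q₃ ^ p = 1 := by
    have := (hres p' p).2 ⟨1, by ring, by ring⟩
    rwa [zpow_natCast, zpow_natCast] at this
  have h : QuantumCgl.Resonant q₁ q₂ q₃ u a b :=
    { two_le := hn
      hq := hq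
      u_ne := hu
      shift := fun i => by
        rw [mul_assoc]
        -- The full product of the ratios is q₁^p' q₃^p, which is 1 by the resonance condition with
        -- κ = 1.
        refine QuantumCgl.cyclic_shift_of_shift (w := fun i => q₁ ^ (a i + 1) * q₃ ^ (b i + 1))
          hu ?_ (fun i hi => by rw [hshift i hi, mul_assoc]) i
        rw [Finset.prod_mul_distrib, Finset.prod_pow_eq_pow_sum, Finset.prod_pow_eq_pow_sum,
          ← hp', ← hp, hone]
      res := fun x y hxy => by
        rw [← hp', ← hp]
        exact (hres x y).1 hxy }
  exact ⟨h.action, h.cyc.action, h.isModuleStructure, h.cyc.isModuleStructure, h.exists_shift_iso⟩
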